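/- For $\mu\in\mathbb R^2$ and a symmetric positive semidefinite matrix $\Sigma\in\mathbb R^{2\times 2}$, let $M_{\mu,\Sigma}(t)=\exp(\mu_1t_1+\mu_2t_2)\cdot\exp\bigl(\tfrac12\sum_{i,j}\sigma_{ij}t_it_j\bigr)=\sum_{a,b}\frac{m_{ab}}{a!\,b!}t_1^at_2^b$ be the moment generating function of the Gaussian distribution with mean $\mu$ and covariance matrix $\Sigma$; the moment generating function of the mixture with parameters $(\lambda,\mu,\Sigma,\nu,T)$, $\lambda\in[0,1]$, is $\lambda M_{\mu,\Sigma}+(1-\lambda)M_{\nu,T}$. Let $\mathbb P^9$ be the complex projective space with homogeneous coordinates $m_{ab}$, $a+b\le 3$. The moments of order at most $3$ of a Gaussian or of a mixture of two Gaussians give a point in $\mathbb P^9$ (with $m_{00}=1$). Let $\mathcal G_{2,3}\subset\mathbb P^9$ be the Zariski closure of the set of points given by all Gaussians, and $\sigma_2(\mathcal G_{2,3})$ the Zariski closure of the set of points given by all mixtures of two Gaussians. The equal-means (respectively equal-variances) submodel of $\sigma_2(\mathcal G_{2,3})$ is the Zariski closure of the set of points given by the mixtures with $\mu=\nu$ (respectively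 $\Sigma=T$). **Proposition.** (1) The equal-means submodel of $\sigma_2(\mathcal G_{2,3})$ is equal to $\mathcal G_{2,3}$; it has dimension $5$ and degree $16$. (2) The equal-variances submodel of $\sigma_2(\mathcal G_{2,3})$ has dimension $7$ and degree $15$ in $\mathbb P^9$. Its homogeneous vanishing ideal in $\mathbb C[m_{ab} : a+b\le 3]$ is Cohen–Macaulay (that is, the quotient ring by it is a Cohen–Macaulay ring) and is generated by the maximal ($5\times5$) minors of the $6\times5$ matrix $$\begin{pmatrix} 0&0&m_{00}&m_{10}&m_{01}\\ 0&m_{10}&m_{20}&m_{30}&m_{21}\\ m_{01}&0&m_{02}&m_{12}&m_{03}\\ 0&m_{00}&2m_{10}&2m_{20}&2m_{11}\\ m_{00}&0&2m_{01}&2m_{11}&2m_{02}\\ m_{10}&m_{01}&2m_{11}&2m_{21}&2m_{12} \end{pmatrix}.$$ -/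

import Mathlib

open scoped LinearAlgebra.Projectivization Nat

noncomputable section

namespace GaussianMoments

/-! ### Moments of Gaussians and of mixtures of two Gaussians -/

/-- The multi-indices `(i₁, …, iₙ)` of order `i₁ + ⋯ + iₙ ≤ d`; they index the homogeneous
coordinates of the projective space of moments. -/
abbrev Idx (n d : ℕ) : Type := {i : Fin n →₀ ℕ // i.degree ≤ d}

/-- The moment generating function
`exp (∑ μᵢ tᵢ) * exp (½ ∑ σᵢⱼ tᵢ tⱼ)`, a formal power series in `t₁, …, tₙ`. -/
def gaussianMGF {n : ℕ} (μ : Fin n → ℝ) (S : Matrix (Fin n) (Fin n) ℝ) :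
    MvPowerSeries (Fin n) ℝ :=
  (PowerSeries.exp ℝ).subst (∑ i, μ i • (MvPowerSeries.X i : MvPowerSeries (Fin n) ℝ)) *
    (PowerSeries.exp ℝ).subst ((1 / 2 : ℝ) •
      ∑ i, ∑ j, S i j • (MvPowerSeries.X i * MvPowerSeries.X j : MvPowerSeries (Fin n) ℝ))

/-- The moment `m_i` of an exponential generating function `M = ∑ m_i / i! t^i`. -/
def momentOf {n : ℕ} (M : MvPowerSeries (Fin n) ℝ) (i : Fin n →₀ ℕ) : ℝ :=
  (∏ k, ((i k)! : ℝ)) * MvPowerSeries.coeff i M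

/-- The parameters of a mixture `w · N(mean₁, cov₁) + (1 - w) · N(mean₂, cov₂)` of two
Gaussian distributions on `ℝⁿ`. -/
structure Mixture (n : ℕ) where
  w : ℝ
  mean₁ : Fin n → ℝ
  mean₂ : Fin n → ℝ
  cov₁ : Matrix (Fin n) (Fin n) ℝ
  cov₂ : Matrix (Fin n) (Fin n) ℝ
  w_mem : w ∈ Set.Icc (0 : ℝ) 1
  posSemidef₁ : cov₁.PosSemidef
  posSemidef₂ : cov₂.PosSemidef

/-- The moment generating function of a mixture. -/
def Mixture.mgf {n : ℕ} (θ : Mixture n) : MvPowerSeries (Fin n) ℝ :=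
  θ.w • gaussianMGF θ.mean₁ θ.cov₁ + (1 - θ.w) • gaussianMGF θ.mean₂ θ.cov₂

/-- The vector of moments of order at most `d`, as a complex vector. -/
def momentVector {n : ℕ} (d : ℕ) (M : MvPowerSeries (Fin n) ℝ) : Idx n d → ℂ :=
  fun i => (momentOf M i.1 : ℂ)

theorem constantCoeff_gaussianMGF {n : ℕ} (μ : Fin n → ℝ) (S : Matrix (Fin n) (Fin n) ℝ) :
    MvPowerSeries.constantCoeff (gaussianMGF μ S) = 1 := by
  have key : ∀ a : MvPowerSeries (Fin n) ℝ, MvPowerSeries.constantCoeff a = 0 →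
      MvPowerSeries.constantCoeff ((PowerSeries.exp ℝ).subst a) = 1 := by
    intro a ha
    have hs := PowerSeries.HasSubst.of_constantCoeff_zero ha
    have h1 := PowerSeries.subst_add hs 1 (PowerSeries.exp ℝ - 1)
    have h2 : (1 : PowerSeries ℝ).subst a = 1 := by
      rw [← PowerSeries.coe_substAlgHom hs, map_one]
    rw [add_sub_cancel] at h1
    rw [h1, map_add, h2, PowerSeries.constantCoeff_subst_eq_zero ha _ (by simp), map_one, add_zero]
  rw [gaussianMGF, map_mul, key _ (by simp), key _ (by simp), one_mul]

theorem constantCoeff_mgf {n : ℕ} (θ : Mixture n) :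
    MvPowerSeries.constantCoeff θ.mgf = 1 := by
  simp [Mixture.mgf, MvPowerSeries.smul_eq_C_mul, constantCoeff_gaussianMGF]

theorem momentVector_ne_zero {n : ℕ} (d : ℕ) {M : MvPowerSeries (Fin n) ℝ}
    (hM : MvPowerSeries.constantCoeff M = 1) : momentVector d M ≠ 0 := by
  intro h
  have h0 := congrFun h ⟨0, by simp⟩
  simp [momentVector, momentOf, hM] at h0

/-! ### Projective varieties -/

/-- The Zariski topology on complex projective space: the complements of the hypersurfaces
`{f = 0}`, `f` homogeneous, form a basis of open sets. -/
instance zariskiTopology (ι : Type) : TopologicalSpace (ℙ ℂ (ι → ℂ)) :=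
  TopologicalSpace.generateFrom
    {U | ∃ (f : MvPolynomial ι ℂ) (m : ℕ), f.IsHomogeneous m ∧
      U = {p | MvPolynomial.eval p.rep f ≠ 0}}

/-- The homogeneous vanishing ideal of a set of points of projective space: all polynomials
that vanish at all nonzero vectors representing a point of the set. -/
def homogeneousIdeal {ι : Type} (X : Set (ℙ ℂ (ι → ℂ))) : Ideal (MvPolynomial ι ℂ) :=
  MvPolynomial.vanishingIdeal ℂ {v : ι → ℂ | ∃ hv : v ≠ 0, Projectivization.mk ℂ v hv ∈ X}

/-- The homogeneous coordinate ring. -/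
abbrev CoordinateRing {ι : Type} (X : Set (ℙ ℂ (ι → ℂ))) : Type :=
  MvPolynomial ι ℂ ⧸ homogeneousIdeal X

/-- The Hilbert function: the dimension of the degree-`m` part of the homogeneous coordinate
ring. -/
def hilbertFunction {ι : Type} (X : Set (ℙ ℂ (ι → ℂ))) (m : ℕ) : ℕ :=
  Module.finrank ℂ ((MvPolynomial.homogeneousSubmodule ι ℂ m).map
    (Ideal.Quotient.mkₐ ℂ (homogeneousIdeal X)).toLinearMap)

/-- `X` has degree `e`: its Hilbert polynomial `P`, of degree `r` say, has leading coefficient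
`e / r!`. -/
def HasDegree {ι : Type} (X : Set (ℙ ℂ (ι → ℂ))) (e : ℕ) : Prop :=
  ∃ P : Polynomial ℚ,
    (∀ᶠ m : ℕ in Filter.atTop, (hilbertFunction X m : ℚ) = P.eval (m : ℚ)) ∧
      (P.natDegree ! : ℚ) * P.leadingCoeff = e

/-! ### The varieties of moments -/

/-- The point of projective space given by the moments of order at most `d` of a Gaussian. -/
def gaussianPoint {n : ℕ} (d : ℕ) (μ : Fin n → ℝ) (S : Matrix (Fin n) (Fin n) ℝ) :
    ℙ ℂ (Idx n d → ℂ) :=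
  Projectivization.mk ℂ (momentVector d (gaussianMGF μ S))
    (momentVector_ne_zero d (constantCoeff_gaussianMGF μ S))

/-- The point of projective space given by the moments of order at most `d` of a mixture. -/
def Mixture.point {n : ℕ} (d : ℕ) (θ : Mixture n) : ℙ ℂ (Idx n d → ℂ) :=
  Projectivization.mk ℂ (momentVector d θ.mgf) (momentVector_ne_zero d (constantCoeff_mgf θ))

/-- The Gaussian moment variety `𝒢_{n,d}`: the Zariski closure of the set of moment vectors of
Gaussian distributions. -/
def gaussianVariety (n d : ℕ) : Set (ℙ ℂ (Idx n d → ℂ)) :=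
  closure {p | ∃ (μ : Fin n → ℝ) (S : Matrix (Fin n) (Fin n) ℝ),
    S.PosSemidef ∧ p = gaussianPoint d μ S}

/-- The submodel of the secant variety `σ₂(𝒢_{n,d})` given by a set `C` of parameters: the
Zariski closure of the set of moment vectors of the mixtures in `C`. The variety
`σ₂(𝒢_{n,d})` itself is the case `C = Set.univ`. -/
def submodel (n d : ℕ) (C : Set (Mixture n)) : Set (ℙ ℂ (Idx n d → ℂ)) :=
  closure (Mixture.point d '' C)

/-- The submodel of mixtures of two Gaussians with the same mean. -/
def equalMeans (n d : ℕ) : Set (ℙ ℂ (Idx n d → ℂ)) :=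
  submodel n d {θ | θ.mean₁ = θ.mean₂}

/-- The submodel of mixtures of two Gaussians with the same covariance matrix. -/
def equalVariances (n d : ℕ) : Set (ℙ ℂ (Idx n d → ℂ)) :=
  submodel n d {θ | θ.cov₁ = θ.cov₂}

/-! ### Cohen–Macaulay rings and determinantal ideals -/

/-- A (Noetherian) local ring is Cohen–Macaulay if it has a regular sequence whose length is the
Krull dimension. -/
def IsCohenMacaulayLocal (R : Type*) [CommRing R] [IsLocalRing R] : Prop :=
  ∃ rs : List R, RingTheory.Sequence.IsRegular R rs ∧
    ((rs.length : ℕ∞) : WithBot ℕ∞) = ringKrullDim R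

/-- A Noetherian ring is Cohen–Macaulay if its localizations at maximal ideals are. -/
def IsCohenMacaulay (R : Type*) [CommRing R] : Prop :=
  IsNoetherianRing R ∧ ∀ (p : Ideal R) [p.IsMaximal], IsCohenMacaulayLocal (Localization.AtPrime p)

/-- The ideal generated by the maximal minors of an `r × c` matrix with `c ≤ r`. -/
def maximalMinors {R : Type*} [CommRing R] {r c : ℕ} (A : Matrix (Fin r) (Fin c) R) : Ideal R :=
  Ideal.span (Set.range fun e : Fin c ↪o Fin r => (A.submatrix e id).det)

/-- The coordinate `m_{ab}` on the space of bivariate moments of order at most `3`. -/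
def m (a b : ℕ) (h : a + b ≤ 3 := by decide) : MvPolynomial (Idx 2 3) ℂ :=
  MvPolynomial.X ⟨Finsupp.equivFunOnFinite.symm ![a, b], by
    simpa [Finsupp.degree_eq_sum, Fin.sum_univ_two] using h⟩

/-- The `6 × 5` matrix of linear forms. -/
def hilbertBurchMatrix : Matrix (Fin 6) (Fin 5) (MvPolynomial (Idx 2 3) ℂ) :=
  !![0, 0, m 0 0, m 1 0, m 0 1;
     0, m 1 0, m 2 0, m 3 0, m 2 1;
     m 0 1, 0, m 0 2, m 1 2, m 0 3;
     0, m 0 0, 2 * m 1 0, 2 * m 2 0, 2 * m 1 1;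
     m 0 0, 0, 2 * m 0 1, 2 * m 1 1, 2 * m 0 2;
     m 1 0, m 0 1, 2 * m 1 1, 2 * m 2 1, 2 * m 1 2]

end GaussianMoments

end

namespace GaussianMoments

open MvPolynomial

attribute [local instance] MvPolynomial.gradedAlgebra

/-! ### The Zariski topology and homogeneous vanishing ideals -/

section Projective

variable {ι : Type}

/-! Both varieties are treated through a polynomial parametrization of the affine cone. Positive
semidefinite parameters contain a product of real intervals, on which only the zero polynomial
vanishes, so the vanishing ideal is the kernel of the parametrization
(`homogeneousIdeal_closure_eq_ker`). The coordinate ring therefore embeds into a polynomial ring in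
6, respectively 8, variables, which bounds the dimension by 5, respectively 7. Equality comes from
an explicit flag of irreducible closed subsets (`le_topologicalKrullDim`).

Equal means: for a fixed mean, the moments of order at most 3 are affine in the covariance, so a
mixture has the moments of the Gaussian with the averaged covariance. For the degree, use $w$, the
mean $(x,y)$ and $a=w(\sigma_{11}+x^2/3)$, with $b,c$ defined likewise. Every moment then lies in
the span of the monomials of degree 1 in $w,a,b,c$ whose degree in $x,y$ is at most $2$ for $w$ and
at most $1$ for $a,b,c$. The graded ring spanned by the corresponding monomials in all degrees is
contained in a finite extension of the ring of moments with the same localization at $w$, so a fixed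
power $w^N$ carries it into the ring of moments. If $Q(n)$ counts its monomials of degree $n$, the
Hilbert function of the variety lies between $Q(n-N)$ and $Q(n)$. Hence the degree is
$5!\cdot\frac{2}{15}=16$, the normalized volume of a polytope.

Equal variances: the third cumulants of the mixture form the cube of a linear form, while the mean
and the second cumulants are free. This gives the matrix a kernel vector along the variety, so its
maximal minors vanish there. Let $J$ be the ideal of minors and $S$ the polynomial ring. Modulo
eight linear forms the six minors span all binary quintics in $m_{10},m_{01}$, so the 15 monomials
of degree at most 4 in these variables generate $S/J$ over the polynomial ring in the eight forms.
The columns of the matrix are syzygies of the minors, which bounds the Hilbert function of $S/J$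
from below. Since $(1+2t+3t^2+4t^3+5t^4)(1-t)^2=1-6t^5+5t^6$, the two bounds agree and $S/J$ is free
of rank 15 (`quotientHilbert_hilbertBurch`, `eq_zero_of_stdCombination_mem`). Freeness gives
Cohen–Macaulayness, the degree $15$, and the fact that $m_{00}$ is a nonzerodivisor. After inverting
$m_{00}$, cumulant coordinates turn the variety into affine space times the cone over a twisted
cubic, whose three quadrics come from minors. Hence $J$ is the whole vanishing ideal
(`homogeneousIdeal_equalVariances_eq`). -/

theorem eval_smul_of_isHomogeneous {R : Type*} [CommSemiring R] {f : MvPolynomial ι R} {n : ℕ}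
    (hf : f.IsHomogeneous n) (c : R) (v : ι → R) : eval (c • v) f = c ^ n * eval v f := by
  rw [eval_eq, eval_eq, Finset.mul_sum]
  refine Finset.sum_congr rfl fun d hd => ?_
  have : n = ∑ i ∈ d.support, d i := hf.degree_eq_sum_deg_support hd
  simp only [Pi.smul_apply, smul_eq_mul, mul_pow, Finset.prod_mul_distrib]
  rw [Finset.prod_pow_eq_pow_sum, ← this]
  ring

theorem eval_rep_mk_eq_zero_iff {f : MvPolynomial ι ℂ} {n : ℕ} (hf : f.IsHomogeneous n)
    {v : ι → ℂ} (hv : v ≠ 0) :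
    eval (Projectivization.mk ℂ v hv).rep f = 0 ↔ eval v f = 0 := by
  obtain ⟨a, ha⟩ := Projectivization.exists_smul_eq_mk_rep ℂ v hv
  rw [← ha, Units.smul_def, eval_smul_of_isHomogeneous hf]
  simp

theorem mem_homogeneousIdeal {X : Set (ℙ ℂ (ι → ℂ))} {f : MvPolynomial ι ℂ} :
    f ∈ homogeneousIdeal X ↔
      ∀ (v : ι → ℂ) (hv : v ≠ 0), Projectivization.mk ℂ v hv ∈ X → eval v f = 0 := by
  simp only [homogeneousIdeal, mem_vanishingIdeal_iff, Set.mem_ofPred_eq, forall_exists_index]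
  exact Iff.rfl

theorem eval_rep_eq_zero {X : Set (ℙ ℂ (ι → ℂ))} {f : MvPolynomial ι ℂ}
    (hf : f ∈ homogeneousIdeal X) {p : ℙ ℂ (ι → ℂ)} (hp : p ∈ X) : eval p.rep f = 0 :=
  mem_homogeneousIdeal.1 hf _ p.rep_nonzero (by rwa [Projectivization.mk_rep])

theorem mem_homogeneousIdeal_of_isHomogeneous {X : Set (ℙ ℂ (ι → ℂ))} {f : MvPolynomial ι ℂ}
    {n : ℕ} (hf : f.IsHomogeneous n) (h : ∀ p ∈ X, eval p.rep f = 0) :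
    f ∈ homogeneousIdeal X :=
  mem_homogeneousIdeal.2 fun _ hv hX => (eval_rep_mk_eq_zero_iff hf hv).1 (h _ hX)

theorem homogeneousIdeal_anti {X Y : Set (ℙ ℂ (ι → ℂ))} (h : X ⊆ Y) :
    homogeneousIdeal Y ≤ homogeneousIdeal X := fun _ hf =>
  mem_homogeneousIdeal.2 fun v hv hX => mem_homogeneousIdeal.1 hf v hv (h hX)

/-- If a polynomial vanishes at all nonzero multiples of a vector, then so do its homogeneous
components. -/
theorem eval_homogeneousComponent_eq_zero {f : MvPolynomial ι ℂ} {v : ι → ℂ}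
    (h : ∀ c : ℂ, c ≠ 0 → eval (c • v) f = 0) (n : ℕ) :
    eval v (homogeneousComponent n f) = 0 := by
  -- The restriction of `f` to the line through `v`, as a polynomial in the scalar; its coefficients
  -- are the values of the homogeneous components, and it has infinitely many roots.
  let P : Polynomial ℂ := ∑ i ∈ Finset.range (f.totalDegree + 1),
    Polynomial.monomial i (eval v (homogeneousComponent i f))
  have hP : ∀ c : ℂ, P.eval c = eval (c • v) f := by
    intro c
    conv_rhs => rw [← sum_homogeneousComponent f]
    simp only [P, Polynomial.eval_finsetSum, map_sum, Polynomial.eval_monomial,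
      eval_smul_of_isHomogeneous (homogeneousComponent_isHomogeneous _ f), mul_comm]
  have hP0 : P = 0 := by
    refine Polynomial.eq_zero_of_infinite_isRoot P
      ((Set.infinite_univ.sdiff (Set.finite_singleton (0 : ℂ))).mono fun c hc => ?_)
    simp only [Set.mem_ofPred_eq, Polynomial.IsRoot, hP]
    exact h c (by simpa using hc)
  by_cases hn : n < f.totalDegree + 1
  · have := congrArg (fun Q => Q.coeff n) hP0
    simpa [P, Polynomial.finsetSum_coeff, Polynomial.coeff_monomial, hn] using this
  · rw [homogeneousComponent_eq_zero _ _ (by omega), map_zero]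

theorem homogeneousComponent_mem_homogeneousIdeal {X : Set (ℙ ℂ (ι → ℂ))}
    {f : MvPolynomial ι ℂ} (hf : f ∈ homogeneousIdeal X) (n : ℕ) :
    homogeneousComponent n f ∈ homogeneousIdeal X := by
  refine mem_homogeneousIdeal.2 fun v hv hX =>
    eval_homogeneousComponent_eq_zero (fun c hc => ?_) n
  refine mem_homogeneousIdeal.1 hf _ (smul_ne_zero hc hv) ?_
  rwa [(Projectivization.mk_eq_mk_iff' ℂ (c • v) v (smul_ne_zero hc hv) hv).2 ⟨c, rfl⟩]

theorem isHomogeneous_homogeneousIdeal (X : Set (ℙ ℂ (ι → ℂ))) :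
    (homogeneousIdeal X).IsHomogeneous (homogeneousSubmodule ι ℂ) := by
  intro n f hf
  have := homogeneousComponent_mem_homogeneousIdeal hf n
  rwa [← decomposition.decompose'_apply] at this

theorem isTopologicalBasis_zariski (ι : Type) :
    TopologicalSpace.IsTopologicalBasis {U : Set (ℙ ℂ (ι → ℂ)) |
      ∃ (f : MvPolynomial ι ℂ) (m : ℕ), f.IsHomogeneous m ∧ U = {p | eval p.rep f ≠ 0}} := by
  have := TopologicalSpace.isTopologicalBasis_of_subbasis_of_inter
    (t := zariskiTopology ι) rfl (by
      rintro _ ⟨f, m, hf, rfl⟩ _ ⟨g, n, hg, rfl⟩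
      refine ⟨f * g, m + n, hf.mul hg, ?_⟩
      ext p
      simp)
  rwa [Set.insert_eq_of_mem] at this
  exact ⟨1, 0, isHomogeneous_one _ _, by simp⟩

theorem isOpen_ne_zero {f : MvPolynomial ι ℂ} {n : ℕ} (hf : f.IsHomogeneous n) :
    IsOpen {p : ℙ ℂ (ι → ℂ) | eval p.rep f ≠ 0} :=
  (isTopologicalBasis_zariski ι).isOpen ⟨f, n, hf, rfl⟩

theorem mem_closure_iff_eval {W : Set (ℙ ℂ (ι → ℂ))} {p : ℙ ℂ (ι → ℂ)} :
    p ∈ closure W ↔ ∀ (f : MvPolynomial ι ℂ) (n : ℕ), f.IsHomogeneous n →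
      f ∈ homogeneousIdeal W → eval p.rep f = 0 := by
  rw [(isTopologicalBasis_zariski ι).mem_closure_iff]
  constructor
  · intro h f n hf hW
    by_contra hp
    obtain ⟨q, hq, hqW⟩ := h _ ⟨f, n, hf, rfl⟩ hp
    exact hq (eval_rep_eq_zero hW hqW)
  · rintro h _ ⟨f, n, hf, rfl⟩ hp
    by_contra hne
    refine hp (h f n hf (mem_homogeneousIdeal_of_isHomogeneous hf fun q hq => ?_))
    by_contra hq'
    exact hne ⟨q, hq', hq⟩

/-- Testing a polynomial on every representative of a point forces each homogeneous component to
vanish, and the vanishing of a form passes to the Zariski closure. -/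
theorem homogeneousIdeal_closure (W : Set (ℙ ℂ (ι → ℂ))) :
    homogeneousIdeal (closure W) = homogeneousIdeal W := by
  refine le_antisymm (homogeneousIdeal_anti subset_closure) fun f hf => ?_
  rw [← sum_homogeneousComponent f]
  refine Ideal.sum_mem _ fun n _ => ?_
  have hn := homogeneousComponent_isHomogeneous n f
  exact mem_homogeneousIdeal_of_isHomogeneous hn fun p hp =>
    mem_closure_iff_eval.1 hp _ n hn (homogeneousComponent_mem_homogeneousIdeal hf n)

theorem mem_of_isClosed {X : Set (ℙ ℂ (ι → ℂ))} (hX : IsClosed X) {v : ι → ℂ} (hv : v ≠ 0)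
    (h : ∀ f ∈ homogeneousIdeal X, eval v f = 0) : Projectivization.mk ℂ v hv ∈ X := by
  rw [← hX.closure_eq, mem_closure_iff_eval]
  intro f n hf hfX
  exact (eval_rep_mk_eq_zero_iff hf hv).2 (h f hfX)

theorem subset_of_homogeneousIdeal_le {X Y : Set (ℙ ℂ (ι → ℂ))} (hY : IsClosed Y)
    (h : homogeneousIdeal Y ≤ homogeneousIdeal X) : X ⊆ Y := by
  intro p hp
  have := mem_of_isClosed hY p.rep_nonzero fun f hf => eval_rep_eq_zero (h hf) hp
  rwa [Projectivization.mk_rep] at this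

/-- Primality of a homogeneous ideal may be tested on forms. Two forms outside the ideal have
nonvanishing loci that are open and meet `X`; by irreducibility these meet inside `X`, where the
product is nonzero. -/
theorem isPrime_homogeneousIdeal {X : Set (ℙ ℂ (ι → ℂ))} (hX : IsIrreducible X) :
    (homogeneousIdeal X).IsPrime := by
  refine (isHomogeneous_homogeneousIdeal X).isPrime_of_homogeneous_mem_or_mem ?_ ?_
  · obtain ⟨p, hp⟩ := hX.nonempty
    intro h
    have h1 : (1 : MvPolynomial ι ℂ) ∈ homogeneousIdeal X := h ▸ Submodule.mem_top
    simpa using eval_rep_eq_zero h1 hp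
  · rintro f g ⟨n, hf⟩ ⟨k, hg⟩ hfg
    by_contra! hcon
    have key : ∀ {h : MvPolynomial ι ℂ} {i : ℕ}, h.IsHomogeneous i → h ∉ homogeneousIdeal X →
        (X ∩ {p | eval p.rep h ≠ 0}).Nonempty := by
      intro h i hh hn
      by_contra hne
      refine hn (mem_homogeneousIdeal_of_isHomogeneous hh fun p hp => ?_)
      by_contra hq
      exact hne ⟨p, hp, hq⟩
    obtain ⟨p, hp, hpf, hpg⟩ := hX.isPreirreducible _ _ (isOpen_ne_zero hf) (isOpen_ne_zero hg)
      (key hf hcon.1) (key hg hcon.2)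
    have := eval_rep_eq_zero hfg hp
    simp only [map_mul, mul_eq_zero] at this
    exact this.elim hpf hpg

end Projective

end GaussianMoments

namespace GaussianMoments

open MvPolynomial

/-! ### Dimension -/

theorem ringKrullDim_le_of_isIntegral (R S : Type*) [CommRing R] [CommRing S] [Algebra R S]
    [Algebra.IsIntegral R S] : ringKrullDim S ≤ ringKrullDim R :=
  Order.krullDim_le_of_strictMono (fun p : PrimeSpectrum S => PrimeSpectrum.comap (algebraMap R S) p)
    fun p _ hpq => Ideal.IsIntegral.comap_lt_comap (I := p.asIdeal) hpq

theorem ringKrullDim_mvPolynomial_fin (n : ℕ) :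
    ringKrullDim (MvPolynomial (Fin n) ℂ) = n := by
  simp

/-- A finitely generated algebra that embeds into a polynomial ring in `n` variables has
dimension at most `n`. -/
theorem ringKrullDim_le_of_injective {A : Type} [CommRing A] [Algebra ℂ A]
    [Algebra.FiniteType ℂ A] {n : ℕ} (f : A →ₐ[ℂ] MvPolynomial (Fin n) ℂ)
    (hf : Function.Injective f) : ringKrullDim A ≤ n := by
  have : Nontrivial A := f.toRingHom.domain_nontrivial
  -- Noether normalization: the dimension of `A` is at most the number `s` of parameters, and `s ≤
  -- n` by comparing transcendence degrees.
  obtain ⟨s, g, hg, hint⟩ := exists_integral_inj_algHom_of_fg ℂ A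
  have hs : s ≤ n := by
    have h1 := trdeg_le_of_injective (f.comp g) (hf.comp hg)
    simpa using h1
  algebraize [g.toRingHom]
  have : Algebra.IsIntegral (MvPolynomial (Fin s) ℂ) A := ⟨hint⟩
  refine (ringKrullDim_le_of_isIntegral (MvPolynomial (Fin s) ℂ) A).trans ?_
  rw [ringKrullDim_mvPolynomial_fin]
  exact_mod_cast hs

section Projective

variable {ι : Type}

/-- A chain of irreducible closed subsets gives a reversed chain of primes over the ideal of `X`,
all strictly below the irrelevant ideal. Adjoining the latter, as the image of a formal bottom
element, lengthens each chain by one; this accounts for the shift between affine and projective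
dimension. -/
theorem topologicalKrullDim_le {X : Set (ℙ ℂ (ι → ℂ))} {n : ℕ}
    (h : ringKrullDim (CoordinateRing X) ≤ (n + 1 : ℕ)) : topologicalKrullDim X ≤ n := by
  rcases isEmpty_or_nonempty (TopologicalSpace.IrreducibleCloseds X) with he | hne
  · rw [topologicalKrullDim, Order.krullDim_eq_bot]
    exact bot_le
  let im (Z : TopologicalSpace.IrreducibleCloseds X) : Set (ℙ ℂ (ι → ℂ)) := Subtype.val '' (Z : Set X)
  have him : ∀ Z, IsIrreducible (im Z) := fun Z =>
    Z.isIrreducible.image _ continuous_subtype_val.continuousOn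
  let irr : Ideal (MvPolynomial ι ℂ) := RingHom.ker (constantCoeff (σ := ι) (R := ℂ))
  have hprime : irr.IsPrime := RingHom.ker_isPrime _
  have hle : ∀ Z, homogeneousIdeal (im Z) ≤ irr := by
    intro Z f hf
    obtain ⟨p, hp⟩ := (him Z).nonempty
    have := eval_rep_eq_zero (homogeneousComponent_mem_homogeneousIdeal hf 0) hp
    simpa [homogeneousComponent_zero, irr, RingHom.mem_ker, constantCoeff_eq] using this
  have hlt : ∀ Z, homogeneousIdeal (im Z) < irr := by
    intro Z
    refine lt_of_le_of_ne (hle Z) fun heq => ?_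
    obtain ⟨p, hp⟩ := (him Z).nonempty
    refine p.rep_nonzero (funext fun i => ?_)
    have hi : (MvPolynomial.X i : MvPolynomial ι ℂ) ∈ homogeneousIdeal (im Z) := by
      rw [heq]; simp [irr, RingHom.mem_ker]
    simpa using eval_rep_eq_zero hi hp
  have hX : ∀ Z, homogeneousIdeal X ≤ homogeneousIdeal (im Z) := fun Z =>
    homogeneousIdeal_anti (by rintro _ ⟨x, -, rfl⟩; exact x.2)
  let Φ : WithBot (TopologicalSpace.IrreducibleCloseds X) →
      (PrimeSpectrum.zeroLocus (homogeneousIdeal X : Set (MvPolynomial ι ℂ)))ᵒᵈ := fun Z =>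
    OrderDual.toDual (Z.recBotCoe ⟨⟨irr, hprime⟩, (hX (Classical.arbitrary _)).trans (hle _)⟩
      fun Z => ⟨⟨homogeneousIdeal (im Z), isPrime_homogeneousIdeal (him Z)⟩, hX Z⟩)
  have hΦ : StrictMono Φ := by
    intro Z₁ Z₂ h12
    induction Z₂ with
    | bot => exact absurd h12 not_lt_bot
    | coe Z₂ =>
      induction Z₁ with
      | bot => exact hlt Z₂
      | coe Z₁ =>
        have h12 : Z₁ < Z₂ := WithBot.coe_lt_coe.1 h12
        change homogeneousIdeal (im Z₂) < homogeneousIdeal (im Z₁)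
        refine lt_of_le_not_ge (homogeneousIdeal_anti (Set.image_mono h12.le)) fun hge => ?_
        refine h12.not_ge ?_
        -- `Z₁` is closed only in `X`, so its image is replaced by its closure in projective space
        -- before the ideals are compared.
        rw [← homogeneousIdeal_closure (im Z₁)] at hge
        have hsub := subset_of_homogeneousIdeal_le isClosed_closure hge
        intro x hx
        have : x ∈ closure (Z₁ : Set X) := closure_subtype.2 (hsub ⟨x, hx, rfl⟩)
        rwa [Z₁.isClosed.closure_eq] at this
  have := Order.krullDim_le_of_strictMono Φ hΦ
  rw [Order.krullDim_withBot, Order.krullDim_orderDual, ← ringKrullDim_quotient] at this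
  have h2 := this.trans h
  push_cast at h2
  exact ENat.WithBot.add_le_add_one_right_iff.1 h2

theorem eval_aeval {σ τ : Type*} (ψ : σ → MvPolynomial τ ℂ) (t : τ → ℂ) (h : MvPolynomial σ ℂ) :
    eval t (aeval ψ h) = eval (fun i => eval t (ψ i)) h := by
  induction h using MvPolynomial.induction_on with
  | C a => simp
  | add p q hp hq => rw [map_add, map_add, map_add, hp, hq]
  | mul_X p i hp => rw [map_mul, map_mul, map_mul, hp, aeval_X, eval_X]

/-- The image of an affine space under a polynomial map to projective space is irreducible. -/
theorem isIrreducible_range_mk {τ : Type} {ψ : ι → MvPolynomial τ ℂ}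
    (hψ : ∀ t : τ → ℂ, (fun i => eval t (ψ i)) ≠ 0) :
    IsIrreducible (Set.range fun t => Projectivization.mk ℂ _ (hψ t)) := by
  refine ⟨Set.range_nonempty _, ?_⟩
  rintro u v hu hv ⟨_, ⟨s, rfl⟩, hs⟩ ⟨_, ⟨t, rfl⟩, ht⟩
  obtain ⟨_, ⟨f, n, hf, rfl⟩, hsf, hfu⟩ :=
    (isTopologicalBasis_zariski ι).exists_subset_of_mem_open hs hu
  obtain ⟨_, ⟨g, k, hg, rfl⟩, htg, hgv⟩ :=
    (isTopologicalBasis_zariski ι).exists_subset_of_mem_open ht hv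
  have hne : ∀ {h : MvPolynomial ι ℂ} {i : ℕ} (t : τ → ℂ), h.IsHomogeneous i →
      (eval (Projectivization.mk ℂ _ (hψ t)).rep h ≠ 0 ↔ eval t (aeval ψ h) ≠ 0) := by
    intro h i t hh
    rw [eval_aeval, Ne, eval_rep_mk_eq_zero_iff hh]
  have h1 : aeval ψ f ≠ 0 := fun h0 => (hne s hf).1 hsf (by rw [h0, map_zero])
  have h2 : aeval ψ g ≠ 0 := fun h0 => (hne t hg).1 htg (by rw [h0, map_zero])
  obtain ⟨r, hr⟩ : ∃ r, eval r (aeval ψ f * aeval ψ g) ≠ 0 := by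
    by_contra! hcon
    exact mul_ne_zero h1 h2 (MvPolynomial.funext fun r => by simpa using hcon r)
  rw [map_mul] at hr
  exact ⟨_, ⟨r, rfl⟩, hfu ((hne r hf).2 (left_ne_zero_of_mul hr)),
    hgv ((hne r hg).2 (right_ne_zero_of_mul hr))⟩

/-- A lower bound for the dimension of a projective variety that contains the image of an affine
space under a polynomial map whose restrictions to the members of the coordinate flag are
separated by coordinate hyperplanes. -/
theorem le_topologicalKrullDim {X : Set (ℙ ℂ (ι → ℂ))} {n : ℕ}
    {ψ : ι → MvPolynomial (Fin n) ℂ} {i₀ : ι} (h₀ : ψ i₀ = 1)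
    (hmem : ∀ t hv, Projectivization.mk ℂ (fun i => eval t (ψ i)) hv ∈ X) (i : Fin n → ι)
    (hz : ∀ j t, (∀ k, j ≤ k → t k = 0) → eval t (ψ (i j)) = 0)
    (hnz : ∀ j, eval (Pi.single j 1) (ψ (i j)) ≠ 0) : (n : WithBot ℕ∞) ≤ topologicalKrullDim X := by
  classical
  -- Only the first `k` parameters are kept. The closures of the images `W k` form the chain: the
  -- coordinate `i j` vanishes on `W` at stage `j` but not at the image of the `j`-th unit vector,
  -- which lies in the next stage.
  let cut (k : Fin (n + 1)) (t : Fin n → ℂ) : Fin n → ℂ :=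
    fun j => if j.castSucc < k then t j else 0
  let ψ' (k : Fin (n + 1)) (a : ι) : MvPolynomial (Fin n) ℂ :=
    aeval (fun j : Fin n => if j.castSucc < k then MvPolynomial.X j else 0) (ψ a)
  have hev : ∀ k t a, eval t (ψ' k a) = eval (cut k t) (ψ a) := by
    intro k t a
    simp only [ψ', cut]
    rw [eval_aeval]
    congr 2
    ext j
    split_ifs <;> simp
  have hne : ∀ k t, (fun a => eval t (ψ' k a)) ≠ 0 := by
    intro k t h
    have := congrFun h i₀
    simp [hev, h₀] at this
  let W (k : Fin (n + 1)) : Set (ℙ ℂ (ι → ℂ)) :=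
    Set.range fun t => Projectivization.mk ℂ _ (hne k t)
  have hWX : ∀ k, W k ⊆ X := by
    rintro k _ ⟨t, rfl⟩
    simp only [hev]
    exact hmem _ _
  have hcut : ∀ {k l : Fin (n + 1)} (t), k ≤ l → cut l (cut k t) = cut k t := by
    intro k l t hkl
    funext j
    simp only [cut]
    split_ifs with h1 h2 h2
    · rfl
    · rfl
    · exact absurd (h2.trans_le hkl) h1
    · rfl
  have hmono : Monotone W := by
    rintro k l hkl _ ⟨t, rfl⟩
    refine ⟨cut k t, ?_⟩
    simp only [hev, hcut t hkl]
  let Z (k : Fin (n + 1)) : TopologicalSpace.IrreducibleCloseds X :=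
    { carrier := closure (Set.range (Set.inclusion (hWX k)))
      isIrreducible' := by
        have := Subtype.irreducibleSpace (isIrreducible_range_mk (hne k))
        rw [← Set.image_univ]
        exact ((IrreducibleSpace.isIrreducible_univ _).image _
          (continuous_inclusion (hWX k)).continuousOn).closure
      isClosed' := isClosed_closure }
  have hrange : ∀ k, ((↑) : X → ℙ ℂ (ι → ℂ)) '' Set.range (Set.inclusion (hWX k)) = W k := by
    intro k
    ext p
    constructor
    · rintro ⟨_, ⟨q, rfl⟩, rfl⟩
      exact q.2
    · intro hp
      exact ⟨_, ⟨⟨p, hp⟩, rfl⟩, rfl⟩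
  have hZ : ∀ k (p : X), p ∈ Z k ↔ (p : ℙ ℂ (ι → ℂ)) ∈ closure (W k) := by
    intro k p
    rw [← hrange k]
    exact closure_subtype
  have hstrict : StrictMono Z := by
    refine Fin.strictMono_iff_lt_succ.2 fun j => lt_of_le_of_ne ?_ ?_
    · intro p hp
      exact (hZ _ _).2 (closure_mono (hmono (Fin.castSucc_lt_succ (i := j)).le) ((hZ _ _).1 hp))
    · intro heq
      let q := Projectivization.mk ℂ _ (hne j.succ (Pi.single j 1))
      have hq : q ∈ W j.succ := ⟨_, rfl⟩
      have hqZ : (⟨q, hWX _ hq⟩ : X) ∈ Z j.succ := (hZ _ _).2 (subset_closure hq)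
      rw [← heq, hZ] at hqZ
      have h0 := mem_closure_iff_eval.1 hqZ (MvPolynomial.X (i j)) 1 (isHomogeneous_X _ _) (by
        refine mem_homogeneousIdeal_of_isHomogeneous (isHomogeneous_X _ _) ?_
        rintro _ ⟨t, rfl⟩
        rw [eval_rep_mk_eq_zero_iff (isHomogeneous_X _ _), eval_X, hev]
        refine hz _ _ fun k hk => if_neg ?_
        simpa using hk)
      rw [eval_rep_mk_eq_zero_iff (isHomogeneous_X _ _), eval_X, hev] at h0
      refine hnz j ?_
      convert h0 using 3
      funext k
      by_cases hk : k = j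
      · subst hk; simp [cut]
      · simp [cut, hk]
  exact Order.LTSeries.length_le_krullDim (LTSeries.mk n Z hstrict)

end Projective

end GaussianMoments

namespace GaussianMoments

open MvPolynomial

attribute [local instance] MvPolynomial.gradedAlgebra

/-! ### Hilbert functions -/

section Hilbert

theorem homogeneousComponent_mul_left {σ R : Type*} [CommRing R] {p : MvPolynomial σ R} {k : ℕ}
    (hp : p.IsHomogeneous k) (q : MvPolynomial σ R) (n : ℕ) :
    homogeneousComponent (k + n) (p * q) = p * homogeneousComponent n q := by
  classical
  have := DirectSum.coe_decompose_mul_add_of_left_mem (homogeneousSubmodule σ R) (i := k) (j := n)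
    (a := p) (b := q) hp
  rwa [← decomposition.decompose'_apply, ← decomposition.decompose'_apply]

theorem homogeneousComponent_mul_left_of_lt {σ R : Type*} [CommRing R] {p : MvPolynomial σ R}
    {k n : ℕ} (hp : p.IsHomogeneous k) (q : MvPolynomial σ R) (hn : n < k) :
    homogeneousComponent n (p * q) = 0 := by
  classical
  have := DirectSum.coe_decompose_mul_of_left_mem_of_not_le (homogeneousSubmodule σ R) (i := k)
    (n := n) (a := p) (b := q) hp (by omega)
  rwa [← decomposition.decompose'_apply]

theorem homogeneousComponent_of_isHomogeneous {σ R : Type*} [CommSemiring R]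
    {p : MvPolynomial σ R} {k : ℕ} (hp : p.IsHomogeneous k) (n : ℕ) :
    homogeneousComponent n p = if n = k then p else 0 :=
  homogeneousComponent_of_mem hp

theorem finrank_restrictSupport {σ : Type} (s : Set (σ →₀ ℕ)) :
    Module.finrank ℂ (restrictSupport ℂ s) = s.ncard := by
  rw [Module.finrank_eq_nat_card_basis (basisRestrictSupport ℂ s), Nat.card_coe_set_eq]

theorem ncard_degree_eq {σ : Type} [Fintype σ] (n : ℕ) :
    {d : σ →₀ ℕ | d.degree = n}.ncard = (Fintype.card σ + n - 1).choose n := by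
  classical
  have : {d : σ →₀ ℕ | d.degree = n} = ((Finset.univ : Finset σ).finsuppAntidiag n : Set _) := by
    ext d
    simp [Finsupp.degree_eq_sum]
  rw [this, Set.ncard_coe_finset, Finset.card_finsuppAntidiag_nat_eq_choose, Finset.card_univ]

theorem finrank_homogeneousSubmodule {σ : Type} [Fintype σ] (n : ℕ) :
    Module.finrank ℂ (homogeneousSubmodule σ ℂ n) = (Fintype.card σ + n - 1).choose n := by
  rw [homogeneousSubmodule_eq_finsupp_supported]
  exact (finrank_restrictSupport _).trans (ncard_degree_eq n)

instance finiteDimensional_homogeneousSubmodule {σ : Type} [Finite σ] (n : ℕ) :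
    FiniteDimensional ℂ (homogeneousSubmodule σ ℂ n) :=
  Module.Finite.iff_fg.2 (homogeneousSubmodule_fg σ ℂ n)

variable {ι : Type}

/-- The dimension of the degree-`n` part of the quotient by an ideal. -/
noncomputable def quotientHilbert (I : Ideal (MvPolynomial ι ℂ)) (n : ℕ) : ℕ :=
  Module.finrank ℂ ((homogeneousSubmodule ι ℂ n).map (Ideal.Quotient.mkₐ ℂ I).toLinearMap)

theorem hilbertFunction_eq (X : Set (ℙ ℂ (ι → ℂ))) (n : ℕ) :
    hilbertFunction X n = quotientHilbert (homogeneousIdeal X) n := rfl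

/-- The degree-`n` part of an ideal. -/
noncomputable def degreePart (I : Ideal (MvPolynomial ι ℂ)) (n : ℕ) :
    Submodule ℂ (MvPolynomial ι ℂ) :=
  homogeneousSubmodule ι ℂ n ⊓ I.restrictScalars ℂ

theorem mem_degreePart {I : Ideal (MvPolynomial ι ℂ)} {n : ℕ} {f : MvPolynomial ι ℂ} :
    f ∈ degreePart I n ↔ f.IsHomogeneous n ∧ f ∈ I := Iff.rfl

/-- Rank-nullity for the restriction of a linear map to the degree-`n` part of the polynomial
ring. -/
theorem finrank_map_add_finrank_inf_ker [Finite ι] {V : Type*} [AddCommGroup V] [Module ℂ V]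
    (L : MvPolynomial ι ℂ →ₗ[ℂ] V) (n : ℕ) :
    Module.finrank ℂ ((homogeneousSubmodule ι ℂ n).map L) +
      Module.finrank ℂ (homogeneousSubmodule ι ℂ n ⊓ LinearMap.ker L : Submodule ℂ _) =
      Module.finrank ℂ (homogeneousSubmodule ι ℂ n) := by
  rw [← LinearMap.finrank_range_add_finrank_ker (L.domRestrict (homogeneousSubmodule ι ℂ n)),
    LinearMap.range_domRestrict, LinearMap.ker_domRestrict,
    ← Submodule.map_comap_subtype, Submodule.finrank_map_subtype_eq]

theorem quotientHilbert_add [Finite ι] (I : Ideal (MvPolynomial ι ℂ)) (n : ℕ) :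
    quotientHilbert I n + Module.finrank ℂ (degreePart I n) =
      Module.finrank ℂ (homogeneousSubmodule ι ℂ n) := by
  rw [← finrank_map_add_finrank_inf_ker (Ideal.Quotient.mkₐ ℂ I).toLinearMap n]
  have : degreePart I n =
      homogeneousSubmodule ι ℂ n ⊓ LinearMap.ker (Ideal.Quotient.mkₐ ℂ I).toLinearMap := by
    ext f
    simp [mem_degreePart, Ideal.Quotient.eq_zero_iff_mem]
  rw [this, quotientHilbert]

/-- Closure under taking homogeneous components. -/
def ComponentClosed (I : Ideal (MvPolynomial ι ℂ)) : Prop :=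
  ∀ f ∈ I, ∀ n, homogeneousComponent n f ∈ I

/-- The colon ideal `(I : p)`. -/
noncomputable def colon (I : Ideal (MvPolynomial ι ℂ)) (p : MvPolynomial ι ℂ) : Ideal (MvPolynomial ι ℂ) :=
  Submodule.comap (LinearMap.mulLeft (MvPolynomial ι ℂ) p) I

theorem mem_colon {I : Ideal (MvPolynomial ι ℂ)} {p f : MvPolynomial ι ℂ} :
    f ∈ colon I p ↔ p * f ∈ I := Iff.rfl

theorem ComponentClosed.colon {I : Ideal (MvPolynomial ι ℂ)} (hI : ComponentClosed I)
    {p : MvPolynomial ι ℂ} {k : ℕ} (hp : p.IsHomogeneous k) : ComponentClosed (colon I p) := by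
  intro f hf n
  rw [mem_colon, ← homogeneousComponent_mul_left hp]
  exact hI _ hf _

theorem ComponentClosed.sup_span_singleton {I : Ideal (MvPolynomial ι ℂ)}
    (hI : ComponentClosed I) {p : MvPolynomial ι ℂ} {k : ℕ} (hp : p.IsHomogeneous k) :
    ComponentClosed (I ⊔ Ideal.span {p}) := by
  intro f hf n
  obtain ⟨g, hg, h, hh, rfl⟩ := Submodule.mem_sup.1 hf
  obtain ⟨q, rfl⟩ := Ideal.mem_span_singleton'.1 hh
  rw [map_add]
  refine add_mem (Ideal.mem_sup_left (hI g hg n)) (Ideal.mem_sup_right ?_)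
  rw [mul_comm]
  rcases lt_or_ge n k with hn | hn
  · rw [homogeneousComponent_mul_left_of_lt hp _ hn]
    exact zero_mem _
  · obtain ⟨r, rfl⟩ := Nat.exists_eq_add_of_le hn
    rw [homogeneousComponent_mul_left hp]
    exact Ideal.mul_mem_right _ _ (Ideal.mem_span_singleton_self p)

/-- Additivity of Hilbert functions along
`0 → S/(I : x)(-1) → S/I → S/(I + (x)) → 0`. -/
theorem quotientHilbert_succ [Finite ι] {I : Ideal (MvPolynomial ι ℂ)} (hI : ComponentClosed I)
    (i : ι) (n : ℕ) :
    quotientHilbert I (n + 1) =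
      quotientHilbert (colon I (X i)) n + quotientHilbert (I ⊔ Ideal.span {X i}) (n + 1) := by
  let x : MvPolynomial ι ℂ := X i
  have hx : x.IsHomogeneous 1 := isHomogeneous_X ℂ i
  let mulx : MvPolynomial ι ℂ →ₗ[ℂ] MvPolynomial ι ℂ := LinearMap.mulLeft ℂ x
  have hinj : Function.Injective mulx := fun a b hab =>
    mul_left_cancel₀ (X_ne_zero (R := ℂ) i) hab
  have hfin : ∀ (J : Ideal (MvPolynomial ι ℂ)) k, FiniteDimensional ℂ (degreePart J k) :=
    fun J k => Submodule.finiteDimensional_of_le (inf_le_left : degreePart J k ≤ _)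
  have hmap : ∀ J : Submodule ℂ (MvPolynomial ι ℂ),
      Module.finrank ℂ (J.map mulx) = Module.finrank ℂ J := fun J =>
    (Submodule.equivMapOfInjective mulx hinj J).finrank_eq.symm
  -- The sum of $I_{n+1}$ and $xS_n$ is the degree part of $I+(x)$, and their intersection is
  -- $x\,(I:x)_n$. The dimension formula for a sum of subspaces then gives the recursion.
  have hsup : degreePart I (n + 1) ⊔ (homogeneousSubmodule ι ℂ n).map mulx =
      degreePart (I ⊔ Ideal.span {x}) (n + 1) := by
    apply le_antisymm
    · refine sup_le (inf_le_inf le_rfl fun f hf => Ideal.mem_sup_left hf) ?_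
      rintro _ ⟨g, hg, rfl⟩
      refine ⟨?_, Ideal.mem_sup_right (Ideal.mul_mem_right _ _ (Ideal.mem_span_singleton_self x))⟩
      have := hx.mul hg
      rwa [add_comm] at this
    · rintro f ⟨hf, hfI⟩
      obtain ⟨g, hg, h, hh, rfl⟩ := Submodule.mem_sup.1 hfI
      obtain ⟨q, rfl⟩ := Ideal.mem_span_singleton'.1 hh
      have h1 := homogeneousComponent_of_isHomogeneous hf (n + 1)
      rw [if_pos rfl, map_add, mul_comm q, add_comm n, homogeneousComponent_mul_left hx] at h1
      rw [mul_comm q, ← h1]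
      refine Submodule.add_mem_sup ⟨?_, hI g hg _⟩
        ⟨homogeneousComponent n q, homogeneousComponent_mem n q, rfl⟩
      rw [add_comm 1]
      exact homogeneousComponent_mem _ g
  have hinf : degreePart I (n + 1) ⊓ (homogeneousSubmodule ι ℂ n).map mulx =
      (degreePart (colon I x) n).map mulx := by
    apply le_antisymm
    · rintro _ ⟨⟨-, hfI⟩, ⟨g, hg, rfl⟩⟩
      exact ⟨g, ⟨hg, hfI⟩, rfl⟩
    · rintro _ ⟨g, ⟨hg, hgI⟩, rfl⟩
      refine ⟨⟨?_, hgI⟩, ⟨g, hg, rfl⟩⟩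
      have := hx.mul hg
      rwa [add_comm] at this
  have := hfin I (n + 1)
  have h := Submodule.finrank_sup_add_finrank_inf_eq (degreePart I (n + 1))
    ((homogeneousSubmodule ι ℂ n).map mulx)
  rw [hsup, hinf, hmap, hmap] at h
  have h1 := quotientHilbert_add I (n + 1)
  have h2 := quotientHilbert_add (colon I x) n
  have h3 := quotientHilbert_add (I ⊔ Ideal.span {x}) (n + 1)
  change _ = quotientHilbert (colon I x) n + quotientHilbert (I ⊔ Ideal.span {x}) (n + 1)
  omega

/-- Every polynomial has a discrete antiderivative. -/
theorem exists_eval_succ_sub_eval (Q : Polynomial ℚ) :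
    ∃ P : Polynomial ℚ, ∀ x : ℚ, P.eval (x + 1) - P.eval x = Q.eval x := by
  induction Q using Polynomial.induction_on' with
  | add p q hp hq =>
    obtain ⟨P, hP⟩ := hp
    obtain ⟨P', hP'⟩ := hq
    exact ⟨P + P', fun x => by simp only [Polynomial.eval_add, ← hP, ← hP']; ring⟩
  | monomial n a =>
    -- The Bernoulli polynomials satisfy $B_{n+1}(x+1)-B_{n+1}(x)=(n+1)x^n$.
    refine ⟨Polynomial.C (a / (n + 1 : ℚ)) * Polynomial.bernoulli (n + 1), fun x => ?_⟩
    have := Polynomial.bernoulli_eval_one_add (n + 1) x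
    have hn : (n + 1 : ℚ) ≠ 0 := by positivity
    rw [Polynomial.eval_mul, Polynomial.eval_mul, Polynomial.eval_C, Polynomial.eval_C, add_comm x,
      this,      Polynomial.eval_monomial]
    simp only [Nat.cast_add, Nat.cast_one, add_tsub_cancel_right]
    field_simp
    ring

theorem exists_eventually_eq_eval_of_sub {a : ℕ → ℚ} {Q : Polynomial ℚ}
    (h : ∀ᶠ n : ℕ in Filter.atTop, a (n + 1) = a n + Q.eval (n : ℚ)) :
    ∃ P : Polynomial ℚ, ∀ᶠ n : ℕ in Filter.atTop, a n = P.eval (n : ℚ) := by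
  obtain ⟨P, hP⟩ := exists_eval_succ_sub_eval Q
  obtain ⟨N, hN⟩ := Filter.eventually_atTop.1 h
  refine ⟨P + Polynomial.C (a N - P.eval (N : ℚ)), Filter.eventually_atTop.2 ⟨N, fun n hn => ?_⟩⟩
  induction n, hn using Nat.le_induction with
  | base => simp
  | succ n hn ih =>
    rw [hN n hn, ih, ← hP]
    simp only [Polynomial.eval_add, Polynomial.eval_C, Nat.cast_add, Nat.cast_one]
    ring

/-- The Hilbert function of a homogeneous ideal is eventually a polynomial. -/
theorem exists_hilbertPolynomial [Finite ι] (I : Ideal (MvPolynomial ι ℂ))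
    (hI : ComponentClosed I) :
    ∃ P : Polynomial ℚ, ∀ᶠ n : ℕ in Filter.atTop, (quotientHilbert I n : ℚ) = P.eval (n : ℚ) := by
  induction I using IsNoetherian.induction with
  | hgt I ih =>
  -- If every variable lies in `I`, the quotient vanishes in positive degrees. Otherwise a variable
  -- outside `I` makes `I + (x)` strictly larger, so Noetherian induction applies to it.
  by_cases hall : ∀ i, (X i : MvPolynomial ι ℂ) ∈ I
  · refine ⟨0, Filter.eventually_atTop.2 ⟨1, fun n hn => ?_⟩⟩
    have hle : homogeneousSubmodule ι ℂ n ≤ I.restrictScalars ℂ := by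
      intro f hf
      obtain ⟨k, rfl⟩ := Nat.exists_eq_add_of_le hn
      rw [add_comm] at hf
      have h0 : constantCoeff f = 0 := by
        rw [constantCoeff_eq]
        exact IsHomogeneous.coeff_eq_zero hf (by simp)
      change f ∈ I
      rw [f.as_sum]
      refine Ideal.sum_mem _ fun d hd => ?_
      have hd0 : d ≠ 0 := by
        rintro rfl
        exact (mem_support_iff.1 hd) h0
      obtain ⟨i, hi⟩ := Finsupp.ne_iff.1 hd0
      have hi : d = Finsupp.single i 1 + (d - Finsupp.single i 1) := by
        rw [add_tsub_cancel_of_le]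
        simpa using Nat.one_le_iff_ne_zero.2 hi
      rw [hi, ← one_mul (coeff _ f), ← monomial_mul]
      exact Ideal.mul_mem_right _ _ (hall i)
    have h1 := quotientHilbert_add I n
    rw [degreePart, inf_eq_left.2 hle] at h1
    simp; omega
  · push Not at hall
    obtain ⟨i, hi⟩ := hall
    have hx := isHomogeneous_X (R := ℂ) i
    obtain ⟨P, hP⟩ := ih (I ⊔ Ideal.span {X i})
      (lt_of_le_of_ne le_sup_left fun h => hi (h ▸ Ideal.mem_sup_right
        (Ideal.mem_span_singleton_self _))) (hI.sup_span_singleton hx)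
    have hP' : ∀ᶠ n : ℕ in Filter.atTop, (quotientHilbert (I ⊔ Ideal.span {X i}) (n + 1) : ℚ) =
        (P.comp (Polynomial.X + 1)).eval (n : ℚ) := by
      filter_upwards [(Filter.tendsto_add_atTop_nat 1).eventually hP] with n hn
      rw [hn]
      simp
    -- When the variable is a nonzerodivisor modulo `I`, the recursion is a difference equation with
    -- polynomial right-hand side. Otherwise the colon ideal is also strictly larger and both
    -- summands are already known to be eventually polynomial.
    by_cases hc : colon I (X i) = I
    · refine exists_eventually_eq_eval_of_sub (Q := P.comp (Polynomial.X + 1)) ?_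
      filter_upwards [hP'] with n hn
      rw [quotientHilbert_succ hI i, hc, ← hn]
      push_cast
      ring
    · obtain ⟨R, hR⟩ := ih (colon I (X i)) (lt_of_le_of_ne
        (fun f hf => Ideal.mul_mem_left _ _ hf) (Ne.symm hc)) (hI.colon hx)
      refine ⟨R.comp (Polynomial.X - 1) + P, ?_⟩
      have h1 : ∀ᶠ n : ℕ in Filter.atTop, (quotientHilbert I (n + 1) : ℚ) =
          (R.comp (Polynomial.X - 1) + P).eval ((n + 1 : ℕ) : ℚ) := by
        filter_upwards [hR, (Filter.tendsto_add_atTop_nat 1).eventually hP] with n h1 h2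
        rw [quotientHilbert_succ hI i]
        simp only [Nat.cast_add, h1, h2]
        simp
      obtain ⟨N, hN⟩ := Filter.eventually_atTop.1 h1
      refine Filter.eventually_atTop.2 ⟨N + 1, fun n hn => ?_⟩
      obtain ⟨k, rfl⟩ : ∃ k, n = k + 1 := ⟨n - 1, by omega⟩
      exact hN k (by omega)

/-- A polynomial that is eventually between two shifts of a polynomial `Q` has the same leading
term as `Q`. -/
theorem leadingTerm_eq_of_le_of_le {P Q : Polynomial ℚ} (hQ : 0 < Q.leadingCoeff) (N : ℕ)
    (hle : ∀ᶠ n : ℕ in Filter.atTop, P.eval (n : ℚ) ≤ Q.eval (n : ℚ))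
    (hge : ∀ᶠ n : ℕ in Filter.atTop, Q.eval ((n : ℚ) - N) ≤ P.eval (n : ℚ)) :
    P.natDegree = Q.natDegree ∧ P.leadingCoeff = Q.leadingCoeff := by
  have hQ0 : Q ≠ 0 := by rintro rfl; simp at hQ
  have hcast : Filter.Tendsto (fun n : ℕ => (n : ℚ)) Filter.atTop Filter.atTop :=
    tendsto_natCast_atTop_atTop
  let Q' := Q.comp (Polynomial.X - Polynomial.C (N : ℚ))
  have hlead : Q'.leadingCoeff = Q.leadingCoeff := by
    rw [Polynomial.leadingCoeff_comp (by rw [Polynomial.natDegree_X_sub_C]; exact one_ne_zero),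
      Polynomial.leadingCoeff_X_sub_C, one_pow, mul_one]
  have hQ'0 : Q' ≠ 0 := by
    intro h; rw [h] at hlead; simp at hlead; exact hQ.ne hlead
  have hdeg : Q'.degree = Q.degree := by
    rw [Polynomial.degree_eq_natDegree hQ'0, Polynomial.degree_eq_natDegree hQ0,
      Polynomial.natDegree_comp, Polynomial.natDegree_X_sub_C, mul_one]
  have hpos : ∀ᶠ n : ℕ in Filter.atTop, 0 < Q.eval (n : ℚ) := by
    rcases lt_or_ge 0 Q.degree with hd | hd
    · exact hcast.eventually
        ((Polynomial.tendsto_atTop_of_leadingCoeff_nonneg Q hd hQ.le).eventually_gt_atTop 0)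
    · rw [Polynomial.eq_C_of_degree_le_zero hd] at hQ ⊢
      exact Filter.Eventually.of_forall fun n => by simpa using hQ
  -- A shift of the argument preserves the leading term, so $Q(n-N)/Q(n)\to1$ and $P/Q$ is squeezed
  -- to $1$; a smaller or larger degree of $P$ would give limit $0$ or an unbounded quotient.
  have h1 : Filter.Tendsto (fun n : ℕ => Q'.eval (n : ℚ) / Q.eval (n : ℚ)) Filter.atTop
      (nhds 1) := by
    have := (Polynomial.div_tendsto_atTop_leadingCoeff_div_of_degree_eq Q' Q hdeg).comp hcast
    rwa [hlead, div_self hQ.ne'] at this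
  have h2 : Filter.Tendsto (fun n : ℕ => P.eval (n : ℚ) / Q.eval (n : ℚ)) Filter.atTop
      (nhds 1) := by
    refine tendsto_of_tendsto_of_tendsto_of_le_of_le' h1 tendsto_const_nhds ?_ ?_
    · filter_upwards [hpos, hge] with n hn hn'
      refine div_le_div_of_nonneg_right ?_ hn.le
      simpa [Q'] using hn'
    · filter_upwards [hpos, hle] with n hn hn'
      exact (div_le_one hn).2 hn'
  rcases lt_trichotomy P.degree Q.degree with h | h | h
  · have := (Polynomial.div_tendsto_atTop_zero_of_degree_lt P Q h).comp hcast
    exact absurd (tendsto_nhds_unique this h2) (by norm_num)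
  · have := (Polynomial.div_tendsto_atTop_leadingCoeff_div_of_degree_eq P Q h).comp hcast
    have h3 := tendsto_nhds_unique this h2
    exact ⟨Polynomial.natDegree_eq_of_degree_eq h, (div_eq_one_iff_eq hQ.ne').1 h3⟩
  · have h3 := (Polynomial.abs_div_tendsto_atTop_atTop_of_degree_gt P Q h hQ0).comp hcast
    exact absurd h2.abs (not_tendsto_nhds_of_tendsto_atTop h3 _)

end Hilbert

end GaussianMoments

namespace GaussianMoments

open MvPolynomial

/-! ### A criterion for Cohen–Macaulay rings -/

section CohenMacaulay

theorem ker_aeval_ite_eq_span {n : ℕ} (c : Fin n → ℂ) (s : Set (Fin n)) [DecidablePred (· ∈ s)] :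
    RingHom.ker (aeval (R := ℂ) fun i : Fin n => if i ∈ s then C (c i) else
      (X i : MvPolynomial (Fin n) ℂ)) = Ideal.span ((fun i => X i - C (c i)) '' s) := by
  apply le_antisymm
  · intro f hf
    let J : Ideal (MvPolynomial (Fin n) ℂ) := Ideal.span ((fun i => X i - C (c i)) '' s)
    have key : (Ideal.Quotient.mkₐ ℂ J).comp (aeval fun i : Fin n => if i ∈ s then C (c i) else
        (X i : MvPolynomial (Fin n) ℂ)) = Ideal.Quotient.mkₐ ℂ J := by
      ext i
      simp only [AlgHom.comp_apply, aeval_X]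
      split_ifs with h
      · refine (Ideal.Quotient.eq.2 ?_).symm
        exact Ideal.subset_span ⟨i, h, rfl⟩
      · rfl
    have := DFunLike.congr_fun key f
    rw [AlgHom.comp_apply, RingHom.mem_ker.1 hf, map_zero] at this
    exact Ideal.Quotient.eq_zero_iff_mem.1 this.symm
  · rw [Ideal.span_le]
    rintro _ ⟨i, hi, rfl⟩
    simp [RingHom.mem_ker, hi, algebraMap_eq]

/-- The ideal of an initial segment is the kernel of a substitution into a polynomial ring, which is
a domain; regularity of the next element reduces to its image being nonzero. -/
theorem isWeaklyRegular_X_sub_C {n : ℕ} (c : Fin n → ℂ) :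
    RingTheory.Sequence.IsWeaklyRegular (MvPolynomial (Fin n) ℂ)
      (List.ofFn fun i => (X i - C (c i) : MvPolynomial (Fin n) ℂ)) := by
  classical
  rw [RingTheory.Sequence.isWeaklyRegular_iff]
  intro k hk'
  have hk : k < n := by simpa using hk'
  let k' : Fin n := ⟨k, hk⟩
  let s : Set (Fin n) := {i | i < k'}
  have hI : Ideal.ofList ((List.ofFn fun i => (X i - C (c i) : MvPolynomial (Fin n) ℂ)).take k) =
      Ideal.span ((fun i => X i - C (c i)) '' s) := by
    rw [Ideal.ofList]
    congr 1
    ext f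
    simp only [Set.mem_ofPred_eq, Set.mem_image, List.mem_take_iff_getElem, List.getElem_ofFn,
      List.length_ofFn, s]
    constructor
    · rintro ⟨i, hi, rfl⟩
      exact ⟨⟨i, by omega⟩, by simp [k', Fin.lt_def]; omega, rfl⟩
    · rintro ⟨i, hi, rfl⟩
      exact ⟨i, by simp [k', Fin.lt_def] at hi; omega, rfl⟩
  rw [hI, ← ker_aeval_ite_eq_span, isSMulRegular_iff_right_eq_zero_of_smul]
  intro q hq
  obtain ⟨f, rfl⟩ := Submodule.Quotient.mk_surjective _ q
  rw [← Submodule.Quotient.mk_smul, Submodule.Quotient.mk_eq_zero] at hq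
  rw [Submodule.Quotient.mk_eq_zero]
  simp only [smul_eq_mul, Ideal.mul_top, RingHom.mem_ker, map_mul, mul_eq_zero,
    List.getElem_ofFn] at hq ⊢
  refine hq.resolve_left ?_
  simp only [map_sub, aeval_X, aeval_C, algebraMap_eq]
  rw [if_neg (by simp [s, k'])]
  intro h
  have := congrArg (eval (fun _ => c k' + 1)) h
  simp [k'] at this

/-- A finite free algebra over a polynomial ring is Cohen–Macaulay. -/
theorem isCohenMacaulay_of_free (n : ℕ) (A : Type*) [CommRing A]
    [Algebra (MvPolynomial (Fin n) ℂ) A] [Module.Free (MvPolynomial (Fin n) ℂ) A]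
    [Module.Finite (MvPolynomial (Fin n) ℂ) A] : IsCohenMacaulay A := by
  have hN : IsNoetherianRing A := IsNoetherianRing.of_finite (MvPolynomial (Fin n) ℂ) A
  refine ⟨hN, fun p hp => ?_⟩
  have hmax : (p.comap (algebraMap (MvPolynomial (Fin n) ℂ) A)).IsMaximal :=
    Ideal.isMaximal_comap_of_isIntegral_of_isMaximal p
  -- By the Nullstellensatz the contraction of `p` is the ideal of a point `c`. The regular sequence
  -- $X_i-c_i$ stays regular over `A` by flatness, and after localizing because it lies in `p`.
  obtain ⟨c, hc⟩ := (MvPolynomial.isMaximal_iff_eq_vanishingIdeal_singleton (K := ℂ)).1 hmax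
  let rs := List.ofFn fun i => (X i - C (c i) : MvPolynomial (Fin n) ℂ)
  have hw := (isWeaklyRegular_X_sub_C c).of_flat (S := A)
  have hmem : ∀ r ∈ rs.map (algebraMap (MvPolynomial (Fin n) ℂ) A), r ∈ p := by
    intro r hr
    obtain ⟨f, hf, rfl⟩ := List.mem_map.1 hr
    obtain ⟨i, rfl⟩ := (List.mem_ofFn' _ _).1 hf
    rw [← Ideal.mem_comap, hc]
    simp
  have hreg := hw.isRegular_of_isLocalization_of_mem (Localization.AtPrime p) p hmem
  refine ⟨_, hreg, ?_⟩
  have hlen : (((rs.map (algebraMap (MvPolynomial (Fin n) ℂ) A)).map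
      (algebraMap A (Localization.AtPrime p))).length) = n := by simp [rs]
  rw [hlen]
  have hNL : IsNoetherianRing (Localization.AtPrime p) :=
    IsLocalization.isNoetherianRing p.primeCompl _ hN
  apply le_antisymm
  -- A regular sequence of length `n` forces dimension at least `n`; the reverse bound comes from
  -- integrality over the polynomial ring.
  · have h := ringKrullDim_add_length_eq_ringKrullDim_of_isRegular _ hreg
    rw [hlen] at h
    rw [← h]
    have hnt : Nontrivial (Localization.AtPrime p ⧸ Ideal.ofList
        ((rs.map (algebraMap (MvPolynomial (Fin n) ℂ) A)).map
          (algebraMap A (Localization.AtPrime p)))) := by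
      rw [Ideal.Quotient.nontrivial_iff]
      have := hreg.top_ne_smul.symm
      rwa [smul_eq_mul, Ideal.mul_top] at this
    calc (((n : ℕ) : ℕ∞) : WithBot ℕ∞) = 0 + n := by simp
      _ ≤ _ := by gcongr; exact ringKrullDim_nonneg_of_nontrivial
  · calc ringKrullDim (Localization.AtPrime p) ≤ ringKrullDim A :=
          (IsLocalization.AtPrime.ringKrullDim_eq_height p _).trans_le
            (Ideal.height_le_ringKrullDim_of_ne_top hp.ne_top)
      _ ≤ ringKrullDim (MvPolynomial (Fin n) ℂ) := ringKrullDim_le_of_isIntegral _ _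
      _ = _ := by rw [ringKrullDim_mvPolynomial_fin]; rfl

end CohenMacaulay

end GaussianMoments

namespace GaussianMoments

/-! ### Moments of order at most three -/

section Moments

/-- The index of the moment `m_{ab}`. -/
noncomputable def ix (a b : ℕ) (h : a + b ≤ 3 := by decide) : Idx 2 3 :=
  ⟨Finsupp.equivFunOnFinite.symm ![a, b], by
    simpa [Finsupp.degree_eq_sum, Fin.sum_univ_two] using h⟩

theorem forall_idx {P : Idx 2 3 → Prop} :
    (∀ i, P i) ↔ P (ix 0 0) ∧ P (ix 1 0) ∧ P (ix 0 1) ∧ P (ix 2 0) ∧ P (ix 1 1) ∧ P (ix 0 2) ∧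
      P (ix 3 0) ∧ P (ix 2 1) ∧ P (ix 1 2) ∧ P (ix 0 3) := by
  refine ⟨fun h => ⟨h _, h _, h _, h _, h _, h _, h _, h _, h _, h _⟩, ?_⟩
  rintro ⟨h1, h2, h3, h4, h5, h6, h7, h8, h9, h10⟩ ⟨d, hd⟩
  have hd' : d 0 + d 1 ≤ 3 := by simpa [Finsupp.degree_eq_sum, Fin.sum_univ_two] using hd
  have key : ∀ (a b : ℕ) (hab : a + b ≤ 3), d 0 = a → d 1 = b → P (ix a b hab) → P ⟨d, hd⟩ := by
    rintro a b hab rfl rfl hP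
    convert hP
    ext k
    fin_cases k <;> simp [ix]
  obtain ⟨a, ha⟩ : ∃ a, d 0 = a := ⟨_, rfl⟩
  obtain ⟨b, hb⟩ : ∃ b, d 1 = b := ⟨_, rfl⟩
  rw [ha, hb] at hd'
  have ha3 : a ≤ 3 := by omega
  have hb3 : b ≤ 3 := by omega
  interval_cases a <;> interval_cases b <;>
    first
    | omega
    | exact key _ _ (by decide) ha hb (by assumption)

/-- The vector with entries `f a b`. -/
def vec {R : Type*} (f : ℕ → ℕ → R) : Idx 2 3 → R := fun i => f (i.1 0) (i.1 1)

@[simp]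
theorem vec_ix {R : Type*} (f : ℕ → ℕ → R) (a b : ℕ) (h : a + b ≤ 3) : vec f (ix a b h) = f a b := by
  simp [vec, ix]

/-- The moments of order at most three, in terms of mean and covariance and third cumulants. -/
def cumulantMoment {R : Type*} [CommRing R] (x y a b c k₀ k₁ k₂ k₃ : R) : ℕ → ℕ → R
  | 0, 0 => 1
  | 1, 0 => x
  | 0, 1 => y
  | 2, 0 => a + x ^ 2
  | 1, 1 => b + x * y
  | 0, 2 => c + y ^ 2
  | 3, 0 => k₀ + 3 * x * a + x ^ 3
  | 2, 1 => k₁ + 2 * x * b + y * a + x ^ 2 * y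
  | 1, 2 => k₂ + x * c + 2 * y * b + x * y ^ 2
  | 0, 3 => k₃ + 3 * y * c + y ^ 3
  | _, _ => 0

open MvPowerSeries

/-- Without a constant term, $a^4$ has order at least 4, so the unspecified factor `r` is invisible
to moments of order at most 3. -/
theorem exists_exp_subst {n : ℕ} {a : MvPowerSeries (Fin n) ℝ}
    (ha : constantCoeff a = 0) :
    ∃ r : MvPowerSeries (Fin n) ℝ, (PowerSeries.exp ℝ).subst a =
      1 + a + C (1 / 2) * a ^ 2 + C (1 / 6) * a ^ 3 + a ^ 4 * r := by
  have hs := PowerSeries.HasSubst.of_constantCoeff_zero ha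
  obtain ⟨q, hq⟩ : (PowerSeries.X : PowerSeries ℝ) ^ 4 ∣ PowerSeries.exp ℝ -
      (1 + PowerSeries.X + PowerSeries.C (1 / 2) * PowerSeries.X ^ 2 +
        PowerSeries.C (1 / 6) * PowerSeries.X ^ 3) := by
    rw [PowerSeries.X_pow_dvd_iff]
    intro k hk
    simp only [map_sub, map_add, PowerSeries.coeff_exp, PowerSeries.coeff_C_mul,
      PowerSeries.coeff_X_pow, PowerSeries.coeff_one, PowerSeries.coeff_X]
    interval_cases k <;> norm_num [Nat.factorial]
  refine ⟨q.subst a, ?_⟩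
  have h1 : PowerSeries.exp ℝ = (1 + PowerSeries.X + (1 / 2 : ℝ) • PowerSeries.X ^ 2 +
        (1 / 6 : ℝ) • PowerSeries.X ^ 3) + PowerSeries.X ^ 4 * q := by
    rw [← hq, PowerSeries.smul_eq_C_mul, PowerSeries.smul_eq_C_mul]
    ring
  rw [h1, ← PowerSeries.coe_substAlgHom hs]
  simp only [map_add, map_mul, map_pow, map_one, map_smul, PowerSeries.substAlgHom_X]
  simp only [MvPowerSeries.smul_eq_C_mul]

theorem coeff_ix_eq_zero {f : MvPowerSeries (Fin 2) ℝ} (hf : 4 ≤ f.order) (p q : ℕ)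
    (h : p + q ≤ 3) : coeff (ix p q h).1 f = 0 := by
  refine coeff_of_lt_order (lt_of_lt_of_le ?_ hf)
  have := (ix p q h).2
  exact_mod_cast Nat.lt_succ_of_le this

theorem coeff_ix_monomial (p q : ℕ) (h : p + q ≤ 3) (c : ℝ) (i j : ℕ) :
    coeff (ix p q h).1 (C c * (X 0 ^ i * X 1 ^ j : MvPowerSeries (Fin 2) ℝ)) =
      if i = p ∧ j = q then c else 0 := by
  classical
  rw [coeff_C_mul, X_pow_eq, X_pow_eq, monomial_mul_monomial, coeff_monomial]
  have : (ix p q h).1 = Finsupp.single 0 i + Finsupp.single 1 j ↔ i = p ∧ j = q := by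
    rw [Finsupp.ext_iff]
    simp [ix, Fin.forall_fin_two, eq_comm]
  simp [this]

/-- The linear exponent $a$ has order at least 1 and the quadratic one $b$ order at least 2, so only
$1,a,a^2/2,a^3/6,b,ab$ contribute. The off-diagonal entries are averaged because symmetry is not
assumed here. -/
theorem momentOf_gaussianMGF (μ : Fin 2 → ℝ) (S : Matrix (Fin 2) (Fin 2) ℝ) (p q : ℕ)
    (h : p + q ≤ 3) : momentOf (gaussianMGF μ S) (ix p q h).1 =
      cumulantMoment (μ 0) (μ 1) (S 0 0) ((S 0 1 + S 1 0) / 2) (S 1 1) 0 0 0 0 p q := by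
  have hX : ∀ i : Fin 2, 1 ≤ (X i : MvPowerSeries (Fin 2) ℝ).order := fun i =>
    one_le_order_iff_constCoeff_eq_zero.2 (by simp)
  have hadd : ∀ {n : ℕ∞} {f g : MvPowerSeries (Fin 2) ℝ}, n ≤ f.order → n ≤ g.order →
      n ≤ (f + g).order := fun hf hg => (le_min hf hg).trans min_order_le_add
  have hmul : ∀ {k l : ℕ∞} {f g : MvPowerSeries (Fin 2) ℝ}, k ≤ f.order → l ≤ g.order →
      k + l ≤ (f * g).order := fun hf hg => (add_le_add hf hg).trans le_order_mul
  have hmul' : ∀ {k : ℕ∞} {f : MvPowerSeries (Fin 2) ℝ} (g), k ≤ f.order →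
      k ≤ (f * g).order := fun g hf => by simpa using hmul hf (zero_le : 0 ≤ g.order)
  obtain ⟨a, ha⟩ : ∃ a : MvPowerSeries (Fin 2) ℝ, a = C (μ 0) * X 0 + C (μ 1) * X 1 := ⟨_, rfl⟩
  obtain ⟨b, hb⟩ : ∃ b : MvPowerSeries (Fin 2) ℝ, b = C (1 / 2) * (C (S 0 0) * X 0 ^ 2 +
    C (S 0 1 + S 1 0) * (X 0 * X 1) + C (S 1 1) * X 1 ^ 2) := ⟨_, rfl⟩
  have ha1 : 1 ≤ a.order := one_le_order_iff_constCoeff_eq_zero.2 (by simp [ha])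
  have h2 : (2 : ℕ∞) = 1 + 1 := by norm_num
  have hb2 : 2 ≤ b.order := by
    rw [hb, mul_comm]
    refine hmul' _ (hadd (hadd ?_ ?_) ?_) <;> rw [mul_comm] <;> refine hmul' _ ?_
    · rw [pow_two, h2]; exact hmul (hX _) (hX _)
    · rw [h2]; exact hmul (hX _) (hX _)
    · rw [pow_two, h2]; exact hmul (hX _) (hX _)
  obtain ⟨r, hr⟩ := exists_exp_subst (one_le_order_iff_constCoeff_eq_zero.1 ha1)
  obtain ⟨s, hs⟩ := exists_exp_subst
    (one_le_order_iff_constCoeff_eq_zero.1 ((by norm_num : (1 : ℕ∞) ≤ 2).trans hb2))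
  have hM : gaussianMGF μ S = (1 + a + C (1 / 2) * a ^ 2 + C (1 / 6) * a ^ 3 + b + a * b) +
      (a * a * b * (C (1 / 2) + C (1 / 6) * a) + a * a * (a * a) * (r * (1 + b)) +
        b * b * ((C (1 / 2) + C (1 / 6) * b + b ^ 2 * s) *
          (1 + a + C (1 / 2) * a ^ 2 + C (1 / 6) * a ^ 3 + a ^ 4 * r))) := by
    have e1 : ∑ i, μ i • (X i : MvPowerSeries (Fin 2) ℝ) = a := by
      simp [ha, Fin.sum_univ_two, smul_eq_C_mul]
    have e2 : (1 / 2 : ℝ) • ∑ i, ∑ j, S i j • (X i * X j : MvPowerSeries (Fin 2) ℝ) = b := by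
      simp only [hb, Fin.sum_univ_two, smul_eq_C_mul, map_add]
      ring
    rw [gaussianMGF, e1, e2, hr, hs]
    ring
  have h4 : (4 : ℕ∞) = 1 + 1 + 2 := by norm_num
  have h4' : (4 : ℕ∞) = 2 + 2 := by norm_num
  have hrest : 4 ≤ (a * a * b * (C (1 / 2) + C (1 / 6) * a) + a * a * (a * a) * (r * (1 + b)) +
        b * b * ((C (1 / 2) + C (1 / 6) * b + b ^ 2 * s) *
          (1 + a + C (1 / 2) * a ^ 2 + C (1 / 6) * a ^ 3 + a ^ 4 * r))).order := by
    refine hadd (hadd (hmul' _ ?_) (hmul' _ ?_)) (hmul' _ ?_)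
    · rw [h4]; exact hmul (hmul ha1 ha1) hb2
    · rw [h4', h2]; exact hmul (hmul ha1 ha1) (hmul ha1 ha1)
    · rw [h4']; exact hmul hb2 hb2
  have hE : (1 + a + C (1 / 2) * a ^ 2 + C (1 / 6) * a ^ 3 + b + a * b) =
      C 1 * (X 0 ^ 0 * X 1 ^ 0) + C (μ 0) * (X 0 ^ 1 * X 1 ^ 0) + C (μ 1) * (X 0 ^ 0 * X 1 ^ 1) +
      C (1 / 2 * μ 0 ^ 2 + 1 / 2 * S 0 0) * (X 0 ^ 2 * X 1 ^ 0) +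
      C (1 / 2 * 2 * μ 0 * μ 1 + 1 / 2 * (S 0 1 + S 1 0)) * (X 0 ^ 1 * X 1 ^ 1) +
      C (1 / 2 * μ 1 ^ 2 + 1 / 2 * S 1 1) * (X 0 ^ 0 * X 1 ^ 2) +
      C (1 / 6 * μ 0 ^ 3 + 1 / 2 * μ 0 * S 0 0) * (X 0 ^ 3 * X 1 ^ 0) +
      C (1 / 6 * 3 * μ 0 ^ 2 * μ 1 + 1 / 2 * μ 0 * (S 0 1 + S 1 0) + 1 / 2 * μ 1 * S 0 0) *
        (X 0 ^ 2 * X 1 ^ 1) +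
      C (1 / 6 * 3 * μ 0 * μ 1 ^ 2 + 1 / 2 * μ 1 * (S 0 1 + S 1 0) + 1 / 2 * μ 0 * S 1 1) *
        (X 0 ^ 1 * X 1 ^ 2) +
      C (1 / 6 * μ 1 ^ 3 + 1 / 2 * μ 1 * S 1 1) * (X 0 ^ 0 * X 1 ^ 3) := by
    rw [ha, hb]
    simp only [map_add, map_mul, map_pow, map_one, map_ofNat]
    ring
  have hp : p ≤ 3 := by omega
  have hq : q ≤ 3 := by omega
  rw [momentOf, hM, map_add, coeff_ix_eq_zero hrest, add_zero, hE]
  simp only [LinearMap.map_add, coeff_ix_monomial]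
  have hp' : (ix p q h).1 0 = p := by simp [ix]
  have hq' : (ix p q h).1 1 = q := by simp [ix]
  rw [Fin.prod_univ_two, hp', hq']
  interval_cases p <;> interval_cases q <;>
    first
    | omega
    | (simp [cumulantMoment, Nat.factorial] <;> ring)

end Moments

open MvPolynomial

/-! ### Parametrizations of the moment varieties -/

section Parametrization

instance : Finite (Idx 2 3) :=
  Finite.of_surjective ![ix 0 0, ix 1 0, ix 0 1, ix 2 0, ix 1 1, ix 0 2, ix 3 0, ix 2 1, ix 1 2,
    ix 0 3] (forall_idx.2 ⟨⟨0, rfl⟩, ⟨1, rfl⟩, ⟨2, rfl⟩, ⟨3, rfl⟩, ⟨4, rfl⟩, ⟨5, rfl⟩, ⟨6, rfl⟩,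
      ⟨7, rfl⟩, ⟨8, rfl⟩, ⟨9, rfl⟩⟩)

/-- A polynomial in $\tau$-variables that vanishes on a product of infinite sets is zero, so a box
of parameters realized in `W` suffices for one inclusion. For the other, each representative only
has to come from some complex parameter, whether or not it is statistically meaningful. -/
theorem homogeneousIdeal_closure_eq_ker {ι τ : Type} {W : Set (ℙ ℂ (ι → ℂ))}
    {ψ : ι → MvPolynomial τ ℂ}
    (h₁ : ∀ v hv, Projectivization.mk ℂ v hv ∈ W → ∃ t : τ → ℂ, v = fun i => eval t (ψ i))
    {s : τ → Set ℂ} (hs : ∀ i, (s i).Infinite)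
    (h₂ : ∀ t ∈ Set.pi Set.univ s, ∃ hv, Projectivization.mk ℂ (fun i => eval t (ψ i)) hv ∈ W) :
    homogeneousIdeal (closure W) = RingHom.ker (aeval (R := ℂ) ψ) := by
  rw [homogeneousIdeal_closure]
  ext f
  rw [RingHom.mem_ker, mem_homogeneousIdeal]
  constructor
  · intro h
    refine funext_set s hs fun t ht => ?_
    obtain ⟨hv, hW⟩ := h₂ t ht
    rw [eval_aeval, h _ hv hW, map_zero]
  · intro h v hv hW
    obtain ⟨t, rfl⟩ := h₁ v hv hW
    rw [← eval_aeval, h, map_zero]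

theorem topologicalKrullDim_le_of_ker {ι : Type} [Finite ι] {X : Set (ℙ ℂ (ι → ℂ))} {n : ℕ}
    {ψ : ι → MvPolynomial (Fin (n + 1)) ℂ}
    (hX : homogeneousIdeal X = RingHom.ker (aeval (R := ℂ) ψ)) : topologicalKrullDim X ≤ n := by
  refine topologicalKrullDim_le ?_
  refine ringKrullDim_le_of_injective
    (Ideal.Quotient.liftₐ (homogeneousIdeal X) (aeval (R := ℂ) ψ)
      (fun f hf => RingHom.mem_ker.1 (hX ▸ hf))) ?_
  rw [injective_iff_map_eq_zero]
  intro q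
  obtain ⟨f, rfl⟩ := Ideal.Quotient.mk_surjective q
  intro hf
  rw [Ideal.Quotient.eq_zero_iff_mem, hX]
  exact hf

theorem mk_mem_closure_of_ker {ι τ : Type} {W : Set (ℙ ℂ (ι → ℂ))} {ψ : ι → MvPolynomial τ ℂ}
    (hX : homogeneousIdeal (closure W) = RingHom.ker (aeval (R := ℂ) ψ)) (t : τ → ℂ)
    {v : ι → ℂ} (hv : v ≠ 0) (h : v = fun i => eval t (ψ i)) :
    Projectivization.mk ℂ v hv ∈ closure W := by
  refine mem_of_isClosed isClosed_closure hv fun f hf => ?_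
  rw [h, ← eval_aeval]
  rw [hX] at hf
  rw [RingHom.mem_ker.1 hf, map_zero]

theorem momentVector_gaussianMGF (μ : Fin 2 → ℝ) (S : Matrix (Fin 2) (Fin 2) ℝ)
    (hS : S.PosSemidef) : momentVector 3 (gaussianMGF μ S) =
      vec (cumulantMoment (μ 0 : ℂ) (μ 1) (S 0 0) (S 0 1) (S 1 1) 0 0 0 0) := by
  have h10 : S 1 0 = S 0 1 := by simpa using hS.isHermitian.apply 0 1
  funext i
  revert i
  rw [forall_idx]
  simp only [momentVector, momentOf_gaussianMGF, vec_ix, cumulantMoment, h10]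
  refine ⟨?_, ?_, ?_, ?_, ?_, ?_, ?_, ?_, ?_, ?_⟩ <;> push_cast <;> ring

theorem momentVector_mgf (θ : Mixture 2) : momentVector 3 θ.mgf =
    (θ.w : ℂ) • momentVector 3 (gaussianMGF θ.mean₁ θ.cov₁) +
      (1 - θ.w : ℂ) • momentVector 3 (gaussianMGF θ.mean₂ θ.cov₂) := by
  funext i
  simp only [momentVector, momentOf, Mixture.mgf, map_add, map_smul, smul_eq_mul, Pi.add_apply,
    Pi.smul_apply]
  push_cast
  ring

/-- The cumulants of a mixture of two Gaussians with the same covariance matrix. -/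
theorem vec_cumulantMoment_mix {R : Type*} [CommRing R] (w x y x' y' a b c : R) :
    w • vec (cumulantMoment x y a b c 0 0 0 0) + (1 - w) • vec (cumulantMoment x' y' a b c 0 0 0 0) =
      vec (cumulantMoment (w * x + (1 - w) * x') (w * y + (1 - w) * y')
        (a + w * (1 - w) * (x - x') ^ 2) (b + w * (1 - w) * ((x - x') * (y - y')))
        (c + w * (1 - w) * (y - y') ^ 2)
        (w * (1 - w) * (1 - 2 * w) * (x - x') ^ 3)
        (w * (1 - w) * (1 - 2 * w) * ((x - x') ^ 2 * (y - y')))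
        (w * (1 - w) * (1 - 2 * w) * ((x - x') * (y - y') ^ 2))
        (w * (1 - w) * (1 - 2 * w) * (y - y') ^ 3)) := by
  funext i
  revert i
  rw [forall_idx]
  simp only [Pi.add_apply, Pi.smul_apply, smul_eq_mul, vec_ix, cumulantMoment]
  refine ⟨?_, ?_, ?_, ?_, ?_, ?_, ?_, ?_, ?_, ?_⟩ <;> first | trivial | ring

/-- A mixture of two Gaussians with the same mean has the moments of order at most three of a
Gaussian. -/
theorem vec_cumulantMoment_mix_of_mean_eq {R : Type*} [CommRing R] (w x y a b c a' b' c' : R) :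
    w • vec (cumulantMoment x y a b c 0 0 0 0) + (1 - w) • vec (cumulantMoment x y a' b' c' 0 0 0 0) =
      vec (cumulantMoment x y (w * a + (1 - w) * a') (w * b + (1 - w) * b')
        (w * c + (1 - w) * c') 0 0 0 0) := by
  funext i
  revert i
  rw [forall_idx]
  simp only [Pi.add_apply, Pi.smul_apply, smul_eq_mul, vec_ix, cumulantMoment]
  refine ⟨?_, ?_, ?_, ?_, ?_, ?_, ?_, ?_, ?_, ?_⟩ <;> ring

/-- The two sets agree before closure: a mixture with a common mean is matched by the Gaussian with
the convex combination of covariances, and a Gaussian is a mixture of weight 1. -/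
theorem equalMeans_eq_gaussianVariety : equalMeans 2 3 = gaussianVariety 2 3 := by
  rw [equalMeans, submodel, gaussianVariety]
  congr 1
  ext p
  constructor
  · rintro ⟨θ, hθ, rfl⟩
    have hθ : θ.mean₁ = θ.mean₂ := hθ
    have hpos : (θ.w • θ.cov₁ + (1 - θ.w) • θ.cov₂).PosSemidef :=
      (θ.posSemidef₁.smul θ.w_mem.1).add (θ.posSemidef₂.smul (sub_nonneg.2 θ.w_mem.2))
    refine ⟨θ.mean₁, θ.w • θ.cov₁ + (1 - θ.w) • θ.cov₂, hpos, ?_⟩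
    have : momentVector 3 θ.mgf = momentVector 3
        (gaussianMGF θ.mean₁ (θ.w • θ.cov₁ + (1 - θ.w) • θ.cov₂)) := by
      rw [momentVector_mgf, momentVector_gaussianMGF _ _ θ.posSemidef₁,
        momentVector_gaussianMGF _ _ θ.posSemidef₂, momentVector_gaussianMGF _ _ hpos, ← hθ,
        vec_cumulantMoment_mix_of_mean_eq]
      simp
    simp only [Mixture.point, gaussianPoint, this]
  · rintro ⟨μ, S, hS, rfl⟩
    refine ⟨⟨1, μ, μ, S, S, by simp, hS, hS⟩, rfl, ?_⟩
    simp [Mixture.point, gaussianPoint, Mixture.mgf]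

/-- Diagonal dominance: the form equals $(a-|b|)z_0^2+(c-|b|)z_1^2+|b|(z_0\pm z_1)^2$. -/
theorem posSemidef_of_le {a b c : ℝ} (ha : |b| ≤ a) (hc : |b| ≤ c) :
    (!![a, b; b, c] : Matrix (Fin 2) (Fin 2) ℝ).PosSemidef := by
  refine Matrix.PosSemidef.of_dotProduct_mulVec_nonneg ?_ fun z => ?_
  · ext i j
    fin_cases i <;> fin_cases j <;> simp
  · simp only [dotProduct, Matrix.mulVec, Fin.sum_univ_two, star_trivial, Matrix.of_apply,
      Matrix.cons_val_zero, Matrix.cons_val_one]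
    rcases abs_cases b with ⟨h, -⟩ | ⟨h, -⟩
    · nlinarith [sq_nonneg (z 0 + z 1), mul_nonneg (sub_nonneg.2 ha) (sq_nonneg (z 0)),
        mul_nonneg (sub_nonneg.2 hc) (sq_nonneg (z 1)),
        mul_nonneg (abs_nonneg b) (sq_nonneg (z 0 + z 1))]
    · nlinarith [mul_nonneg (sub_nonneg.2 ha) (sq_nonneg (z 0)),
        mul_nonneg (sub_nonneg.2 hc) (sq_nonneg (z 1)),
        mul_nonneg (abs_nonneg b) (sq_nonneg (z 0 - z 1))]

/-- The moments of order at most three of `w` times a Gaussian, in coordinates in which they are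
of low degree in the mean `(x, y)`; the constant `k` is `2 / 3`. -/
def gaussianForm {R : Type*} [CommRing R] (k w x y a b c : R) : ℕ → ℕ → R
  | 0, 0 => w
  | 1, 0 => w * x
  | 0, 1 => w * y
  | 2, 0 => a + k * w * x ^ 2
  | 1, 1 => b + k * w * (x * y)
  | 0, 2 => c + k * w * y ^ 2
  | 3, 0 => 3 * (x * a)
  | 2, 1 => 2 * (x * b) + y * a
  | 1, 2 => x * c + 2 * (y * b)
  | 0, 3 => 3 * (y * c)
  | _, _ => 0

/-- The shift by $x^2/3$ absorbs the pure cubic term, as in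
$3x\sigma_{11}+x^3=3x(\sigma_{11}+x^2/3)$; third moments become linear in the mean, and second
moments pay with the factor $2/3$. -/
theorem vec_gaussianForm {K : Type*} [Field K] [CharZero K] (w x y a b c : K) :
    vec (gaussianForm (2 / 3) w x y (w * (a + x ^ 2 / 3)) (w * (b + x * y / 3))
      (w * (c + y ^ 2 / 3))) = w • vec (cumulantMoment x y a b c 0 0 0 0) := by
  funext i
  revert i
  rw [forall_idx]
  simp only [Pi.smul_apply, smul_eq_mul, vec_ix, cumulantMoment, gaussianForm]
  refine ⟨?_, ?_, ?_, ?_, ?_, ?_, ?_, ?_, ?_, ?_⟩ <;> first | trivial | ring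

/-- The parametrization of the affine cone over the Gaussian moment variety. -/
noncomputable def gaussianParam : Idx 2 3 → MvPolynomial (Fin 6) ℂ :=
  vec (gaussianForm (C (2 / 3)) (X 0) (X 1) (X 2) (X 3) (X 4) (X 5))

theorem eval_gaussianParam (t : Fin 6 → ℂ) : (fun i => eval t (gaussianParam i)) =
    vec (gaussianForm (2 / 3) (t 0) (t 1) (t 2) (t 3) (t 4) (t 5)) := by
  funext i
  revert i
  rw [forall_idx]
  simp [gaussianParam, gaussianForm]

/-- The parametrization of the affine cone over the variety of mixtures with equal variances. -/
noncomputable def equalVariancesParam : Idx 2 3 → MvPolynomial (Fin 8) ℂ :=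
  (X 0 : MvPolynomial (Fin 8) ℂ) • vec (cumulantMoment (R := MvPolynomial (Fin 8) ℂ) (X 1) (X 2) (X 3) (X 4) (X 5)
    (2 * X 6 ^ 3) (2 * (X 6 ^ 2 * X 7)) (2 * (X 6 * X 7 ^ 2)) (2 * X 7 ^ 3))

theorem eval_equalVariancesParam (t : Fin 8 → ℂ) : (fun i => eval t (equalVariancesParam i)) =
    t 0 • vec (cumulantMoment (t 1) (t 2) (t 3) (t 4) (t 5) (2 * t 6 ^ 3) (2 * (t 6 ^ 2 * t 7))
    (2 * (t 6 * t 7 ^ 2)) (2 * t 7 ^ 3)) := by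
  funext i
  revert i
  rw [forall_idx]
  simp [equalVariancesParam, cumulantMoment]

theorem infinite_ofReal_image_Icc {a b : ℝ} (h : a < b) :
    (Complex.ofReal '' Set.Icc a b).Infinite :=
  (Set.Icc_infinite h).image Complex.ofReal_injective.injOn

theorem homogeneousIdeal_gaussianVariety :
    homogeneousIdeal (gaussianVariety 2 3) = RingHom.ker (aeval (R := ℂ) gaussianParam) := by
  -- On this box the resulting covariance has diagonal entries at least $2-1/3$ and an off-diagonal
  -- entry of absolute value at most 1, so it is diagonally dominant.
  let lo : Fin 6 → ℝ := ![1, 0, 0, 4, 0, 4]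
  let hi : Fin 6 → ℝ := ![2, 1, 1, 5, 1, 5]
  refine homogeneousIdeal_closure_eq_ker (s := fun i => Complex.ofReal '' Set.Icc (lo i) (hi i))
    ?_ (fun i => infinite_ofReal_image_Icc (by fin_cases i <;> norm_num [lo, hi])) ?_
  · rintro v hv ⟨μ, S, hS, hp⟩
    obtain ⟨z, rfl⟩ := (Projectivization.mk_eq_mk_iff' ℂ _ _ hv _).1 hp
    refine ⟨![z, μ 0, μ 1, z * (S 0 0 + μ 0 ^ 2 / 3), z * (S 0 1 + μ 0 * μ 1 / 3),
      z * (S 1 1 + μ 1 ^ 2 / 3)], ?_⟩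
    rw [eval_gaussianParam, momentVector_gaussianMGF _ _ hS, ← vec_gaussianForm]
    rfl
  · intro t ht
    have ht' : ∀ i, ∃ r : ℝ, r ∈ Set.Icc (lo i) (hi i) ∧ t i = r := fun i => by
      obtain ⟨r, hr, h⟩ := ht i trivial
      exact ⟨r, hr, h.symm⟩
    choose r hr hrt using ht'
    have h0 := hr 0
    have h1 := hr 1
    have h2 := hr 2
    have h3 := hr 3
    have h4 := hr 4
    have h5 := hr 5
    simp only [lo, hi, Set.mem_Icc, Matrix.cons_val] at h0 h1 h2 h3 h4 h5
    have hw : r 0 ≠ 0 := by linarith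
    have hS : (!![r 3 / r 0 - r 1 ^ 2 / 3, r 4 / r 0 - r 1 * r 2 / 3;
        r 4 / r 0 - r 1 * r 2 / 3, r 5 / r 0 - r 2 ^ 2 / 3] : Matrix _ _ ℝ).PosSemidef := by
      have hw0 : 0 < r 0 := by linarith
      have hb : |r 4 / r 0 - r 1 * r 2 / 3| ≤ 1 := by
        have e1 : 0 ≤ r 4 / r 0 := by apply div_nonneg <;> linarith
        have e2 : r 4 / r 0 ≤ 1 := by rw [div_le_one hw0]; linarith
        have e3 : 0 ≤ r 1 * r 2 := by apply mul_nonneg <;> linarith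
        have e4 : r 1 * r 2 ≤ 1 := by nlinarith
        rw [abs_le]
        constructor <;> linarith
      have ha : 2 ≤ r 3 / r 0 := by rw [le_div_iff₀ hw0]; linarith
      have hc : 2 ≤ r 5 / r 0 := by rw [le_div_iff₀ hw0]; linarith
      refine posSemidef_of_le (hb.trans ?_) (hb.trans ?_) <;> nlinarith
    have key : (fun i => eval t (gaussianParam i)) = (r 0 : ℂ) •
        momentVector 3 (gaussianMGF ![r 1, r 2] !![r 3 / r 0 - r 1 ^ 2 / 3,
          r 4 / r 0 - r 1 * r 2 / 3; r 4 / r 0 - r 1 * r 2 / 3, r 5 / r 0 - r 2 ^ 2 / 3]) := by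
      rw [eval_gaussianParam, momentVector_gaussianMGF _ _ hS, ← vec_gaussianForm]
      have hw' : (r 0 : ℂ) ≠ 0 := by exact_mod_cast hw
      simp only [hrt]
      congr 2 <;> simp <;> field_simp
    have hne : (fun i => eval t (gaussianParam i)) ≠ 0 := by
      rw [key]
      exact smul_ne_zero (by exact_mod_cast hw)
        (momentVector_ne_zero 3 (constantCoeff_gaussianMGF _ _))
    exact ⟨hne, _, _, hS, (Projectivization.mk_eq_mk_iff' ℂ _ _ _ _).2 ⟨_, key.symm⟩⟩

theorem homogeneousIdeal_equalVariances :
    homogeneousIdeal (equalVariances 2 3) = RingHom.ker (aeval (R := ℂ) equalVariancesParam) := by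
  -- The box leaves room to subtract the between-component covariance: the remaining diagonal is at
  -- least 3 and the off-diagonal entry at most 2 in absolute value.
  let lo : Fin 8 → ℝ := ![1, 0, 0, 5, 0, 5, 0, 0]
  let hi : Fin 8 → ℝ := ![2, 1, 1, 6, 1, 6, 1, 1]
  refine homogeneousIdeal_closure_eq_ker (s := fun i => Complex.ofReal '' Set.Icc (lo i) (hi i))
    ?_ (fun i => infinite_ofReal_image_Icc (by fin_cases i <;> norm_num [lo, hi])) ?_
  · rintro v hv ⟨θ, hθ, hp⟩
    have hθ : θ.cov₁ = θ.cov₂ := hθ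
    obtain ⟨z, rfl⟩ := (Projectivization.mk_eq_mk_iff' ℂ _ _ hv _).1 hp.symm
    rw [momentVector_mgf, momentVector_gaussianMGF _ _ θ.posSemidef₁,
        momentVector_gaussianMGF _ _ θ.posSemidef₂, ← hθ, vec_cumulantMoment_mix]
    generalize (θ.w : ℂ) = w
    -- A complex cube root absorbs the skewness factor $w(1-w)(1-2w)$ into the difference of the
    -- means, so that the third cumulants take the parametrized form.
    obtain ⟨e, he⟩ := IsAlgClosed.exists_pow_nat_eq (w * (1 - w) * (1 - 2 * w) / 2)
      (n := 3) (by norm_num)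
    have he : w * (1 - w) * (1 - 2 * w) = 2 * e ^ 3 := by rw [he]; ring
    rw [he]
    generalize (θ.mean₁ 0 : ℂ) = x
    generalize (θ.mean₁ 1 : ℂ) = y
    generalize (θ.mean₂ 0 : ℂ) = x'
    generalize (θ.mean₂ 1 : ℂ) = y'
    refine ⟨![z, w * x + (1 - w) * x', w * y + (1 - w) * y',
        θ.cov₁ 0 0 + w * (1 - w) * (x - x') ^ 2, θ.cov₁ 0 1 + w * (1 - w) * ((x - x') * (y - y')),
        θ.cov₁ 1 1 + w * (1 - w) * (y - y') ^ 2, e * (x - x'), e * (y - y')], ?_⟩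
    rw [eval_equalVariancesParam]
    congr 2
    simp only [Matrix.cons_val]
    congr 1 <;> ring
  · intro t ht
    have ht' : ∀ i, ∃ r : ℝ, r ∈ Set.Icc (lo i) (hi i) ∧ t i = r := fun i => by
      obtain ⟨r, hr, h⟩ := ht i trivial
      exact ⟨r, hr, h.symm⟩
    choose r hr hrt using ht'
    have h0 := hr 0
    have h1 := hr 1
    have h2 := hr 2
    have h3 := hr 3
    have h4 := hr 4
    have h5 := hr 5
    have h6 := hr 6
    have h7 := hr 7
    simp only [lo, hi, Set.mem_Icc, Matrix.cons_val] at h0 h1 h2 h3 h4 h5 h6 h7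
    have hw : r 0 ≠ 0 := by linarith
    have hS : (!![r 3 - 2 * r 6 ^ 2, r 4 - 2 * (r 6 * r 7);
        r 4 - 2 * (r 6 * r 7), r 5 - 2 * r 7 ^ 2] : Matrix _ _ ℝ).PosSemidef := by
      have hb : |r 4 - 2 * (r 6 * r 7)| ≤ 2 := by
        have e3 : 0 ≤ r 6 * r 7 := by apply mul_nonneg <;> linarith
        have e4 : r 6 * r 7 ≤ 1 := by nlinarith
        rw [abs_le]
        constructor <;> linarith
      refine posSemidef_of_le (hb.trans ?_) (hb.trans ?_) <;> nlinarith
    -- At weight $1/3$ with mean difference $3(r_6,r_7)$, the factors $2/9$ and $2/27$ turn the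
    -- second and third central moments of the two means into $2r_6^2$, $2r_6^3$ and their mixed
    -- analogues. This explains the constant 2 in the parametrization.
    let θ : Mixture 2 :=
      ⟨1 / 3, ![r 1 + 2 * r 6, r 2 + 2 * r 7], ![r 1 - r 6, r 2 - r 7], _, _, by norm_num, hS, hS⟩
    have key : (fun i => eval t (equalVariancesParam i)) = (r 0 : ℂ) • momentVector 3 θ.mgf := by
      rw [eval_equalVariancesParam, momentVector_mgf, momentVector_gaussianMGF _ _ hS,
        momentVector_gaussianMGF _ _ hS, vec_cumulantMoment_mix]
      simp only [hrt]
      congr 2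
      simp only [θ]
      congr 1 <;> simp <;> ring
    have hne : (fun i => eval t (equalVariancesParam i)) ≠ 0 := by
      rw [key]
      exact smul_ne_zero (by exact_mod_cast hw) (momentVector_ne_zero 3 (constantCoeff_mgf θ))
    exact ⟨hne, θ, rfl, ((Projectivization.mk_eq_mk_iff' ℂ _ _ _ _).2 ⟨_, key.symm⟩).symm⟩

theorem topologicalKrullDim_gaussianVariety : topologicalKrullDim (gaussianVariety 2 3) = 5 := by
  apply le_antisymm (topologicalKrullDim_le_of_ker homogeneousIdeal_gaussianVariety)
  -- Covariances come before means in the flag: $m_{20}=\sigma_{11}+x^2$ must vanish once its own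
  -- and all later parameters are zero.
  let ψ : Idx 2 3 → MvPolynomial (Fin 5) ℂ :=
    vec (cumulantMoment (X 3) (X 4) (X 0) (X 1) (X 2) 0 0 0 0)
  have hψ : ∀ t, (fun i => eval t (ψ i)) =
      vec (cumulantMoment (t 3) (t 4) (t 0) (t 1) (t 2) 0 0 0 0) := by
    intro t
    funext i
    revert i
    rw [forall_idx]
    simp [ψ, cumulantMoment]
  refine le_topologicalKrullDim (n := 5) (ψ := ψ) (i₀ := ix 0 0) (by simp [ψ, cumulantMoment])
    (fun t hv => ?_) ![ix 2 0, ix 1 1, ix 0 2, ix 1 0, ix 0 1] ?_ ?_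
  · refine mk_mem_closure_of_ker homogeneousIdeal_gaussianVariety
      ![1, t 3, t 4, 1 * (t 0 + t 3 ^ 2 / 3), 1 * (t 1 + t 3 * t 4 / 3),
        1 * (t 2 + t 4 ^ 2 / 3)] hv ?_
    rw [eval_gaussianParam, hψ]
    exact ((vec_gaussianForm 1 _ _ _ _ _).trans (one_smul _ _)).symm
  · intro j t ht
    rw [congrFun (hψ t)]
    fin_cases j <;> simp [cumulantMoment, ht]
  · intro j
    rw [congrFun (hψ (Pi.single j 1))]
    fin_cases j <;> simp [cumulantMoment]

theorem topologicalKrullDim_equalVariances : topologicalKrullDim (equalVariances 2 3) = 7 := by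
  apply le_antisymm (topologicalKrullDim_le_of_ker homogeneousIdeal_equalVariances)
  -- The same flag with the direction of the third cumulants inserted between covariances and means;
  -- $m_{30}$ and $m_{03}$ detect its two parameters.
  let ψ : Idx 2 3 → MvPolynomial (Fin 7) ℂ :=
    vec (cumulantMoment (X 5) (X 6) (X 0) (X 1) (X 2) (2 * X 3 ^ 3) (2 * (X 3 ^ 2 * X 4))
      (2 * (X 3 * X 4 ^ 2)) (2 * X 4 ^ 3))
  have hψ : ∀ t, (fun i => eval t (ψ i)) =
      vec (cumulantMoment (t 5) (t 6) (t 0) (t 1) (t 2) (2 * t 3 ^ 3) (2 * (t 3 ^ 2 * t 4))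
      (2 * (t 3 * t 4 ^ 2)) (2 * t 4 ^ 3)) := by
    intro t
    funext i
    revert i
    rw [forall_idx]
    simp [ψ, cumulantMoment]
  refine le_topologicalKrullDim (n := 7) (ψ := ψ) (i₀ := ix 0 0) (by simp [ψ, cumulantMoment])
    (fun t hv => ?_) ![ix 2 0, ix 1 1, ix 0 2, ix 3 0, ix 0 3, ix 1 0, ix 0 1] ?_ ?_
  · refine mk_mem_closure_of_ker homogeneousIdeal_equalVariances
      ![1, t 5, t 6, t 0, t 1, t 2, t 3, t 4] hv ?_
    rw [eval_equalVariancesParam, hψ]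
    exact (one_smul ℂ _).symm
  · intro j t ht
    rw [congrFun (hψ t)]
    fin_cases j <;> simp [cumulantMoment, ht]
  · intro j
    rw [congrFun (hψ (Pi.single j 1))]
    fin_cases j <;> simp [cumulantMoment]

end Parametrization

/-! ### The degree of the Gaussian moment variety -/

section GaussianDegree

theorem aeval_mem_of_isHomogeneous {ι τ : Type} {V : ℕ → Submodule ℂ (MvPolynomial τ ℂ)}
    (h₀ : 1 ∈ V 0) (hmul : ∀ {k l p q}, p ∈ V k → q ∈ V l → p * q ∈ V (k + l))
    {ψ : ι → MvPolynomial τ ℂ} (hψ : ∀ i, ψ i ∈ V 1) {f : MvPolynomial ι ℂ} {n : ℕ}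
    (hf : f.IsHomogeneous n) : aeval ψ f ∈ V n := by
  classical
  rw [f.as_sum, map_sum]
  refine sum_mem fun d hd => ?_
  rw [aeval_monomial]
  have hpow : ∀ i k, ψ i ^ k ∈ V k := fun i k => by
    induction k with
    | zero => simpa using h₀
    | succ k ih => rw [pow_succ]; exact hmul ih (hψ i)
  have hprod : ∀ s : Finset ι, ∏ i ∈ s, ψ i ^ d i ∈ V (∑ i ∈ s, d i) := fun s => by
    induction s using Finset.induction_on with
    | empty => simpa using h₀
    | insert i s hi ih =>
      rw [Finset.prod_insert hi, Finset.sum_insert hi]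
      exact hmul (hpow i _) ih
  have hdeg : d.degree = n := by
    rw [Finsupp.degree_eq_weight_one]
    exact hf (mem_support_iff.1 hd)
  rw [← Algebra.smul_def, ← hdeg]
  exact Submodule.smul_mem _ _ (hprod _)

/-- The exponents of the monomials of degree `n` in the variables `w, a, b, c` and of degree at most
`2 deg w + deg a + deg b + deg c` in `x, y`. -/
def gaussianExponents (n : ℕ) : Set (Fin 6 →₀ ℕ) :=
  {e | e 0 + e 3 + e 4 + e 5 = n ∧ e 1 + e 2 ≤ 2 * e 0 + e 3 + e 4 + e 5}

theorem mul_mem_restrictSupport_gaussianExponents {k l : ℕ} {p q : MvPolynomial (Fin 6) ℂ}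
    (hp : p ∈ restrictSupport ℂ (gaussianExponents k))
    (hq : q ∈ restrictSupport ℂ (gaussianExponents l)) :
    p * q ∈ restrictSupport ℂ (gaussianExponents (k + l)) := by
  have := Submodule.mul_mem_mul hp hq
  rw [← restrictSupport_add] at this
  refine restrictSupport_mono (R := ℂ) ?_ this
  rintro _ ⟨d, ⟨hd, hd'⟩, e, ⟨he, he'⟩, rfl⟩
  simp only [gaussianExponents, Set.mem_ofPred_eq, Finsupp.add_apply]
  omega

theorem monomial_eq_mul (e : Fin 6 →₀ ℕ) : (monomial e 1 : MvPolynomial (Fin 6) ℂ) =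
    X 0 ^ e 0 * X 3 ^ e 3 * X 4 ^ e 4 * X 5 ^ e 5 * (X 1 ^ e 1 * X 2 ^ e 2) := by
  rw [monomial_eq, Finsupp.prod_fintype _ _ (by simp), Fin.prod_univ_six]
  simp only [map_one]
  ring

theorem mem_restrictSupport_gaussianExponents {k i j p q r n : ℕ} (hn : k + p + q + r = n)
    (hij : i + j ≤ 2 * k + p + q + r) :
    (X 0 ^ k * X 3 ^ p * X 4 ^ q * X 5 ^ r * (X 1 ^ i * X 2 ^ j) : MvPolynomial (Fin 6) ℂ) ∈
      restrictSupport ℂ (gaussianExponents n) := by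
  have := monomial_eq_mul (Finsupp.equivFunOnFinite.symm ![k, i, j, p, q, r])
  simp only [Finsupp.equivFunOnFinite_symm_apply_apply, Matrix.cons_val] at this
  rw [← this]
  refine (monomial_mem_restrictSupport ℂ).2 (Or.inl ?_)
  simp [gaussianExponents, hn, hij]

theorem gaussianParam_mem (i : Idx 2 3) :
    gaussianParam i ∈ restrictSupport ℂ (gaussianExponents 1) := by
  have hC : ∀ (c : ℂ) {p : MvPolynomial (Fin 6) ℂ},
      p ∈ restrictSupport ℂ (gaussianExponents 1) →
      C c * p ∈ restrictSupport ℂ (gaussianExponents 1) := fun c p hp => by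
    rw [C_mul']
    exact Submodule.smul_mem _ _ hp
  have hm := @mem_restrictSupport_gaussianExponents
  have e : ∀ (p q : MvPolynomial (Fin 6) ℂ), p ∈ restrictSupport ℂ (gaussianExponents 1) → p = q →
    q ∈ restrictSupport ℂ (gaussianExponents 1) := by
    rintro p q h rfl
    exact h
  have h3 : (3 : MvPolynomial (Fin 6) ℂ) = C 3 := (map_ofNat C 3).symm
  have h2 : (2 : MvPolynomial (Fin 6) ℂ) = C 2 := (map_ofNat C 2).symm
  revert i
  rw [forall_idx]
  simp only [gaussianParam, vec_ix, gaussianForm, h3, h2]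
  refine ⟨?_, ?_, ?_, ?_, ?_, ?_, ?_, ?_, ?_, ?_⟩
  · exact e _ _ (hm (k := 1) (i := 0) (j := 0) (p := 0) (q := 0) (r := 0) rfl (by simp)) (by ring)
  · exact e _ _ (hm (k := 1) (i := 1) (j := 0) (p := 0) (q := 0) (r := 0) rfl (by simp)) (by ring)
  · exact e _ _ (hm (k := 1) (i := 0) (j := 1) (p := 0) (q := 0) (r := 0) rfl (by simp)) (by ring)
  · exact e _ _ (add_mem
      (hm (k := 0) (i := 0) (j := 0) (p := 1) (q := 0) (r := 0) rfl (by simp))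
      (hC (2 / 3) (hm (k := 1) (i := 2) (j := 0) (p := 0) (q := 0) (r := 0) rfl (by simp))))
      (by ring)
  · exact e _ _ (add_mem
      (hm (k := 0) (i := 0) (j := 0) (p := 0) (q := 1) (r := 0) rfl (by simp))
      (hC (2 / 3) (hm (k := 1) (i := 1) (j := 1) (p := 0) (q := 0) (r := 0) rfl (by simp))))
      (by ring)
  · exact e _ _ (add_mem
      (hm (k := 0) (i := 0) (j := 0) (p := 0) (q := 0) (r := 1) rfl (by simp))
      (hC (2 / 3) (hm (k := 1) (i := 0) (j := 2) (p := 0) (q := 0) (r := 0) rfl (by simp))))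
      (by ring)
  · exact e _ _ (hC 3 (hm (k := 0) (i := 1) (j := 0) (p := 1) (q := 0) (r := 0) rfl (by simp)))
      (by ring)
  · exact e _ _ (add_mem
      (hC 2 (hm (k := 0) (i := 1) (j := 0) (p := 0) (q := 1) (r := 0) rfl (by simp)))
      (hm (k := 0) (i := 0) (j := 1) (p := 1) (q := 0) (r := 0) rfl (by simp)))
      (by ring)
  · exact e _ _ (add_mem
      (hm (k := 0) (i := 1) (j := 0) (p := 0) (q := 0) (r := 1) rfl (by simp))
      (hC 2 (hm (k := 0) (i := 0) (j := 1) (p := 0) (q := 1) (r := 0) rfl (by simp))))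
      (by ring)
  · exact e _ _ (hC 3 (hm (k := 0) (i := 0) (j := 1) (p := 0) (q := 0) (r := 1) rfl (by simp)))
      (by ring)

theorem aeval_gaussianParam_mem {f : MvPolynomial (Idx 2 3) ℂ} {n : ℕ} (hf : f.IsHomogeneous n) :
    aeval gaussianParam f ∈ restrictSupport ℂ (gaussianExponents n) :=
  aeval_mem_of_isHomogeneous (V := fun n => restrictSupport ℂ (gaussianExponents n))
    (by simpa using mem_restrictSupport_gaussianExponents (k := 0) (i := 0) (j := 0) (p := 0)
          (q := 0) (r := 0) (n := 0) rfl le_rfl)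
    (fun h h' => mul_mem_restrictSupport_gaussianExponents h h') gaussianParam_mem hf

/-! ### The finite extension containing the toric monomials -/

theorem isIntegral_of_pow_four_eq_algebraMap {R B : Type*} [CommRing R] [CommRing B] [Algebra R B]
    {z : B} (c₀ c₁ c₂ c₃ : R) (h : z ^ 4 = algebraMap R B c₃ * z ^ 3 + algebraMap R B c₂ * z ^ 2 +
      algebraMap R B c₁ * z + algebraMap R B c₀) : IsIntegral R z := by
  refine ⟨Polynomial.X ^ 4 - (Polynomial.C c₃ * Polynomial.X ^ 3 +
    Polynomial.C c₂ * Polynomial.X ^ 2 + Polynomial.C c₁ * Polynomial.X + Polynomial.C c₀),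
    Polynomial.monic_X_pow_sub Polynomial.degree_cubic_lt, ?_⟩
  simp only [Polynomial.eval₂_sub, Polynomial.eval₂_add, Polynomial.eval₂_mul,
    Polynomial.eval₂_pow, Polynomial.eval₂_X, Polynomial.eval₂_C]
  rw [h, sub_self]

theorem isIntegral_of_pow_four_eq {R B : Type*} [CommRing R] [CommRing B] [Algebra R B]
    {z c₀ c₁ c₂ c₃ : B} (h₀ : IsIntegral R c₀) (h₁ : IsIntegral R c₁) (h₂ : IsIntegral R c₂)
    (h₃ : IsIntegral R c₃) (h : z ^ 4 = c₃ * z ^ 3 + c₂ * z ^ 2 + c₁ * z + c₀) :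
    IsIntegral R z :=
  isIntegral_trans (R := R) (A := integralClosure R B) z
    (isIntegral_of_pow_four_eq_algebraMap ⟨c₀, h₀⟩ ⟨c₁, h₁⟩ ⟨c₂, h₂⟩ ⟨c₃, h₃⟩ h)

theorem isIntegral_of_sq_eq {R B : Type*} [CommRing R] [CommRing B] [Algebra R B]
    {z c₀ c₁ : B} (h₀ : IsIntegral R c₀) (h₁ : IsIntegral R c₁) (h : z ^ 2 = c₁ * z + c₀) :
    IsIntegral R z :=
  isIntegral_of_pow_four_eq (c₃ := 0) (c₂ := c₁ ^ 2 + c₀) (c₁ := c₁ * c₀) (c₀ := 0) isIntegral_zero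
    (h₁.mul h₀) ((h₁.pow 2).add h₀) isIntegral_zero (by linear_combination (z ^ 2 + c₁ * z) * h)

/-- The subalgebra generated by the parametrization of the Gaussian moment variety. -/
noncomputable abbrev gaussianAlgebra : Subalgebra ℂ (MvPolynomial (Fin 6) ℂ) :=
  (aeval gaussianParam : MvPolynomial (Idx 2 3) ℂ →ₐ[ℂ] MvPolynomial (Fin 6) ℂ).range

theorem gaussianParam_mem_gaussianAlgebra (i : Idx 2 3) : gaussianParam i ∈ gaussianAlgebra :=
  ⟨X i, by simp⟩

/-- A module-finite extension of `gaussianAlgebra`. -/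
noncomputable abbrev gaussianExtension :
    Subalgebra gaussianAlgebra (MvPolynomial (Fin 6) ℂ) :=
  Algebra.adjoin gaussianAlgebra {X 3, X 4, X 5, X 2 * X 3, X 2 * X 4}

theorem C_mem_gaussianAlgebra (c : ℂ) : (C c : MvPolynomial (Fin 6) ℂ) ∈ gaussianAlgebra :=
  Subalgebra.algebraMap_mem _ c

theorem gaussianForm_mem_gaussianAlgebra :
    (X 0 : MvPolynomial (Fin 6) ℂ) ∈ gaussianAlgebra ∧
    (X 0 * X 1 : MvPolynomial (Fin 6) ℂ) ∈ gaussianAlgebra ∧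
    (X 0 * X 2 : MvPolynomial (Fin 6) ℂ) ∈ gaussianAlgebra ∧
    (X 3 + C (2 / 3) * (X 0 * X 1 ^ 2) : MvPolynomial (Fin 6) ℂ) ∈ gaussianAlgebra ∧
    (X 4 + C (2 / 3) * (X 0 * X 1 * X 2) : MvPolynomial (Fin 6) ℂ) ∈ gaussianAlgebra ∧
    (X 5 + C (2 / 3) * (X 0 * X 2 ^ 2) : MvPolynomial (Fin 6) ℂ) ∈ gaussianAlgebra ∧
    (X 1 * X 3 : MvPolynomial (Fin 6) ℂ) ∈ gaussianAlgebra ∧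
    (2 * (X 1 * X 4) + X 2 * X 3 : MvPolynomial (Fin 6) ℂ) ∈ gaussianAlgebra ∧
    (X 1 * X 5 + 2 * (X 2 * X 4) : MvPolynomial (Fin 6) ℂ) ∈ gaussianAlgebra ∧
    (X 2 * X 5 : MvPolynomial (Fin 6) ℂ) ∈ gaussianAlgebra := by
  have h := forall_idx.1 gaussianParam_mem_gaussianAlgebra
  simp only [gaussianParam, vec_ix, gaussianForm] at h
  obtain ⟨h1, h2, h3, h4, h5, h6, h7, h8, h9, h10⟩ := h
  have h3' : C (1 / 3) * (3 : MvPolynomial (Fin 6) ℂ) = 1 := by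
    rw [← map_ofNat C 3, ← C_mul]
    norm_num
  refine ⟨h1, h2, h3, ?_, ?_, ?_, ?_, h8, h9, ?_⟩
  · convert h4 using 1; ring
  · convert h5 using 1; ring
  · convert h6 using 1; ring
  · convert mul_mem (C_mem_gaussianAlgebra (1 / 3)) h7 using 1
    linear_combination (- X 1 * X 3) * h3'
  · convert mul_mem (C_mem_gaussianAlgebra (1 / 3)) h10 using 1
    linear_combination (- X 2 * X 5) * h3'

/-- The third moments are the coefficients of the binary cubic $(xs+yt)(as^2+2bst+ct^2)$. The
products of coefficients of the two factors are integral over the coefficients of the cubic, and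
then $a,b,c$ satisfy quadratic equations coming from the second moments. -/
theorem isIntegral_gaussianExtension_generators :
    ∀ z ∈ ({X 3, X 4, X 5, X 2 * X 3, X 2 * X 4} : Set (MvPolynomial (Fin 6) ℂ)),
      IsIntegral gaussianAlgebra z := by
  have hI : ∀ z ∈ gaussianAlgebra, IsIntegral gaussianAlgebra z := fun z hz =>
    isIntegral_algebraMap (x := (⟨z, hz⟩ : gaussianAlgebra))
  obtain ⟨h1, h2, h3, h4, h5, h6, h7, h8, h9, h10⟩ := gaussianForm_mem_gaussianAlgebra
  have h1 := hI _ h1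
  have h2 := hI _ h2
  have h3 := hI _ h3
  have h4 := hI _ h4
  have h5 := hI _ h5
  have h6 := hI _ h6
  have h7 := hI _ h7
  have h8 := hI _ h8
  have h9 := hI _ h9
  have h10 := hI _ h10
  have hC := fun c => hI _ (C_mem_gaussianAlgebra c)
  have hhalf : C (1 / 2) * (2 : MvPolynomial (Fin 6) ℂ) = 1 := by
    rw [← map_ofNat C 2, ← C_mul]
    norm_num
  have ha : IsIntegral gaussianAlgebra (X 3 : MvPolynomial (Fin 6) ℂ) :=
    isIntegral_of_sq_eq ((hC (-(2 / 3))).mul (h7.mul h2)) h4 (by rw [C_neg]; ring)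
  have hc : IsIntegral gaussianAlgebra (X 5 : MvPolynomial (Fin 6) ℂ) :=
    isIntegral_of_sq_eq ((hC (-(2 / 3))).mul (h10.mul h3)) h6 (by rw [C_neg]; ring)
  -- Write the cubic as $As^3+Bs^2t+Cst^2+Dt^3$. Its root $(-y,x)$ gives $z^3=Bz^2-ACz+A^2D$ for
  -- $z=ya$; multiplying by $z-B$ yields the quartic used here.
  have hya : IsIntegral gaussianAlgebra (X 2 * X 3 : MvPolynomial (Fin 6) ℂ) :=
    isIntegral_of_pow_four_eq
      (c₃ := (2 * (X 1 * X 4) + X 2 * X 3) + (2 * (X 1 * X 4) + X 2 * X 3))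
      (c₂ := -((2 * (X 1 * X 4) + X 2 * X 3) ^ 2 + (X 1 * X 5 + 2 * (X 2 * X 4)) * (X 1 * X 3)))
      (c₁ := (2 * (X 1 * X 4) + X 2 * X 3) * (X 1 * X 5 + 2 * (X 2 * X 4)) * (X 1 * X 3) +
        (X 1 * X 3) ^ 2 * (X 2 * X 5))
      (c₀ := -((X 1 * X 3) ^ 2 * (X 2 * X 5) * (2 * (X 1 * X 4) + X 2 * X 3)))
      (((h7.pow 2).mul h10).mul h8).neg
      (((h8.mul h9).mul h7).add ((h7.pow 2).mul h10)) ((h8.pow 2).add (h9.mul h7)).neg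
      (h8.add h8) (by ring)
  -- By symmetry $u=xc$ satisfies $u^3=Cu^2-BDu+AD^2$. Substituting $u=C-z$ with $z=2yb$ and
  -- multiplying by $z$ gives this quartic.
  have hyb : IsIntegral gaussianAlgebra (2 * (X 2 * X 4) : MvPolynomial (Fin 6) ℂ) :=
    isIntegral_of_pow_four_eq
      (c₃ := (X 1 * X 5 + 2 * (X 2 * X 4)) + (X 1 * X 5 + 2 * (X 2 * X 4)))
      (c₂ := -((X 1 * X 5 + 2 * (X 2 * X 4)) ^ 2 + (2 * (X 1 * X 4) + X 2 * X 3) * (X 2 * X 5)))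
      (c₁ := (2 * (X 1 * X 4) + X 2 * X 3) * (X 1 * X 5 + 2 * (X 2 * X 4)) * (X 2 * X 5) -
        (X 2 * X 5) ^ 2 * (X 1 * X 3))
      (c₀ := 0) isIntegral_zero (((h8.mul h9).mul h10).sub ((h10.pow 2).mul h7))
      ((h9.pow 2).add (h8.mul h10)).neg (h9.add h9) (by ring)
  have hyb' : IsIntegral gaussianAlgebra (X 2 * X 4 : MvPolynomial (Fin 6) ℂ) := by
    have := (hC (1 / 2)).mul hyb
    rwa [← mul_assoc, hhalf, one_mul] at this
  have hxb : IsIntegral gaussianAlgebra (X 1 * X 4 : MvPolynomial (Fin 6) ℂ) := by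
    have := (hC (1 / 2)).mul (h8.sub hya)
    rwa [add_sub_cancel_right, ← mul_assoc, hhalf, one_mul] at this
  have hb : IsIntegral gaussianAlgebra (X 4 : MvPolynomial (Fin 6) ℂ) :=
    isIntegral_of_sq_eq ((hC (-(2 / 3))).mul (hxb.mul h3)) h5 (by rw [C_neg]; ring)
  rintro z (rfl | rfl | rfl | rfl | rfl)
  exacts [ha, hb, hc, hya, hyb']

theorem mul_pow_mem_of_le {R B : Type*} [CommRing R] [CommRing B] [Algebra R B]
    {V : Subalgebra R B} {x y z z' : B} {n n' : ℕ}
    (h : ∀ i j, i + j ≤ n → z * (x ^ i * y ^ j) ∈ V)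
    (h' : ∀ i j, i + j ≤ n' → z' * (x ^ i * y ^ j) ∈ V) :
    ∀ i j, i + j ≤ n + n' → z * z' * (x ^ i * y ^ j) ∈ V := by
  intro i j hij
  obtain ⟨i₁, i₂, j₁, j₂, rfl, rfl, h₁, h₂⟩ : ∃ i₁ i₂ j₁ j₂, i = i₁ + i₂ ∧ j = j₁ + j₂ ∧
      i₁ + j₁ ≤ n ∧ i₂ + j₂ ≤ n' :=
    ⟨min i n, i - min i n, min j (n - min i n), j - min j (n - min i n), by omega, by omega,
      by omega, by omega⟩
  convert mul_mem (h _ _ h₁) (h' _ _ h₂) using 1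
  ring

/-- Such a monomial factors into pieces $wx^iy^j$ with $i+j\le2$ and $a,b,c$ times at most one of
$x,y$. All these pieces lie in the extension: the multiples of $w$ by subtracting $a,b,c$ from the
second moments. -/
theorem monomial_mem_gaussianExtension {n : ℕ} {e : Fin 6 →₀ ℕ} (he : e ∈ gaussianExponents n) :
    (monomial e 1 : MvPolynomial (Fin 6) ℂ) ∈ gaussianExtension := by
  have hA : ∀ z ∈ gaussianAlgebra, z ∈ gaussianExtension := fun z hz =>
    gaussianExtension.algebraMap_mem ⟨z, hz⟩
  obtain ⟨h1, h2, h3, h4, h5, h6, h7, h8, h9, h10⟩ := gaussianForm_mem_gaussianAlgebra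
  have h1 := hA _ h1
  have h2 := hA _ h2
  have h3 := hA _ h3
  have h4 := hA _ h4
  have h5 := hA _ h5
  have h6 := hA _ h6
  have h7 := hA _ h7
  have h8 := hA _ h8
  have h9 := hA _ h9
  have h10 := hA _ h10
  have hC := fun c => hA _ (C_mem_gaussianAlgebra c)
  have ha : X 3 ∈ gaussianExtension := Algebra.subset_adjoin (by simp)
  have hb : X 4 ∈ gaussianExtension := Algebra.subset_adjoin (by simp)
  have hc : X 5 ∈ gaussianExtension := Algebra.subset_adjoin (by simp)
  have hya : X 2 * X 3 ∈ gaussianExtension := Algebra.subset_adjoin (by simp)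
  have hyb : X 2 * X 4 ∈ gaussianExtension := Algebra.subset_adjoin (by simp)
  have hhalf : C (1 / 2) * (2 : MvPolynomial (Fin 6) ℂ) = 1 := by
    rw [← map_ofNat C 2, ← C_mul]
    norm_num
  have h23 : C (3 / 2) * C (2 / 3) = (1 : MvPolynomial (Fin 6) ℂ) := by
    rw [← C_mul]
    norm_num
  have hxb : X 1 * X 4 ∈ gaussianExtension := by
    have := mul_mem (hC (1 / 2)) (sub_mem h8 hya)
    rwa [add_sub_cancel_right, ← mul_assoc, hhalf, one_mul] at this
  have hxc : X 1 * X 5 ∈ gaussianExtension := by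
    convert sub_mem (sub_mem h9 hyb) hyb using 1
    ring
  have hw : ∀ i j, i + j ≤ 2 → X 0 * (X 1 ^ i * X 2 ^ j) ∈ gaussianExtension := by
    intro i j hij
    have hi : i ≤ 2 := by omega
    have hj : j ≤ 2 := by omega
    interval_cases i <;> interval_cases j <;> first | omega | skip
    · simpa using h1
    · simpa using h3
    · have := mul_mem (hC (3 / 2)) (sub_mem h6 hc)
      rw [add_sub_cancel_left, ← mul_assoc, h23, one_mul] at this
      simpa using this
    · simpa using h2
    · have := mul_mem (hC (3 / 2)) (sub_mem h5 hb)
      rw [add_sub_cancel_left, ← mul_assoc, h23, one_mul] at this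
      simpa [mul_assoc] using this
    · have := mul_mem (hC (3 / 2)) (sub_mem h4 ha)
      rw [add_sub_cancel_left, ← mul_assoc, h23, one_mul] at this
      simpa using this
  have hlin : ∀ z : MvPolynomial (Fin 6) ℂ, z ∈ gaussianExtension → X 1 * z ∈ gaussianExtension →
      X 2 * z ∈ gaussianExtension → ∀ i j, i + j ≤ 1 → z * (X 1 ^ i * X 2 ^ j) ∈ gaussianExtension := by
    intro z h0 hx hy i j hij
    have hi : i ≤ 1 := by omega
    have hj : j ≤ 1 := by omega
    interval_cases i <;> interval_cases j <;> first | omega | skip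
    · simpa using h0
    · simpa [mul_comm] using hy
    · simpa [mul_comm] using hx
  have hpow : ∀ (z : MvPolynomial (Fin 6) ℂ) (n k : ℕ),
      (∀ i j, i + j ≤ n → z * (X 1 ^ i * X 2 ^ j) ∈ gaussianExtension) →
      ∀ i j, i + j ≤ n * k → z ^ k * (X 1 ^ i * X 2 ^ j) ∈ gaussianExtension := by
    intro z n k hz
    induction k with
    | zero =>
      intro i j hij
      obtain ⟨rfl, rfl⟩ : i = 0 ∧ j = 0 := by omega
      simp
    | succ k ih =>
      rw [pow_succ]
      exact mul_pow_mem_of_le ih hz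
  rw [monomial_eq_mul]
  exact mul_pow_mem_of_le (mul_pow_mem_of_le (mul_pow_mem_of_le (hpow _ _ _ hw)
    (hpow _ _ _ (hlin _ ha h7 hya))) (hpow _ _ _ (hlin _ hb hxb hyb)))
    (hpow _ _ _ (hlin _ hc hxc h10)) _ _ (by have := he.2; omega)

/-- A power of $w$ clears the denominators of each element, since $wy$, $wa$, $wb$ and $wc$ are
polynomials in the moments. A single exponent works because the extension is a finite module: take
the largest one over its generators. -/
theorem exists_pow_mul_mem_gaussianAlgebra :
    ∃ N : ℕ, ∀ z ∈ gaussianExtension, X 0 ^ N * z ∈ gaussianAlgebra := by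
  obtain ⟨h1, h2, h3, h4, h5, h6, h7, h8, h9, h10⟩ := gaussianForm_mem_gaussianAlgebra
  have hD : ∀ z ∈ gaussianExtension, ∃ n, X 0 ^ n * z ∈ gaussianAlgebra := by
    intro z hz
    have hmul : ∀ z z' : MvPolynomial (Fin 6) ℂ, (∃ n, X 0 ^ n * z ∈ gaussianAlgebra) →
        (∃ n, X 0 ^ n * z' ∈ gaussianAlgebra) → ∃ n, X 0 ^ n * (z * z') ∈ gaussianAlgebra := by
      rintro z z' ⟨n, hn⟩ ⟨n', hn'⟩
      refine ⟨n + n', ?_⟩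
      convert mul_mem hn hn' using 1
      ring
    have ha : ∃ n, X 0 ^ n * X 3 ∈ gaussianAlgebra := by
      refine ⟨1, ?_⟩
      convert sub_mem (mul_mem h1 h4) (mul_mem (C_mem_gaussianAlgebra (2 / 3)) (mul_mem h2 h2))
        using 1
      ring
    have hb : ∃ n, X 0 ^ n * X 4 ∈ gaussianAlgebra := by
      refine ⟨1, ?_⟩
      convert sub_mem (mul_mem h1 h5) (mul_mem (C_mem_gaussianAlgebra (2 / 3)) (mul_mem h2 h3))
        using 1
      ring
    have hc : ∃ n, X 0 ^ n * X 5 ∈ gaussianAlgebra := by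
      refine ⟨1, ?_⟩
      convert sub_mem (mul_mem h1 h6) (mul_mem (C_mem_gaussianAlgebra (2 / 3)) (mul_mem h3 h3))
        using 1
      ring
    have hy : ∃ n, X 0 ^ n * X 2 ∈ gaussianAlgebra := ⟨1, by simpa using h3⟩
    induction hz using Algebra.adjoin_induction with
    | mem z hz =>
      rcases hz with rfl | rfl | rfl | rfl | rfl
      exacts [ha, hb, hc, hmul _ _ hy ha, hmul _ _ hy hb]
    | algebraMap r => exact ⟨0, by simp⟩
    | add z z' _ _ hz hz' =>
      obtain ⟨n, hn⟩ := hz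
      obtain ⟨n', hn'⟩ := hz'
      refine ⟨n + n', ?_⟩
      convert add_mem (mul_mem (pow_mem h1 n') hn) (mul_mem (pow_mem h1 n) hn') using 1
      ring
    | mul z z' _ _ hz hz' => exact hmul z z' hz hz'
  obtain ⟨t, ht⟩ := fg_adjoin_of_finite (R := gaussianAlgebra)
    (s := {X 3, X 4, X 5, X 2 * X 3, X 2 * X 4}) (by simp) isIntegral_gaussianExtension_generators
  have ht' : ∀ z ∈ t, z ∈ gaussianExtension := fun z hz => by
    have : z ∈ Subalgebra.toSubmodule gaussianExtension := ht ▸ Submodule.subset_span hz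
    exact this
  choose! n hn using fun z hz => hD z (ht' z hz)
  refine ⟨t.sup n, fun z hz => ?_⟩
  have hz' : z ∈ Submodule.span gaussianAlgebra (t : Set (MvPolynomial (Fin 6) ℂ)) := ht ▸ hz
  clear hz
  induction hz' using Submodule.span_induction with
  | mem z hz =>
    obtain ⟨k, hk⟩ := Nat.exists_eq_add_of_le (Finset.le_sup (f := n) hz)
    rw [hk]
    convert mul_mem (pow_mem h1 k) (hn z hz) using 1
    ring
  | zero => simp
  | add z z' _ _ hz hz' =>
    rw [mul_add]
    exact add_mem hz hz'
  | smul r z _ hz =>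
    rw [Algebra.smul_def, mul_left_comm]
    exact mul_mem r.2 hz

/-! ### Counting the toric monomials and the degree 16 -/

theorem ncard_gaussianExponents (n : ℕ) : (gaussianExponents n).ncard =
    ∑ s ∈ Finset.range (n + 1), (s + 2).choose s * (2 * n - s + 2).choose (2 * n - s) := by
  classical
  let D : ℕ → Finset (Fin 3 →₀ ℕ) := fun k => (Finset.univ : Finset (Fin 3)).finsuppAntidiag k
  have hD : ∀ k d, d ∈ D k ↔ d 0 + d 1 + d 2 = k := fun k d => by
    simp [D, Fin.sum_univ_three]
  have hcard : ∀ k, (D k).card = (k + 2).choose k := fun k => by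
    rw [Finset.card_finsuppAntidiag_nat_eq_choose, Finset.card_univ, Fintype.card_fin]
    congr 1
    omega
  -- Slices by the degree $s$ in $a,b,c$: then $w$ has exponent $n-s$, and the bound for $x,y$ is
  -- $2(n-s)+s=2n-s$. A third entry is the slack in that inequality.
  let F : Finset ((Fin 3 →₀ ℕ) × (Fin 3 →₀ ℕ)) :=
    (Finset.range (n + 1)).biUnion fun s => D s ×ˢ D (2 * n - s)
  have hF : F.card = ∑ s ∈ Finset.range (n + 1),
      (s + 2).choose s * (2 * n - s + 2).choose (2 * n - s) := by
    rw [Finset.card_biUnion]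
    · simp [Finset.card_product, hcard]
    · intro s _ s' _ hs
      refine Finset.disjoint_left.2 fun p hp hp' => hs ?_
      rw [Finset.mem_product, hD, hD] at hp hp'
      exact hp.1.symm.trans hp'.1
  let g : (Fin 3 →₀ ℕ) × (Fin 3 →₀ ℕ) → (Fin 6 →₀ ℕ) := fun p =>
    Finsupp.equivFunOnFinite.symm
      ![n - (p.1 0 + p.1 1 + p.1 2), p.2 0, p.2 1, p.1 0, p.1 1, p.1 2]
  have hmem : ∀ p, p ∈ F ↔ p.1 0 + p.1 1 + p.1 2 ≤ n ∧
      p.2 0 + p.2 1 + p.2 2 = 2 * n - (p.1 0 + p.1 1 + p.1 2) := fun p => by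
    simp only [F, Finset.mem_biUnion, Finset.mem_range, Finset.mem_product, hD]
    constructor
    · rintro ⟨s, hs, rfl, h⟩
      exact ⟨by omega, h⟩
    · rintro ⟨h, h'⟩
      exact ⟨_, by omega, rfl, h'⟩
  have himage : gaussianExponents n = g '' (F : Set _) := by
    ext e
    simp only [Set.mem_image, Finset.mem_coe, hmem]
    constructor
    · rintro ⟨h, h'⟩
      refine ⟨(Finsupp.equivFunOnFinite.symm ![e 3, e 4, e 5], Finsupp.equivFunOnFinite.symm
        ![e 1, e 2, 2 * n - (e 3 + e 4 + e 5) - e 1 - e 2]), ⟨?_, ?_⟩, ?_⟩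
      · simp
        omega
      · simp
        omega
      · ext k
        fin_cases k <;> simp [g]
        omega
    · rintro ⟨p, ⟨h, h'⟩, rfl⟩
      simp [gaussianExponents, g]
      omega
  rw [himage, Set.InjOn.ncard_image, Set.ncard_coe_finset, hF]
  rintro ⟨p, q⟩ hp ⟨p', q'⟩ hp' h
  rw [Finset.mem_coe, hmem] at hp hp'
  have hk := fun k => DFunLike.congr_fun h k
  have h1 := hk 1
  have h2 := hk 2
  have h3 := hk 3
  have h4 := hk 4
  have h5 := hk 5
  simp only [g, Finsupp.equivFunOnFinite_symm_apply_apply, Matrix.cons_val] at h1 h2 h3 h4 h5 hp hp'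
  have hp : p = p' := by
    ext k
    fin_cases k
    exacts [h3, h4, h5]
  have hq : q = q' := by
    ext k
    fin_cases k
    exacts [h1, h2, by simp; omega]
  rw [hp, hq]

theorem sum_choose_mul_choose (n : ℕ) :
    ((∑ s ∈ Finset.range (n + 1), (s + 2).choose s * (2 * n - s + 2).choose (2 * n - s) : ℕ) : ℚ) =
      2 / 15 * n ^ 5 + 9 / 8 * n ^ 4 + 43 / 12 * n ^ 3 + 43 / 8 * n ^ 2 + 227 / 60 * n + 1 := by
  have hch : ∀ k : ℕ, (((k + 2).choose k : ℕ) : ℚ) = (k + 2) * (k + 1) / 2 := fun k => by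
    rw [Nat.choose_symm_add, Nat.cast_choose_two]
    push_cast
    ring
  -- The summation limit is decoupled from the value $2n$ in the summand, so that induction on the
  -- limit works.
  have key : ∀ k (x : ℚ), ∑ s ∈ Finset.range (k + 1), ((s : ℚ) + 2) * (s + 1) / 2 *
      ((x - s + 2) * (x - s + 1) / 2) =
      (1 + 47 / 60 * k - 5 / 8 * k ^ 2 - 1 / 3 * k ^ 3 + 1 / 8 * k ^ 4 + 1 / 20 * k ^ 5) +
      (3 / 2 + 2 * k + 1 / 8 * k ^ 2 - 1 / 2 * k ^ 3 - 1 / 8 * k ^ 4) * x +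
      (1 / 2 + 11 / 12 * k + 1 / 2 * k ^ 2 + 1 / 12 * k ^ 3) * x ^ 2 := fun k x => by
    induction k with
    | zero => simp; ring
    | succ k ih =>
      rw [Finset.sum_range_succ, ih]
      push_cast
      ring
  have h := key n (2 * n)
  push_cast
  rw [show 2 / 15 * (n : ℚ) ^ 5 + 9 / 8 * n ^ 4 + 43 / 12 * n ^ 3 + 43 / 8 * n ^ 2 +
    227 / 60 * n + 1 = _ from .trans (by ring) h.symm]
  refine Finset.sum_congr rfl fun s hs => ?_
  rw [Finset.mem_range] at hs
  rw [hch, hch, Nat.cast_sub (by omega)]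
  push_cast
  ring

theorem finrank_restrictSupport_gaussianExponents (n : ℕ) :
    (Module.finrank ℂ (restrictSupport ℂ (gaussianExponents n)) : ℚ) =
      2 / 15 * n ^ 5 + 9 / 8 * n ^ 4 + 43 / 12 * n ^ 3 + 43 / 8 * n ^ 2 + 227 / 60 * n + 1 := by
  rw [finrank_restrictSupport, ncard_gaussianExponents, sum_choose_mul_choose]

instance finite_restrictSupport_gaussianExponents (n : ℕ) :
    Module.Finite ℂ (restrictSupport ℂ (gaussianExponents n)) := by
  refine Module.finite_of_finrank_pos ?_
  have h := finrank_restrictSupport_gaussianExponents n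
  have : (0 : ℚ) < Module.finrank ℂ (restrictSupport ℂ (gaussianExponents n)) := by
    rw [h]
    positivity
  exact_mod_cast this

theorem quotientHilbert_ker {ι τ : Type} [Finite ι] (ψ : ι → MvPolynomial τ ℂ) (n : ℕ) :
    quotientHilbert (RingHom.ker (aeval (R := ℂ) ψ)) n =
      Module.finrank ℂ ((homogeneousSubmodule ι ℂ n).map (aeval (R := ℂ) ψ).toLinearMap) := by
  have h₁ := quotientHilbert_add (RingHom.ker (aeval (R := ℂ) ψ)) n
  rw [← finrank_map_add_finrank_inf_ker (aeval (R := ℂ) ψ).toLinearMap n] at h₁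
  exact Nat.add_right_cancel h₁

theorem isWeightedHomogeneous_of_mem {n : ℕ} {p : MvPolynomial (Fin 6) ℂ}
    (hp : p ∈ restrictSupport ℂ (gaussianExponents n)) :
    p.IsWeightedHomogeneous ![1, 0, 0, 1, 1, 1] n := by
  intro d hd
  have h := (hp (mem_support_iff.2 hd)).1
  rw [Finsupp.weight_apply, Finsupp.sum_fintype _ _ (by simp), Fin.sum_univ_six]
  simpa using h

/-- Giving $w,a,b,c$ weight 1 and $x,y$ weight 0 makes the parametrization graded; a preimage of
$w^Nv$ can therefore be replaced by its component of degree $N+n$. -/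
theorem exists_pow_mul_mem_map_gaussianParam : ∃ N : ℕ, ∀ n,
    ∀ v ∈ restrictSupport ℂ (gaussianExponents n), X 0 ^ N * v ∈
      (homogeneousSubmodule (Idx 2 3) ℂ (N + n)).map (aeval (R := ℂ) gaussianParam).toLinearMap := by
  classical
  obtain ⟨N, hN⟩ := exists_pow_mul_mem_gaussianAlgebra
  refine ⟨N, fun n v hv => ?_⟩
  have hv' : v ∈ gaussianExtension := by
    rw [v.as_sum]
    refine sum_mem fun d hd => ?_
    rw [← mul_one (coeff d v), ← C_mul_monomial]
    exact mul_mem (gaussianExtension.algebraMap_mem ⟨_, C_mem_gaussianAlgebra _⟩)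
      (monomial_mem_gaussianExtension (hv hd))
  obtain ⟨f, hf⟩ := hN v hv'
  have hX : (X 0 ^ N : MvPolynomial (Fin 6) ℂ) ∈ restrictSupport ℂ (gaussianExponents N) := by
    simpa using mem_restrictSupport_gaussianExponents (k := N) (i := 0) (j := 0) (p := 0)
        (q := 0) (r := 0) (n := N) (by simp) (by simp)
  refine ⟨homogeneousComponent (N + n) f, homogeneousComponent_mem _ _, ?_⟩
  have h₁ := (isWeightedHomogeneous_of_mem (mul_mem_restrictSupport_gaussianExponents hX hv)
    ).weightedHomogeneousComponent_same
  have h₂ : ∀ k, weightedHomogeneousComponent ![1, 0, 0, 1, 1, 1] (N + n)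
      (aeval gaussianParam (homogeneousComponent k f)) =
        if N + n = k then aeval gaussianParam (homogeneousComponent k f) else 0 := fun k =>
    weightedHomogeneousComponent_of_mem (isWeightedHomogeneous_of_mem
      (aeval_gaussianParam_mem (homogeneousComponent_isHomogeneous k f)))
  rw [← h₁, ← hf]
  simp only [AlgHom.toLinearMap_apply, AlgHom.toRingHom_eq_coe, RingHom.coe_coe]
  conv_rhs => rw [← sum_homogeneousComponent f]
  rw [map_sum, map_sum]
  simp only [h₂]
  rw [Finset.sum_ite_eq]
  split_ifs with h
  · rfl
  · rw [homogeneousComponent_eq_zero _ _ (by simpa using h), map_zero]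

theorem hasDegree_gaussianVariety : HasDegree (gaussianVariety 2 3) 16 := by
  let Q : Polynomial ℚ := Polynomial.C (2 / 15) * Polynomial.X ^ 5 +
    Polynomial.C (9 / 8) * Polynomial.X ^ 4 + Polynomial.C (43 / 12) * Polynomial.X ^ 3 +
    Polynomial.C (43 / 8) * Polynomial.X ^ 2 + Polynomial.C (227 / 60) * Polynomial.X +
    Polynomial.C 1
  have hQe : ∀ n : ℕ, Q.eval (n : ℚ) =
      Module.finrank ℂ (restrictSupport ℂ (gaussianExponents n)) := fun n => by
    rw [finrank_restrictSupport_gaussianExponents]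
    simp [Q]
  have hQd : Q.natDegree = 5 := by
    simp only [Q]
    compute_degree!
  have hQl : Q.leadingCoeff = 2 / 15 := by
    rw [Polynomial.leadingCoeff, hQd]
    simp [Q, Polynomial.coeff_one, Polynomial.coeff_X_pow]
  obtain ⟨P, hP⟩ := exists_hilbertPolynomial (homogeneousIdeal (gaussianVariety 2 3))
    fun f hf n => homogeneousComponent_mem_homogeneousIdeal hf n
  obtain ⟨N, hN⟩ := exists_pow_mul_mem_map_gaussianParam
  have hH : ∀ n, quotientHilbert (homogeneousIdeal (gaussianVariety 2 3)) n =
      Module.finrank ℂ ((homogeneousSubmodule (Idx 2 3) ℂ n).map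
        (aeval (R := ℂ) gaussianParam).toLinearMap) := fun n => by
    rw [homogeneousIdeal_gaussianVariety, quotientHilbert_ker]
  obtain ⟨hd, hl⟩ := leadingTerm_eq_of_le_of_le (P := P) (Q := Q) (by rw [hQl]; norm_num) N
    (by
      filter_upwards [hP] with n hn
      rw [← hn, hQe, hH]
      have : (homogeneousSubmodule (Idx 2 3) ℂ n).map (aeval (R := ℂ) gaussianParam).toLinearMap ≤
          restrictSupport ℂ (gaussianExponents n) := by
        rintro _ ⟨f, hf, rfl⟩
        exact aeval_gaussianParam_mem hf
      exact_mod_cast Submodule.finrank_mono this)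
    (by
      filter_upwards [hP, Filter.eventually_ge_atTop N] with n hn hNn
      obtain ⟨k, rfl⟩ := Nat.exists_eq_add_of_le hNn
      rw [← hn, hH, Nat.cast_add, add_sub_cancel_left, hQe]
      have hinj : Function.Injective
          ((LinearMap.mulLeft ℂ (X 0 ^ N : MvPolynomial (Fin 6) ℂ)).restrict (hN k)) := by
        intro v v' h
        have h' : X 0 ^ N * v.1 = X 0 ^ N * v'.1 := congrArg Subtype.val h
        exact Subtype.ext (mul_left_cancel₀ (pow_ne_zero _ (X_ne_zero _)) h')
      exact_mod_cast LinearMap.finrank_le_finrank_of_injective hinj)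
  refine ⟨P, hP, ?_⟩
  rw [hd, hl, hQd, hQl]
  norm_num [Nat.factorial]

end GaussianDegree

/-! ### Ideals of maximal minors of a matrix with one more row than columns -/

section HilbertBurch

theorem exists_eq_succAboveOrderEmb {c : ℕ} (e : Fin c ↪o Fin (c + 1)) :
    ∃ k : Fin (c + 1), e = Fin.succAboveOrderEmb k := by
  classical
  obtain ⟨k, hk⟩ : ∃ k, k ∉ Finset.univ.map e.toEmbedding := by
    by_contra! h
    have h1 := Finset.card_le_card (fun k _ => h k : Finset.univ ⊆ Finset.univ.map e.toEmbedding)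
    simp at h1
  refine ⟨k, ?_⟩
  have hs : Set.range e = {k}ᶜ := by
    have h2 : Finset.univ.map e.toEmbedding = {k}ᶜ := by
      apply Finset.eq_of_subset_of_card_le
      · intro x hx
        rw [Finset.mem_compl, Finset.mem_singleton]
        rintro rfl
        exact hk hx
      · simp [Finset.card_compl]
    have := congrArg (fun s : Finset (Fin (c + 1)) => (s : Set (Fin (c + 1)))) h2
    simpa using this
  have hr : Set.range e = Set.range (Fin.succAboveOrderEmb k) := by
    rw [hs]
    exact (Fin.range_succAbove k).symm
  exact OrderEmbedding.range_inj.1 hr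

theorem maximalMinors_eq_span {R : Type*} [CommRing R] {c : ℕ}
    (A : Matrix (Fin (c + 1)) (Fin c) R) : maximalMinors A =
      Ideal.span (Set.range fun k : Fin (c + 1) => (A.submatrix k.succAbove id).det) := by
  rw [maximalMinors]
  congr 1
  ext x
  constructor
  · rintro ⟨e, rfl⟩
    obtain ⟨k, rfl⟩ := exists_eq_succAboveOrderEmb e
    exact ⟨k, rfl⟩
  · rintro ⟨k, rfl⟩
    exact ⟨Fin.succAboveOrderEmb k, rfl⟩

/-- Repeat column `j` in front of `A` and expand the vanishing determinant along it. These are the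
Hilbert–Burch syzygies. -/
theorem sum_mul_det_submatrix_succAbove {R : Type*} [CommRing R] {c : ℕ}
    (A : Matrix (Fin (c + 1)) (Fin c) R) (j : Fin c) :
    ∑ k : Fin (c + 1), (-1) ^ (k : ℕ) * A k j * (A.submatrix k.succAbove id).det = 0 := by
  let B : Matrix (Fin (c + 1)) (Fin (c + 1)) R := Matrix.of fun k => Fin.cons (A k j) (A k)
  have hB : B.det = 0 := Matrix.det_zero_of_column_eq (Fin.succ_ne_zero j).symm fun k => by simp [B]
  rw [Matrix.det_succ_column_zero] at hB
  exact hB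

variable {ι : Type}

theorem exists_of_mem_span_range {κ : Type*} [Fintype κ] {g : κ → MvPolynomial ι ℂ} {c : ℕ}
    (hg : ∀ k, (g k).IsHomogeneous c) {l : ℕ} {f : MvPolynomial ι ℂ} (hf : f.IsHomogeneous (c + l))
    (hfg : f ∈ Ideal.span (Set.range g)) :
    ∃ h : κ → homogeneousSubmodule ι ℂ l, ∑ k, (h k : MvPolynomial ι ℂ) * g k = f := by
  obtain ⟨h, hh⟩ := Ideal.mem_span_range_iff_exists_fun.1 hfg
  refine ⟨fun k => ⟨homogeneousComponent l (h k), homogeneousComponent_mem _ _⟩, ?_⟩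
  have := congrArg (homogeneousComponent (c + l)) hh
  rw [homogeneousComponent_of_isHomogeneous hf, if_pos rfl, map_sum] at this
  rw [← this]
  refine Finset.sum_congr rfl fun k _ => ?_
  rw [mul_comm, mul_comm (h k), homogeneousComponent_mul_left (hg k)]

theorem componentClosed_span_range {κ : Type*} [Fintype κ] {g : κ → MvPolynomial ι ℂ} {c : ℕ}
    (hg : ∀ k, (g k).IsHomogeneous c) : ComponentClosed (Ideal.span (Set.range g)) := by
  intro f hf n
  obtain ⟨h, rfl⟩ := Ideal.mem_span_range_iff_exists_fun.1 hf
  rw [map_sum]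
  refine sum_mem fun k _ => ?_
  rw [mul_comm]
  by_cases hn : n < c
  · rw [homogeneousComponent_mul_left_of_lt (hg k) _ hn]
    exact zero_mem _
  · obtain ⟨l, rfl⟩ := Nat.exists_eq_add_of_le (not_lt.1 hn)
    rw [homogeneousComponent_mul_left (hg k)]
    exact Ideal.mul_mem_right _ _ (Ideal.subset_span ⟨k, rfl⟩)

theorem isHomogeneous_det {c : ℕ} {A : Matrix (Fin c) (Fin c) (MvPolynomial ι ℂ)}
    (hA : ∀ i j, (A i j).IsHomogeneous 1) : A.det.IsHomogeneous c := by
  rw [Matrix.det_apply]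
  refine IsHomogeneous.sum _ _ _ fun σ _ => ?_
  have := IsHomogeneous.prod Finset.univ (fun i => A (σ i) i) (fun _ => 1) fun i _ => hA _ _
  simp only [Finset.sum_const, Finset.card_univ, Fintype.card_fin, smul_eq_mul, mul_one] at this
  rw [Units.smul_def]
  exact zsmul_mem (S := Submodule ℂ (MvPolynomial ι ℂ)) (K := homogeneousSubmodule ι ℂ c) this _

variable {c : ℕ} {A : Matrix (Fin (c + 1)) (Fin c) (MvPolynomial ι ℂ)}

theorem isHomogeneous_minor (hA : ∀ i j, (A i j).IsHomogeneous 1) (k : Fin (c + 1)) :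
    (A.submatrix k.succAbove id).det.IsHomogeneous c :=
  isHomogeneous_det (A := A.submatrix k.succAbove id) fun _ _ => hA _ _

theorem componentClosed_maximalMinors (hA : ∀ i j, (A i j).IsHomogeneous 1) :
    ComponentClosed (maximalMinors A) := by
  rw [maximalMinors_eq_span]
  exact componentClosed_span_range (isHomogeneous_minor hA)

/-- The degree part is covered by $c+1$ copies of forms of degree $l+1$, one per minor, and the
columns of `A` embed $c$ copies of forms of degree $l$ into the relations. A nonzero minor makes
this embedding injective; exactness of the complex is not required. -/
theorem finrank_degreePart_maximalMinors_add_le [Finite ι] (hA : ∀ i j, (A i j).IsHomogeneous 1)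
    {k₀ : Fin (c + 1)} (hk₀ : (A.submatrix k₀.succAbove id).det ≠ 0) (l : ℕ) :
    Module.finrank ℂ (degreePart (maximalMinors A) (c + (l + 1))) +
      c * Module.finrank ℂ (homogeneousSubmodule ι ℂ l) ≤
      (c + 1) * Module.finrank ℂ (homogeneousSubmodule ι ℂ (l + 1)) := by
  let L : (Fin (c + 1) → homogeneousSubmodule ι ℂ (l + 1)) →ₗ[ℂ] MvPolynomial ι ℂ :=
    { toFun := fun h => ∑ k : Fin (c + 1), (h k : MvPolynomial ι ℂ) *
        (A.submatrix k.succAbove id).det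
      map_add' := fun h h' => by simp [add_mul, Finset.sum_add_distrib]
      map_smul' := fun a h => by simp [Finset.smul_sum] }
  let M : (Fin c → homogeneousSubmodule ι ℂ l) →ₗ[ℂ] (Fin (c + 1) → homogeneousSubmodule ι ℂ (l + 1)) :=
    { toFun := fun h k => ⟨∑ j, (h j : MvPolynomial ι ℂ) * ((-1) ^ (k : ℕ) * A k j),
        IsHomogeneous.sum _ _ _ fun j _ => (h j).2.mul (by
          simpa using ((isHomogeneous_one ι ℂ).neg.pow (k : ℕ)).mul (hA k j))⟩
      map_add' := fun h h' => by
        ext1 k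
        apply Subtype.ext
        simp [add_mul, Finset.sum_add_distrib]
      map_smul' := fun a h => by
        ext1 k
        apply Subtype.ext
        simp [Finset.smul_sum] }
  have hLM : ∀ h, M h ∈ LinearMap.ker L := fun h => by
    rw [LinearMap.mem_ker]
    change ∑ k : Fin (c + 1), (∑ j, (h j : MvPolynomial ι ℂ) * ((-1) ^ (k : ℕ) * A k j)) *
      (A.submatrix k.succAbove id).det = 0
    simp only [Finset.sum_mul]
    rw [Finset.sum_comm]
    refine Finset.sum_eq_zero fun j _ => ?_
    have := congrArg ((h j : MvPolynomial ι ℂ) * ·) (sum_mul_det_submatrix_succAbove A j)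
    simp only [mul_zero, Finset.mul_sum] at this
    rw [← this]
    exact Finset.sum_congr rfl fun k _ => by ring
  have hM : Function.Injective (M.codRestrict _ hLM) := by
    rw [injective_iff_map_eq_zero]
    intro h hh
    have h1 : ∀ k, ∑ j, (h j : MvPolynomial ι ℂ) * A k j = 0 := fun k => by
      have h0 : ∑ j, (h j : MvPolynomial ι ℂ) * ((-1) ^ (k : ℕ) * A k j) = 0 :=
        congrArg Subtype.val (congrFun (congrArg Subtype.val hh) k)
      simp only [mul_left_comm _ ((-1 : MvPolynomial ι ℂ) ^ (k : ℕ)), ← Finset.mul_sum] at h0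
      exact (mul_eq_zero.1 h0).resolve_left (pow_ne_zero _ (by simp))
    have h2 : (A.submatrix k₀.succAbove id).mulVec (fun j => (h j : MvPolynomial ι ℂ)) = 0 := by
      funext i
      rw [Pi.zero_apply, ← h1 (k₀.succAbove i)]
      change ∑ j, A (k₀.succAbove i) j * (h j : MvPolynomial ι ℂ) = _
      exact Finset.sum_congr rfl fun j _ => mul_comm (A (k₀.succAbove i) j) (h j)
    have h3 := Matrix.eq_zero_of_mulVec_eq_zero hk₀ h2
    funext j
    exact Subtype.ext (congrFun h3 j)
  have e1 := LinearMap.finrank_le_finrank_of_injective hM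
  have e2 := LinearMap.finrank_range_add_finrank_ker L
  have e3 : degreePart (maximalMinors A) (c + (l + 1)) ≤ LinearMap.range L := fun f hf =>
    exists_of_mem_span_range (isHomogeneous_minor hA) (mem_degreePart.1 hf).1
      (by rw [← maximalMinors_eq_span]; exact (mem_degreePart.1 hf).2)
  have e4 := Submodule.finrank_mono e3
  rw [Module.finrank_pi_fintype] at e1 e2
  simp only [Finset.sum_const, Finset.card_univ, Fintype.card_fin, smul_eq_mul] at e1 e2
  omega

end HilbertBurch

/-! ### The ideal of maximal minors of the matrix of moments -/

section MomentMatrix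

/-- The matrix `hilbertBurchMatrix`, for a vector of moments in any ring. -/
noncomputable def momentMatrix {R : Type*} [CommRing R] (f : Idx 2 3 → R) :
    Matrix (Fin 6) (Fin 5) R :=
  !![0, 0, f (ix 0 0), f (ix 1 0), f (ix 0 1);
     0, f (ix 1 0), f (ix 2 0), f (ix 3 0), f (ix 2 1);
     f (ix 0 1), 0, f (ix 0 2), f (ix 1 2), f (ix 0 3);
     0, f (ix 0 0), 2 * f (ix 1 0), 2 * f (ix 2 0), 2 * f (ix 1 1);
     f (ix 0 0), 0, 2 * f (ix 0 1), 2 * f (ix 1 1), 2 * f (ix 0 2);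
     f (ix 1 0), f (ix 0 1), 2 * f (ix 1 1), 2 * f (ix 2 1), 2 * f (ix 1 2)]

theorem hilbertBurchMatrix_eq : hilbertBurchMatrix = momentMatrix X := rfl

/-- The minor of `momentMatrix` without row `k`. -/
noncomputable def momentMinor {R : Type*} [CommRing R] (f : Idx 2 3 → R) (k : Fin 6) : R :=
  ((momentMatrix f).submatrix k.succAbove id).det

theorem maximalMinors_hilbertBurchMatrix :
    maximalMinors hilbertBurchMatrix = Ideal.span (Set.range (momentMinor X)) := by
  rw [maximalMinors_eq_span]
  rfl

theorem momentMinor_mem (k : Fin 6) : momentMinor X k ∈ maximalMinors hilbertBurchMatrix := by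
  rw [maximalMinors_hilbertBurchMatrix]
  exact Ideal.subset_span ⟨k, rfl⟩

theorem map_momentMinor {R R' : Type*} [CommRing R] [CommRing R'] (g : R →+* R') (f : Idx 2 3 → R)
    (k : Fin 6) : g (momentMinor f k) = momentMinor (fun i => g (f i)) k := by
  rw [momentMinor, momentMinor, RingHom.map_det]
  congr 1
  ext i j
  rw [RingHom.mapMatrix_apply, Matrix.map_apply, Matrix.submatrix_apply, Matrix.submatrix_apply]
  generalize k.succAbove i = i
  fin_cases i <;> fin_cases j <;> simp [momentMatrix, map_ofNat]

theorem isHomogeneous_hilbertBurchMatrix (i : Fin 6) (j : Fin 5) :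
    (hilbertBurchMatrix i j).IsHomogeneous 1 := by
  have h2 : ∀ k, (2 * X k : MvPolynomial (Idx 2 3) ℂ).IsHomogeneous 1 := fun k => by
    rw [← map_ofNat C 2]
    exact (isHomogeneous_X ℂ k).C_mul 2
  rw [hilbertBurchMatrix_eq]
  fin_cases i <;> fin_cases j <;>
    first
    | exact isHomogeneous_zero _ _ _
    | exact isHomogeneous_X _ _
    | exact h2 _

theorem isHomogeneous_momentMinor (k : Fin 6) :
    (momentMinor X k : MvPolynomial (Idx 2 3) ℂ).IsHomogeneous 5 :=
  isHomogeneous_minor isHomogeneous_hilbertBurchMatrix k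

theorem componentClosed_hilbertBurch : ComponentClosed (maximalMinors hilbertBurchMatrix) :=
  componentClosed_maximalMinors isHomogeneous_hilbertBurchMatrix

/-- The moment vectors on which all the linear forms `linearParam` vanish. -/
def sectionVec {R : Type*} [Zero R] (u v : R) : ℕ → ℕ → R
  | 1, 0 => u
  | 0, 1 => v
  | 0, 2 => u
  | 3, 0 => v
  | _, _ => 0

/-- Up to nonzero constants the values include $u^5,u^4v,u^3v^2,u^2v^3,uv^4$, and the remaining one
contributes $v^5$; together they span the binary quintics. -/
theorem momentMinor_sectionVec {R : Type*} [CommRing R] (u v : R) :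
    momentMinor (vec (sectionVec u v)) 0 = -(4 * (u ^ 2 * v ^ 3)) ∧
    momentMinor (vec (sectionVec u v)) 1 = -(4 * (u ^ 3 * v ^ 2)) ∧
    momentMinor (vec (sectionVec u v)) 2 = 4 * u ^ 5 ∧
    momentMinor (vec (sectionVec u v)) 3 = 2 * u ^ 5 + 2 * v ^ 5 ∧
    momentMinor (vec (sectionVec u v)) 4 = 2 * (u * v ^ 4) ∧
    momentMinor (vec (sectionVec u v)) 5 = 4 * (u ^ 4 * v) := by
  simp [momentMinor, momentMatrix, Matrix.det_succ_row_zero, Fin.sum_univ_succ, Fin.succAbove,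
    sectionVec]
  refine ⟨?_, ?_, ?_, ?_, ?_, ?_⟩ <;> ring

/-- A linear system of parameters for the ideal of minors. -/
noncomputable def linearParam : Fin 8 → MvPolynomial (Idx 2 3) ℂ :=
  ![X (ix 0 0), X (ix 2 0), X (ix 1 1), X (ix 0 2) - X (ix 1 0), X (ix 3 0) - X (ix 0 1),
    X (ix 2 1), X (ix 1 2), X (ix 0 3)]

theorem isHomogeneous_linearParam (j : Fin 8) : (linearParam j).IsHomogeneous 1 := by
  fin_cases j <;>
    first
    | exact isHomogeneous_X _ _
    | exact (isHomogeneous_X _ _).sub (isHomogeneous_X _ _)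

/-- Restriction to the plane on which the forms `linearParam` vanish. -/
noncomputable def restrictSection : MvPolynomial (Idx 2 3) ℂ →ₐ[ℂ] MvPolynomial (Idx 2 3) ℂ :=
  aeval (vec (sectionVec (X (ix 1 0)) (X (ix 0 1))))

theorem sub_restrictSection_mem (f : MvPolynomial (Idx 2 3) ℂ) :
    f - restrictSection f ∈ Ideal.span (Set.range linearParam) := by
  have hl : ∀ j, linearParam j ∈ Ideal.span (Set.range linearParam) := fun j =>
    Ideal.subset_span ⟨j, rfl⟩
  have : ∀ i, X i - restrictSection (X i) ∈ Ideal.span (Set.range linearParam) := by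
    rw [forall_idx]
    simp only [restrictSection, aeval_X, vec_ix, sectionVec, sub_zero, sub_self, zero_mem, true_and]
    exact ⟨hl 0, hl 1, hl 2, hl 3, hl 4, hl 5, hl 6, hl 7⟩
  have h : (Ideal.Quotient.mkₐ ℂ (Ideal.span (Set.range linearParam))) =
      (Ideal.Quotient.mkₐ ℂ (Ideal.span (Set.range linearParam))).comp restrictSection :=
    algHom_ext fun i => Ideal.Quotient.eq.2 (this i)
  exact Ideal.Quotient.eq.1 (DFunLike.congr_fun h f)

/-- The span of the products of `linearParam j` and a form of degree `n`. -/
noncomputable def linearParamSpan (n : ℕ) : Submodule ℂ (MvPolynomial (Idx 2 3) ℂ) :=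
  Submodule.span ℂ {f | ∃ j s, s.IsHomogeneous n ∧ f = linearParam j * s}

/-- The span of the monomials of degree `n` in the means. -/
noncomputable def meanSpan (n : ℕ) : Submodule ℂ (MvPolynomial (Idx 2 3) ℂ) :=
  Submodule.span ℂ {f | ∃ a b, a + b = n ∧ f = X (ix 1 0) ^ a * X (ix 0 1) ^ b}

theorem restrictSection_mem_meanSpan {n : ℕ} {f : MvPolynomial (Idx 2 3) ℂ}
    (hf : f.IsHomogeneous n) : restrictSection f ∈ meanSpan n := by
  refine aeval_mem_of_isHomogeneous (V := meanSpan) (Submodule.subset_span ⟨0, 0, rfl, by simp⟩)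
    ?_ ?_ hf
  · intro k l p q hp hq
    have h : meanSpan k * meanSpan l ≤ meanSpan (k + l) := by
      rw [meanSpan, meanSpan, Submodule.span_mul_span, Submodule.span_le]
      rintro _ ⟨_, ⟨a, b, rfl, rfl⟩, _, ⟨a', b', rfl, rfl⟩, rfl⟩
      exact Submodule.subset_span ⟨a + a', b + b', by omega, by ring⟩
    exact h (Submodule.mul_mem_mul hp hq)
  · have h1 : X (ix 1 0) ∈ meanSpan 1 := Submodule.subset_span ⟨1, 0, rfl, by simp⟩
    have h2 : X (ix 0 1) ∈ meanSpan 1 := Submodule.subset_span ⟨0, 1, rfl, by simp⟩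
    rw [forall_idx]
    simp [sectionVec, h1, h2]

theorem isHomogeneous_of_mem_meanSpan {n : ℕ} {f : MvPolynomial (Idx 2 3) ℂ}
    (hf : f ∈ meanSpan n) : f.IsHomogeneous n := by
  suffices meanSpan n ≤ homogeneousSubmodule _ ℂ n from this hf
  rw [meanSpan, Submodule.span_le]
  rintro _ ⟨a, b, rfl, rfl⟩
  simpa using ((isHomogeneous_X ℂ (ix 1 0)).pow a).mul ((isHomogeneous_X ℂ (ix 0 1)).pow b)

theorem sub_restrictSection_mem_linearParamSpan {n : ℕ} {f : MvPolynomial (Idx 2 3) ℂ}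
    (hf : f.IsHomogeneous (n + 1)) : f - restrictSection f ∈ linearParamSpan n := by
  obtain ⟨h, hh⟩ := exists_of_mem_span_range (l := n) isHomogeneous_linearParam
    (by
      rw [add_comm]
      exact hf.sub (isHomogeneous_of_mem_meanSpan (restrictSection_mem_meanSpan hf)))
    (sub_restrictSection_mem f)
  rw [← hh]
  exact sum_mem fun j _ => Submodule.subset_span ⟨j, h j, (h j).2, mul_comm _ _⟩

theorem meanSpan_five_le : meanSpan 5 ≤
    linearParamSpan 4 ⊔ (maximalMinors hilbertBurchMatrix).restrictScalars ℂ := by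
  have key : ∀ k, momentMinor (vec (sectionVec (X (ix 1 0)) (X (ix 0 1)))) k ∈
      linearParamSpan 4 ⊔ (maximalMinors hilbertBurchMatrix).restrictScalars ℂ := fun k => by
    have h1 := sub_restrictSection_mem_linearParamSpan (isHomogeneous_momentMinor k)
    have h2 : restrictSection (momentMinor X k) =
        momentMinor (vec (sectionVec (X (ix 1 0)) (X (ix 0 1)))) k := by
      rw [← AlgHom.coe_toRingHom, map_momentMinor]
      simp [restrictSection]
    rw [← h2, ← sub_sub_self (momentMinor X k) (restrictSection (momentMinor X k))]
    exact sub_mem (Submodule.mem_sup_right (momentMinor_mem k)) (Submodule.mem_sup_left h1)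
  obtain ⟨e0, e1, e2, e3, e4, e5⟩ := momentMinor_sectionVec
    (X (ix 1 0) : MvPolynomial (Idx 2 3) ℂ) (X (ix 0 1))
  have hn : ∀ n : ℕ, n ≠ 0 → ∀ {p : MvPolynomial (Idx 2 3) ℂ}, (n : MvPolynomial (Idx 2 3) ℂ) * p ∈
      linearParamSpan 4 ⊔ (maximalMinors hilbertBurchMatrix).restrictScalars ℂ → p ∈
      linearParamSpan 4 ⊔ (maximalMinors hilbertBurchMatrix).restrictScalars ℂ := by
    intro n hn p hp
    have := Submodule.smul_mem _ (n : ℂ)⁻¹ hp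
    rwa [← nsmul_eq_mul, ← Nat.cast_smul_eq_nsmul ℂ, smul_smul, inv_mul_cancel₀ (by exact_mod_cast hn),
      one_smul] at this
  have h5 := hn 4 (by norm_num) (p := X (ix 1 0) ^ 5) (by simpa [e2] using key 2)
  rw [meanSpan, Submodule.span_le]
  rintro _ ⟨a, b, hab, rfl⟩
  have ha : a ≤ 5 := by omega
  obtain rfl : b = 5 - a := by omega
  interval_cases a
  · refine hn 2 (by norm_num) ?_
    have h := key 3
    rw [e3] at h
    have := sub_mem h (Submodule.smul_mem _ (2 : ℂ) h5)
    rw [ofNat_smul_eq_nsmul, nsmul_eq_mul] at this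
    simpa using this
  · exact hn 2 (by norm_num) (by simpa [e4] using key 4)
  · exact hn 4 (by norm_num) (by simpa [e0] using key 0)
  · exact hn 4 (by norm_num) (by simpa [e1] using key 1)
  · exact hn 4 (by norm_num) (by simpa [e5] using key 5)
  · simpa using h5

end MomentMatrix

/-! ### The ring of the minors is free over a polynomial ring -/

section Free

/-- The polynomial ring in the linear forms `linearParam`. -/
noncomputable def paramHom : MvPolynomial (Fin 8) ℂ →ₐ[ℂ] MvPolynomial (Idx 2 3) ℂ :=
  aeval linearParam

theorem isHomogeneous_paramHom {b : MvPolynomial (Fin 8) ℂ} {n : ℕ} (hb : b.IsHomogeneous n) :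
    (paramHom b).IsHomogeneous n :=
  aeval_mem_of_isHomogeneous (V := homogeneousSubmodule (Idx 2 3) ℂ) (isHomogeneous_one _ _)
    (fun hp hq => IsHomogeneous.mul hp hq) isHomogeneous_linearParam hb

theorem homogeneousComponent_paramHom (b : MvPolynomial (Fin 8) ℂ) (n : ℕ) :
    homogeneousComponent n (paramHom b) = paramHom (homogeneousComponent n b) := by
  conv_lhs => rw [← sum_homogeneousComponent b, map_sum, map_sum]
  simp only [fun k => homogeneousComponent_of_isHomogeneous
    (isHomogeneous_paramHom (homogeneousComponent_isHomogeneous k b)) n]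
  rw [Finset.sum_ite_eq]
  split_ifs with h
  · rfl
  · rw [homogeneousComponent_eq_zero _ _ (by simpa using h), map_zero]

/-- The index set of the fifteen monomials of degree at most four in the means. -/
abbrev StdIdx : Type := (k : Fin 5) × Fin (k + 1)

/-- The monomials of degree at most four in the means. -/
noncomputable def stdMonomial (p : StdIdx) : MvPolynomial (Idx 2 3) ℂ :=
  X (ix 1 0) ^ (p.2 : ℕ) * X (ix 0 1) ^ ((p.1 : ℕ) - p.2)

theorem isHomogeneous_stdMonomial (p : StdIdx) : (stdMonomial p).IsHomogeneous p.1 := by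
  have h := ((isHomogeneous_X ℂ (ix 1 0)).pow (p.2 : ℕ)).mul
    ((isHomogeneous_X ℂ (ix 0 1)).pow ((p.1 : ℕ) - p.2))
  rwa [one_mul, one_mul, Nat.add_sub_cancel' (by omega)] at h

/-- The span of the forms of degree `n` that are products of a polynomial in the linear forms
`linearParam` and a monomial of degree at most four in the means. -/
noncomputable def stdSpan (n : ℕ) : Submodule ℂ (MvPolynomial (Idx 2 3) ℂ) :=
  Submodule.span ℂ {f | ∃ (l : ℕ) (b : MvPolynomial (Fin 8) ℂ) (p : StdIdx), p.1 + l = n ∧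
    b.IsHomogeneous l ∧ f = paramHom b * stdMonomial p}

theorem paramHom_X (j : Fin 8) : paramHom (X j) = linearParam j := aeval_X _ _

theorem linearParam_mul_mem_stdSpan (j : Fin 8) {n : ℕ} {f : MvPolynomial (Idx 2 3) ℂ}
    (hf : f ∈ stdSpan n) : linearParam j * f ∈ stdSpan (n + 1) := by
  induction hf using Submodule.span_induction with
  | mem f hf =>
    obtain ⟨l, b, p, hp, hb, rfl⟩ := hf
    refine Submodule.subset_span ⟨l + 1, b * X j, p, by omega, hb.mul (isHomogeneous_X _ _), ?_⟩
    rw [map_mul, paramHom_X, mul_left_comm, mul_assoc]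
  | zero =>
    rw [mul_zero]
    exact zero_mem _
  | add f g _ _ hf hg =>
    rw [mul_add]
    exact add_mem hf hg
  | smul a f _ hf =>
    rw [mul_smul_comm]
    exact Submodule.smul_mem _ _ hf

/-- A graded Nakayama argument: a form equals its restriction to the plane plus products of linear
parameters with forms of lower degree. On the plane, monomials of degree at least 5 reduce further
through `meanSpan_five_le`. -/
theorem homogeneous_le_stdSpan (n : ℕ) : homogeneousSubmodule (Idx 2 3) ℂ n ≤
    stdSpan n ⊔ (maximalMinors hilbertBurchMatrix).restrictScalars ℂ := by
  induction n with
  | zero =>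
    intro f hf
    obtain ⟨c, rfl⟩ : ∃ c, f = C c := ⟨_, totalDegree_eq_zero_iff_eq_C.1
      ((totalDegree_zero_iff_isHomogeneous _).2 hf)⟩
    exact Submodule.mem_sup_left (Submodule.subset_span ⟨0, C c, ⟨0, 0⟩, rfl,
      isHomogeneous_C _ _, by simp [stdMonomial, paramHom]⟩)
  | succ n ih =>
    have hI : ∀ (g : MvPolynomial (Idx 2 3) ℂ) {f}, f ∈ maximalMinors hilbertBurchMatrix →
        g * f ∈ stdSpan (n + 1) ⊔ (maximalMinors hilbertBurchMatrix).restrictScalars ℂ :=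
      fun g f hf => Submodule.mem_sup_right (Ideal.mul_mem_left _ g hf)
    have hlin : ∀ (j : Fin 8) {s : MvPolynomial (Idx 2 3) ℂ}, s.IsHomogeneous n →
        linearParam j * s ∈
          stdSpan (n + 1) ⊔ (maximalMinors hilbertBurchMatrix).restrictScalars ℂ := by
      intro j s hs
      obtain ⟨a, ha, b, hb, rfl⟩ := Submodule.mem_sup.1 (ih hs)
      rw [mul_add]
      exact add_mem (Submodule.mem_sup_left (linearParam_mul_mem_stdSpan j ha)) (hI _ hb)
    have hlin' : linearParamSpan n ≤
        stdSpan (n + 1) ⊔ (maximalMinors hilbertBurchMatrix).restrictScalars ℂ := by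
      rw [linearParamSpan, Submodule.span_le]
      rintro _ ⟨j, s, hs, rfl⟩
      exact hlin j hs
    have hmean : meanSpan (n + 1) ≤
        stdSpan (n + 1) ⊔ (maximalMinors hilbertBurchMatrix).restrictScalars ℂ := by
      rw [meanSpan, Submodule.span_le]
      rintro _ ⟨a, b, hab, rfl⟩
      by_cases hn : n + 1 < 5
      · refine Submodule.mem_sup_left (Submodule.subset_span ⟨0, 1, ⟨⟨n + 1, hn⟩, ⟨a, ?_⟩⟩, rfl,
          isHomogeneous_one _ _, ?_⟩)
        · simp only
          omega
        · rw [map_one, one_mul, stdMonomial]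
          congr 2
          simp only
          omega
      · obtain ⟨a₁, a₂, b₁, b₂, rfl, rfl, h5⟩ : ∃ a₁ a₂ b₁ b₂, a = a₁ + a₂ ∧ b = b₁ + b₂ ∧
            a₂ + b₂ = 5 :=
          ⟨a - min a 5, min a 5, b - (5 - min a 5), 5 - min a 5, by omega, by omega, by omega⟩
        have hq : (X (ix 1 0) ^ a₁ * X (ix 0 1) ^ b₁ : MvPolynomial (Idx 2 3) ℂ).IsHomogeneous
            (a₁ + b₁) := by
          simpa using ((isHomogeneous_X ℂ (ix 1 0)).pow a₁).mul
            ((isHomogeneous_X ℂ (ix 0 1)).pow b₁)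
        have hle : linearParamSpan 4 ⊔ (maximalMinors hilbertBurchMatrix).restrictScalars ℂ ≤
            (stdSpan (n + 1) ⊔ (maximalMinors hilbertBurchMatrix).restrictScalars ℂ).comap
              (LinearMap.mulLeft ℂ (X (ix 1 0) ^ a₁ * X (ix 0 1) ^ b₁)) := by
          refine sup_le ?_ fun f hf => hI _ hf
          rw [linearParamSpan, Submodule.span_le]
          rintro _ ⟨j, s, hs, rfl⟩
          rw [SetLike.mem_coe, Submodule.mem_comap, LinearMap.mulLeft_apply, mul_left_comm]
          refine hlin j ?_
          convert hq.mul hs using 1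
          omega
        have := hle (meanSpan_five_le (Submodule.subset_span ⟨a₂, b₂, h5, rfl⟩))
        rw [Submodule.mem_comap, LinearMap.mulLeft_apply] at this
        rw [SetLike.mem_coe]
        convert this using 1
        ring
    intro f hf
    rw [← sub_add_cancel f (restrictSection f)]
    exact add_mem (hlin' (sub_restrictSection_mem_linearParamSpan hf))
      (hmean (restrictSection_mem_meanSpan hf))

/-- The linear combination of the standard monomials with given coefficients. -/
noncomputable def stdCombination : (StdIdx → MvPolynomial (Fin 8) ℂ) →ₗ[ℂ] MvPolynomial (Idx 2 3) ℂ where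
  toFun b := ∑ p, paramHom (b p) * stdMonomial p
  map_add' b b' := by simp [add_mul, Finset.sum_add_distrib]
  map_smul' a b := by simp [Finset.smul_sum]

theorem stdCombination_apply (b : StdIdx → MvPolynomial (Fin 8) ℂ) :
    stdCombination b = ∑ p, paramHom (b p) * stdMonomial p := rfl

theorem stdCombination_smul (a : MvPolynomial (Fin 8) ℂ) (b : StdIdx → MvPolynomial (Fin 8) ℂ) :
    stdCombination (a • b) = paramHom a * stdCombination b := by
  simp [stdCombination_apply, Finset.mul_sum, mul_assoc]

theorem stdSpan_le_range (n : ℕ) : stdSpan n ≤ LinearMap.range stdCombination := by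
  classical
  rw [stdSpan, Submodule.span_le]
  rintro _ ⟨l, b, p, -, -, rfl⟩
  refine ⟨Pi.single p b, ?_⟩
  rw [stdCombination_apply, Finset.sum_eq_single p]
  · rw [Pi.single_eq_same]
  · intro q _ hq
    rw [Pi.single_eq_of_ne hq, map_zero, zero_mul]
  · simp

theorem exists_stdCombination_sub_mem (f : MvPolynomial (Idx 2 3) ℂ) :
    ∃ b, f - stdCombination b ∈ maximalMinors hilbertBurchMatrix := by
  have h : f ∈ LinearMap.range stdCombination ⊔
      (maximalMinors hilbertBurchMatrix).restrictScalars ℂ := by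
    rw [← sum_homogeneousComponent f]
    exact sum_mem fun n _ => sup_le_sup_right (stdSpan_le_range n) _
      (homogeneous_le_stdSpan n (homogeneousComponent_mem _ _))
  obtain ⟨_, ⟨b, rfl⟩, g, hg, rfl⟩ := Submodule.mem_sup.1 h
  exact ⟨b, by simpa using hg⟩

/-- The combinations of the standard monomials that are forms of degree `n`. -/
noncomputable def gradedCombination (n : ℕ) :
    ((p : StdIdx) → homogeneousSubmodule (Fin 8) ℂ (n - p.1)) →ₗ[ℂ]
      MvPolynomial (Idx 2 3) ℂ ⧸ maximalMinors hilbertBurchMatrix :=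
  (Ideal.Quotient.mkₐ ℂ _).toLinearMap ∘ₗ stdCombination ∘ₗ
    LinearMap.pi fun p => (homogeneousSubmodule (Fin 8) ℂ (n - p.1)).subtype ∘ₗ LinearMap.proj p

theorem gradedCombination_apply (n : ℕ)
    (b : (p : StdIdx) → homogeneousSubmodule (Fin 8) ℂ (n - p.1)) :
    gradedCombination n b = Ideal.Quotient.mk _ (stdCombination fun p => (b p).1) := rfl

theorem map_homogeneousSubmodule_le {n : ℕ} :
    (homogeneousSubmodule (Idx 2 3) ℂ n).map
      (Ideal.Quotient.mkₐ ℂ (maximalMinors hilbertBurchMatrix)).toLinearMap ≤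
      LinearMap.range (gradedCombination n) := by
  classical
  rintro _ ⟨f, hf, rfl⟩
  obtain ⟨g, hg, i, hi, rfl⟩ := Submodule.mem_sup.1 (homogeneous_le_stdSpan n hf)
  clear hf
  have hi' : (Ideal.Quotient.mkₐ ℂ (maximalMinors hilbertBurchMatrix)) i = 0 :=
    Ideal.Quotient.eq_zero_iff_mem.2 hi
  rw [AlgHom.toLinearMap_apply, map_add, hi', add_zero]
  suffices stdSpan n ≤ (LinearMap.range (gradedCombination n)).comap
    (Ideal.Quotient.mkₐ ℂ (maximalMinors hilbertBurchMatrix)).toLinearMap from this hg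
  rw [stdSpan, Submodule.span_le]
  rintro _ ⟨l, b, p, rfl, hb, rfl⟩
  refine ⟨Pi.single p ⟨b, by simpa using hb⟩, ?_⟩
  rw [gradedCombination_apply, AlgHom.toLinearMap_apply]
  refine congrArg (Ideal.Quotient.mk _) ?_
  rw [stdCombination_apply, Finset.sum_eq_single p]
  · rw [Pi.single_eq_same]
  · intro q _ hq
    rw [Pi.single_eq_of_ne hq, Submodule.coe_zero, map_zero, zero_mul]
  · simp

/-! ### Matching Hilbert function bounds and freeness -/

theorem finrank_gradedCombination (n : ℕ) :
    Module.finrank ℂ ((p : StdIdx) → homogeneousSubmodule (Fin 8) ℂ (n - p.1)) =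
      ∑ k : Fin 5, ((k : ℕ) + 1) * (8 + (n - k) - 1).choose (n - k) := by
  rw [Module.finrank_pi_fintype, Fintype.sum_sigma]
  simp [finrank_homogeneousSubmodule]

theorem cast_choose_seven (n : ℕ) : (((8 + n - 1).choose n : ℕ) : ℚ) =
    (n + 1) * (n + 2) * (n + 3) * (n + 4) * (n + 5) * (n + 6) * (n + 7) / 5040 := by
  have h := Nat.ascFactorial_eq_factorial_mul_choose n 7
  rw [← Nat.choose_symm_add] at h
  have h' : (((n + 1).ascFactorial 7 : ℕ) : ℚ) = ((7 ! * (n + 7).choose n : ℕ) : ℚ) := by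
    rw [h]
  rw [show 8 + n - 1 = n + 7 by omega]
  simp only [Nat.ascFactorial, Nat.factorial] at h'
  push_cast at h'
  linear_combination (-1 / 5040) * h'

theorem cast_choose_nine (n : ℕ) : (((10 + n - 1).choose n : ℕ) : ℚ) =
    (n + 1) * (n + 2) * (n + 3) * (n + 4) * (n + 5) * (n + 6) * (n + 7) * (n + 8) * (n + 9) /
      362880 := by
  have h := Nat.ascFactorial_eq_factorial_mul_choose n 9
  rw [← Nat.choose_symm_add] at h
  have h' : (((n + 1).ascFactorial 9 : ℕ) : ℚ) = ((9 ! * (n + 9).choose n : ℕ) : ℚ) := by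
    rw [h]
  rw [show 10 + n - 1 = n + 9 by omega]
  simp only [Nat.ascFactorial, Nat.factorial] at h'
  push_cast at h'
  linear_combination (-1 / 362880) * h'

/-- The coefficient of $t^{l+6}$ in $(1-6t^5+5t^6)/(1-t)^{10}=(1+2t+3t^2+4t^3+5t^4)/(1-t)^8$. -/
theorem choose_add_choose_eq (l : ℕ) : (10 + (l + 6) - 1).choose (l + 6) +
    5 * (10 + l - 1).choose l = 6 * (10 + (l + 1) - 1).choose (l + 1) +
      ∑ k : Fin 5, ((k : ℕ) + 1) * (8 + (l + 6 - k) - 1).choose (l + 6 - k) := by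
  have h : ((((10 + (l + 6) - 1).choose (l + 6) + 5 * (10 + l - 1).choose l : ℕ)) : ℚ) =
      ((6 * (10 + (l + 1) - 1).choose (l + 1) +
        ∑ k : Fin 5, ((k : ℕ) + 1) * (8 + (l + 6 - k) - 1).choose (l + 6 - k) : ℕ) : ℚ) := by
    rw [Fin.sum_univ_five]
    push_cast [cast_choose_seven, cast_choose_nine]
    simp only [Fin.val_zero, Fin.val_one, Fin.val_two, Nat.sub_zero,
      show l + 6 - 1 = l + 5 by omega, show l + 6 - 2 = l + 4 by omega,
      show l + 6 - ((3 : Fin 5) : ℕ) = l + 3 by simp, show l + 6 - ((4 : Fin 5) : ℕ) = l + 2 by simp]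
    push_cast
    simp
    ring
  exact_mod_cast h

theorem card_idx [Fintype (Idx 2 3)] : Fintype.card (Idx 2 3) = 10 := by
  have hinj : Function.Injective (![ix 0 0, ix 1 0, ix 0 1, ix 2 0, ix 1 1, ix 0 2, ix 3 0, ix 2 1,
      ix 1 2, ix 0 3] : Fin 10 → Idx 2 3) := by
    refine Function.Injective.of_comp (f := fun i : Idx 2 3 => (i.1 0, i.1 1)) ?_
    have : (fun i : Idx 2 3 => (i.1 0, i.1 1)) ∘ (![ix 0 0, ix 1 0, ix 0 1, ix 2 0, ix 1 1, ix 0 2,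
        ix 3 0, ix 2 1, ix 1 2, ix 0 3] : Fin 10 → Idx 2 3) =
        ![(0, 0), (1, 0), (0, 1), (2, 0), (1, 1), (0, 2), (3, 0), (2, 1), (1, 2), (0, 3)] := by
      funext k
      fin_cases k <;> rfl
    rw [this]
    decide
  have hsurj : Function.Surjective (![ix 0 0, ix 1 0, ix 0 1, ix 2 0, ix 1 1, ix 0 2, ix 3 0,
      ix 2 1, ix 1 2, ix 0 3] : Fin 10 → Idx 2 3) :=
    forall_idx.2 ⟨⟨0, rfl⟩, ⟨1, rfl⟩, ⟨2, rfl⟩, ⟨3, rfl⟩, ⟨4, rfl⟩, ⟨5, rfl⟩, ⟨6, rfl⟩,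
      ⟨7, rfl⟩, ⟨8, rfl⟩, ⟨9, rfl⟩⟩
  rw [← Fintype.card_congr (Equiv.ofBijective _ ⟨hinj, hsurj⟩), Fintype.card_fin]

/-- The syzygies bound the Hilbert function from below and the standard monomials from above. The
bounds coincide, so the spanning combinations have no linear relation in degrees at least 6. -/
theorem quotientHilbert_hilbertBurch (l : ℕ) :
    quotientHilbert (maximalMinors hilbertBurchMatrix) (l + 6) =
      ∑ k : Fin 5, ((k : ℕ) + 1) * (8 + (l + 6 - k) - 1).choose (l + 6 - k) ∧
    Function.Injective (gradedCombination (l + 6)) := by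
  have := Fintype.ofFinite (Idx 2 3)
  have h1 := quotientHilbert_add (maximalMinors hilbertBurchMatrix) (l + 6)
  have hk : ((hilbertBurchMatrix).submatrix (Fin.succAbove 2) id).det ≠ 0 := by
    intro h
    have h2 : momentMinor X 2 = (0 : MvPolynomial (Idx 2 3) ℂ) := h
    have h3 := map_momentMinor (aeval (R := ℂ) (vec (sectionVec (1 : ℂ) 0))).toRingHom
      (X : Idx 2 3 → MvPolynomial (Idx 2 3) ℂ) 2
    rw [h2, map_zero] at h3
    simp [(momentMinor_sectionVec (1 : ℂ) 0).2.2.1] at h3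
  have h2 := finrank_degreePart_maximalMinors_add_le isHomogeneous_hilbertBurchMatrix hk l
  have h3 := choose_add_choose_eq l
  have h4 := LinearMap.finrank_range_add_finrank_ker (gradedCombination (l + 6))
  have h5 := Submodule.finrank_mono (map_homogeneousSubmodule_le (n := l + 6))
  rw [finrank_gradedCombination] at h4
  rw [show 5 + (l + 1) = l + 6 by omega] at h2
  simp only [finrank_homogeneousSubmodule, card_idx] at h1 h2
  change quotientHilbert (maximalMinors hilbertBurchMatrix) (l + 6) ≤ _ at h5
  refine ⟨by omega, ?_⟩
  rw [← LinearMap.ker_eq_bot, ← Submodule.finrank_eq_zero (R := ℂ)]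
  omega

theorem eq_zero_of_stdCombination_mem {b : StdIdx → MvPolynomial (Fin 8) ℂ}
    (hb : stdCombination b ∈ maximalMinors hilbertBurchMatrix) : b = 0 := by
  -- Injectivity is known only from degree 6 on; multiplication by the sixth power of a parameter
  -- moves every possible relation into that range.
  set b' : StdIdx → MvPolynomial (Fin 8) ℂ := (X 0 ^ 6 : MvPolynomial (Fin 8) ℂ) • b with hb'
  have hmem : stdCombination b' ∈ maximalMinors hilbertBurchMatrix := by
    rw [hb', stdCombination_smul]
    exact Ideal.mul_mem_left _ _ hb
  have hcomp : ∀ n (p : StdIdx), homogeneousComponent (n + 6 - p.1) (b' p) = 0 := fun n p => by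
    have h1 := componentClosed_hilbertBurch _ hmem (n + 6)
    have h2 : homogeneousComponent (n + 6) (stdCombination b') =
        stdCombination fun p => homogeneousComponent (n + 6 - p.1) (b' p) := by
      rw [stdCombination_apply, stdCombination_apply, map_sum]
      refine Finset.sum_congr rfl fun p _ => ?_
      have h3 := homogeneousComponent_mul_left (isHomogeneous_stdMonomial p) (paramHom (b' p))
        (n + 6 - p.1)
      rw [Nat.add_sub_cancel' (by omega), homogeneousComponent_paramHom] at h3
      rw [mul_comm, h3, mul_comm]
    rw [h2] at h1
    have h4 : gradedCombination (n + 6) (fun p => ⟨homogeneousComponent (n + 6 - p.1) (b' p),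
        homogeneousComponent_mem _ _⟩) = 0 := Ideal.Quotient.eq_zero_iff_mem.2 h1
    have h5 := (injective_iff_map_eq_zero _).1 (quotientHilbert_hilbertBurch n).2 _ h4
    exact congrArg Subtype.val (congrFun h5 p)
  funext p
  have hzero : b' p = 0 := by
    rw [← sum_homogeneousComponent (b' p)]
    refine Finset.sum_eq_zero fun k _ => ?_
    by_cases hk : k < 6
    · exact homogeneousComponent_mul_left_of_lt (by simpa using (isHomogeneous_X ℂ (0 : Fin 8)).pow 6)
        (b p) hk
    · have h := hcomp (k + p.1 - 6) p
      rwa [show k + (p.1 : ℕ) - 6 + 6 - p.1 = k by omega] at h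
  exact (mul_eq_zero.1 hzero).resolve_left (pow_ne_zero _ (X_ne_zero _))

/-- The coordinate $m_{00}$ is one of the linear parameters, hence acts injectively on a free module
over their polynomial ring. -/
theorem mem_of_X_mul_mem {f : MvPolynomial (Idx 2 3) ℂ}
    (hf : X (ix 0 0) * f ∈ maximalMinors hilbertBurchMatrix) :
    f ∈ maximalMinors hilbertBurchMatrix := by
  obtain ⟨b, hb⟩ := exists_stdCombination_sub_mem f
  have h1 : stdCombination ((X 0 : MvPolynomial (Fin 8) ℂ) • b) ∈
      maximalMinors hilbertBurchMatrix := by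
    have h2 := sub_mem hf (Ideal.mul_mem_left _ (X (ix 0 0)) hb)
    rw [stdCombination_smul, paramHom_X]
    rwa [← mul_sub, sub_sub_cancel] at h2
  have h3 : b = 0 := (smul_eq_zero.1 (eq_zero_of_stdCombination_mem h1)).resolve_left (X_ne_zero _)
  rwa [h3, map_zero, sub_zero] at hb

theorem isCohenMacaulay_hilbertBurch :
    IsCohenMacaulay (MvPolynomial (Idx 2 3) ℂ ⧸ maximalMinors hilbertBurchMatrix) := by
  let _ : Algebra (MvPolynomial (Fin 8) ℂ)
      (MvPolynomial (Idx 2 3) ℂ ⧸ maximalMinors hilbertBurchMatrix) :=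
    ((Ideal.Quotient.mk _).comp paramHom.toRingHom).toAlgebra
  let L : (StdIdx → MvPolynomial (Fin 8) ℂ) →ₗ[MvPolynomial (Fin 8) ℂ]
      MvPolynomial (Idx 2 3) ℂ ⧸ maximalMinors hilbertBurchMatrix :=
    { toFun := fun b => Ideal.Quotient.mk _ (stdCombination b)
      map_add' := fun b b' => by rw [map_add, map_add]
      map_smul' := fun a b => by
        rw [stdCombination_smul, map_mul]
        rfl }
  have hL : Function.Bijective L := by
    constructor
    · rw [injective_iff_map_eq_zero]
      exact fun b hb => eq_zero_of_stdCombination_mem (Ideal.Quotient.eq_zero_iff_mem.1 hb)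
    · intro q
      obtain ⟨f, rfl⟩ := Ideal.Quotient.mk_surjective q
      obtain ⟨b, hb⟩ := exists_stdCombination_sub_mem f
      exact ⟨b, (Ideal.Quotient.eq.2 hb).symm⟩
  have := Module.Free.of_equiv (LinearEquiv.ofBijective L hL)
  have := Module.Finite.equiv (LinearEquiv.ofBijective L hL)
  exact isCohenMacaulay_of_free 8 _

/-- The Hilbert polynomial of the ideal of minors. -/
noncomputable def hilbertBurchPolynomial : Polynomial ℚ :=
  ∑ k : Fin 5, Polynomial.C (((k : ℚ) + 1) / 5040) *
    ∏ i : Fin 7, (Polynomial.X + Polynomial.C ((i : ℚ) + 1 - k))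

theorem quotientHilbert_hilbertBurch_eq_eval (l : ℕ) :
    (quotientHilbert (maximalMinors hilbertBurchMatrix) (l + 6) : ℚ) =
      hilbertBurchPolynomial.eval ((l + 6 : ℕ) : ℚ) := by
  rw [(quotientHilbert_hilbertBurch l).1, hilbertBurchPolynomial, Polynomial.eval_finsetSum,
    Nat.cast_sum]
  refine Finset.sum_congr rfl fun k _ => ?_
  rw [Polynomial.eval_mul, Polynomial.eval_prod, Nat.cast_mul, cast_choose_seven,
    Nat.cast_sub (by omega), Fin.prod_univ_seven]
  simp
  ring

theorem hilbertBurchPolynomial_degree :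
    hilbertBurchPolynomial.natDegree = 7 ∧ hilbertBurchPolynomial.leadingCoeff = 15 / 5040 := by
  have hdeg : ∀ k : Fin 5, (∏ i : Fin 7, (Polynomial.X + Polynomial.C ((i : ℚ) + 1 - k))).natDegree
      = 7 := fun k => by
    rw [Polynomial.natDegree_prod_of_monic _ _ fun i _ => Polynomial.monic_X_add_C _]
    simp only [Polynomial.natDegree_X_add_C]
    simp
  have hcoeff : hilbertBurchPolynomial.coeff 7 = 15 / 5040 := by
    rw [hilbertBurchPolynomial, Polynomial.finsetSum_coeff]
    have : ∀ k : Fin 5,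
        (∏ i : Fin 7, (Polynomial.X + Polynomial.C ((i : ℚ) + 1 - k))).coeff 7 = 1 := fun k => by
      have h := (Polynomial.monic_prod_of_monic Finset.univ _ fun (i : Fin 7) _ =>
        Polynomial.monic_X_add_C ((i : ℚ) + 1 - k)).coeff_natDegree
      rwa [hdeg] at h
    simp only [Polynomial.coeff_C_mul, this, Fin.sum_univ_five]
    norm_num
  have hle : hilbertBurchPolynomial.natDegree ≤ 7 := by
    refine Polynomial.natDegree_sum_le_of_forall_le _ _ fun k _ => ?_
    exact (Polynomial.natDegree_C_mul_le _ _).trans (hdeg k).le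
  have hnat : hilbertBurchPolynomial.natDegree = 7 :=
    Polynomial.natDegree_eq_of_le_of_coeff_ne_zero hle (by rw [hcoeff]; norm_num)
  exact ⟨hnat, by rw [Polynomial.leadingCoeff, hnat, hcoeff]⟩

end Free

/-! ### The ideal of the variety of mixtures with equal variances -/

section EqualVariances

theorem momentMinor_eq_zero {R : Type*} [CommRing R] [IsDomain R] (w x y a b c e u v : R)
    (hv : v ≠ 0) (k : Fin 6) :
    momentMinor (w • vec (cumulantMoment x y a b c (e * u ^ 3) (e * (u ^ 2 * v)) (e * (u * v ^ 2))
      (e * v ^ 3))) k = 0 := by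
  by_contra hk
  -- The last two entries combine the last two columns so that the third cumulants, proportional to
  -- $u^3,u^2v,uv^2,v^3$, cancel; the first three entries cancel the lower-order terms. A nonzero
  -- minor would force `z = 0`, contrary to `v ≠ 0`.
  let z : Fin 5 → R := ![-(2 * (v * b - u * c)), -(2 * (v * a - u * b)), -(v * x - u * y), v, -u]
  have hz : (momentMatrix (w • vec (cumulantMoment x y a b c (e * u ^ 3) (e * (u ^ 2 * v))
      (e * (u * v ^ 2)) (e * v ^ 3)))).mulVec z = 0 := by
    funext i
    fin_cases i <;>
      simp [momentMatrix, Matrix.mulVec, dotProduct, Fin.sum_univ_five, z, cumulantMoment] <;> ring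
  have h := Matrix.eq_zero_of_mulVec_eq_zero (v := z) hk (by
    funext i
    exact congrFun hz (k.succAbove i))
  exact hv (congrFun h 3)

theorem maximalMinors_le_ker :
    maximalMinors hilbertBurchMatrix ≤ RingHom.ker (aeval (R := ℂ) equalVariancesParam) := by
  rw [maximalMinors_hilbertBurchMatrix, Ideal.span_le]
  rintro _ ⟨k, rfl⟩
  have h := momentMinor_eq_zero (X 0 : MvPolynomial (Fin 8) ℂ) (X 1) (X 2) (X 3) (X 4) (X 5) 2 (X 6)
    (X 7) (X_ne_zero _) k
  rw [SetLike.mem_coe, RingHom.mem_ker, ← AlgHom.coe_toRingHom, map_momentMinor]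
  have hX : (fun i => ((aeval (R := ℂ) equalVariancesParam : MvPolynomial (Idx 2 3) ℂ →ₐ[ℂ] _) :
      MvPolynomial (Idx 2 3) ℂ →+* MvPolynomial (Fin 8) ℂ) (X i)) = equalVariancesParam :=
    funext fun i => aeval_X _ i
  rw [hX]
  exact h

/-! ### Reduction to the cone over the twisted cubic -/

/-- The third cumulants, with denominators cleared, and the moments of lower order. -/
noncomputable def clearedCumulant {R : Type*} [CommRing R] (f : Idx 2 3 → R) : ℕ → ℕ → R
  | 0, 0 => f (ix 0 0)
  | 1, 0 => f (ix 1 0)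
  | 0, 1 => f (ix 0 1)
  | 2, 0 => f (ix 2 0)
  | 1, 1 => f (ix 1 1)
  | 0, 2 => f (ix 0 2)
  | 3, 0 => f (ix 0 0) ^ 2 * f (ix 3 0) - 3 * f (ix 0 0) * f (ix 1 0) * f (ix 2 0) +
      2 * f (ix 1 0) ^ 3
  | 2, 1 => f (ix 0 0) ^ 2 * f (ix 2 1) - 2 * f (ix 0 0) * f (ix 1 0) * f (ix 1 1) -
      f (ix 0 0) * f (ix 0 1) * f (ix 2 0) + 2 * f (ix 1 0) ^ 2 * f (ix 0 1)
  | 1, 2 => f (ix 0 0) ^ 2 * f (ix 1 2) - 2 * f (ix 0 0) * f (ix 0 1) * f (ix 1 1) -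
      f (ix 0 0) * f (ix 1 0) * f (ix 0 2) + 2 * f (ix 1 0) * f (ix 0 1) ^ 2
  | 0, 3 => f (ix 0 0) ^ 2 * f (ix 0 3) - 3 * f (ix 0 0) * f (ix 0 1) * f (ix 0 2) +
      2 * f (ix 0 1) ^ 3
  | _, _ => 0

/-- These identities place the twisted cubic quadrics, evaluated at the cleared cumulants, inside
the ideal of minors. -/
theorem clearedCumulant_relations {R : Type*} [CommRing R] (f : Idx 2 3 → R) :
    2 * (clearedCumulant f 3 0 * clearedCumulant f 1 2 - clearedCumulant f 2 1 ^ 2) =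
      -(f (ix 0 0) * momentMinor f 2) ∧
    clearedCumulant f 3 0 * clearedCumulant f 0 3 - clearedCumulant f 2 1 * clearedCumulant f 1 2 =
      -(f (ix 0 0) * momentMinor f 5) ∧
    2 * (clearedCumulant f 2 1 * clearedCumulant f 0 3 - clearedCumulant f 1 2 ^ 2) =
      f (ix 0 0) * momentMinor f 1 := by
  simp [momentMinor, momentMatrix, Matrix.det_succ_row_zero, Fin.sum_univ_succ, Fin.succAbove,
    clearedCumulant]
  refine ⟨?_, ?_, ?_⟩ <;> ring

/-- The substitution of the cleared cumulants. -/
noncomputable def clearHom : MvPolynomial (Idx 2 3) ℂ →ₐ[ℂ] MvPolynomial (Idx 2 3) ℂ :=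
  aeval (vec (clearedCumulant X))

/-- The substitution is triangular: it fixes the moments of order at most 2 and sends a third moment
to $m_{00}^2$ times itself plus terms of lower order. It is thus invertible after inverting
$m_{00}$. -/
theorem exists_pow_mul_eq_clearHom (f : MvPolynomial (Idx 2 3) ℂ) :
    ∃ N g, X (ix 0 0) ^ N * f = clearHom g := by
  have h0 : clearHom (X (ix 0 0)) = X (ix 0 0) := by simp [clearHom, clearedCumulant]
  induction f using MvPolynomial.induction_on with
  | C a => exact ⟨0, C a, by simp [clearHom]⟩
  | add p q hp hq =>
    obtain ⟨N, g, hg⟩ := hp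
    obtain ⟨N', g', hg'⟩ := hq
    refine ⟨N + N', X (ix 0 0) ^ N' * g + X (ix 0 0) ^ N * g', ?_⟩
    rw [map_add, map_mul, map_mul, map_pow, map_pow, h0, ← hg, ← hg']
    ring
  | mul_X p i hp =>
    obtain ⟨N, g, hg⟩ := hp
    suffices ∃ M h, X (ix 0 0) ^ M * X i = clearHom h by
      obtain ⟨M, h, hM⟩ := this
      refine ⟨N + M, g * h, ?_⟩
      rw [map_mul, ← hg, ← hM]
      ring
    have h1 : clearHom (X (ix 1 0)) = X (ix 1 0) := by simp [clearHom, clearedCumulant]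
    have h2 : clearHom (X (ix 0 1)) = X (ix 0 1) := by simp [clearHom, clearedCumulant]
    have h3 : clearHom (X (ix 2 0)) = X (ix 2 0) := by simp [clearHom, clearedCumulant]
    have h4 : clearHom (X (ix 1 1)) = X (ix 1 1) := by simp [clearHom, clearedCumulant]
    have h5 : clearHom (X (ix 0 2)) = X (ix 0 2) := by simp [clearHom, clearedCumulant]
    have h6 : clearHom (X (ix 3 0)) = clearedCumulant X 3 0 := by simp [clearHom]
    have h7 : clearHom (X (ix 2 1)) = clearedCumulant X 2 1 := by simp [clearHom]
    have h8 : clearHom (X (ix 1 2)) = clearedCumulant X 1 2 := by simp [clearHom]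
    have h9 : clearHom (X (ix 0 3)) = clearedCumulant X 0 3 := by simp [clearHom]
    revert i
    rw [forall_idx]
    refine ⟨⟨0, _, by rw [h0]; simp⟩, ⟨0, _, by rw [h1]; simp⟩, ⟨0, _, by rw [h2]; simp⟩,
      ⟨0, _, by rw [h3]; simp⟩, ⟨0, _, by rw [h4]; simp⟩, ⟨0, _, by rw [h5]; simp⟩,
      ⟨2, X (ix 3 0) + 3 * X (ix 0 0) * X (ix 1 0) * X (ix 2 0) - 2 * X (ix 1 0) ^ 3, ?_⟩,
      ⟨2, X (ix 2 1) + 2 * X (ix 0 0) * X (ix 1 0) * X (ix 1 1) +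
        X (ix 0 0) * X (ix 0 1) * X (ix 2 0) - 2 * X (ix 1 0) ^ 2 * X (ix 0 1), ?_⟩,
      ⟨2, X (ix 1 2) + 2 * X (ix 0 0) * X (ix 0 1) * X (ix 1 1) +
        X (ix 0 0) * X (ix 1 0) * X (ix 0 2) - 2 * X (ix 1 0) * X (ix 0 1) ^ 2, ?_⟩,
      ⟨2, X (ix 0 3) + 3 * X (ix 0 0) * X (ix 0 1) * X (ix 0 2) - 2 * X (ix 0 1) ^ 3, ?_⟩⟩ <;>
    · simp only [map_add, map_sub, map_mul, map_pow, map_ofNat, h0, h1, h2, h3, h4, h5, h6, h7, h8,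
        h9, clearedCumulant]
      ring

/-- The parametrization of the product of an affine space with the cone over the twisted cubic. -/
noncomputable def twistedCubic {R : Type*} [CommRing R] (t : Fin 8 → R) : ℕ → ℕ → R
  | 0, 0 => t 0
  | 1, 0 => t 1
  | 0, 1 => t 2
  | 2, 0 => t 3
  | 1, 1 => t 4
  | 0, 2 => t 5
  | 3, 0 => t 6 ^ 3
  | 2, 1 => t 6 ^ 2 * t 7
  | 1, 2 => t 6 * t 7 ^ 2
  | 0, 3 => t 7 ^ 3
  | _, _ => 0

/-- The substitution of `twistedCubic`. -/
noncomputable def twistedHom : MvPolynomial (Idx 2 3) ℂ →ₐ[ℂ] MvPolynomial (Fin 8) ℂ :=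
  aeval (vec (twistedCubic X))

theorem clearedCumulant_param {K : Type*} [Field K] (w x y a b c k₀ k₁ k₂ k₃ : K) :
    clearedCumulant (w • vec (cumulantMoment x y a b c k₀ k₁ k₂ k₃)) 3 0 = w ^ 3 * k₀ ∧
    clearedCumulant (w • vec (cumulantMoment x y a b c k₀ k₁ k₂ k₃)) 2 1 = w ^ 3 * k₁ ∧
    clearedCumulant (w • vec (cumulantMoment x y a b c k₀ k₁ k₂ k₃)) 1 2 = w ^ 3 * k₂ ∧
    clearedCumulant (w • vec (cumulantMoment x y a b c k₀ k₁ k₂ k₃)) 0 3 = w ^ 3 * k₃ := by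
  simp only [clearedCumulant, Pi.smul_apply, vec_ix, cumulantMoment, smul_eq_mul]
  refine ⟨?_, ?_, ?_, ?_⟩ <;> ring

theorem eval_clearedCumulant (v : Idx 2 3 → ℂ) :
    (fun i => eval v (vec (clearedCumulant X) i)) = vec (clearedCumulant v) := by
  funext i
  revert i
  rw [forall_idx]
  simp [clearedCumulant]

theorem eval_twistedCubic (t : Fin 8 → ℂ) :
    (fun i => eval t (vec (twistedCubic X) i)) = vec (twistedCubic t) := by
  funext i
  revert i
  rw [forall_idx]
  simp [twistedCubic]

theorem twistedHom_eq_zero {f g : MvPolynomial (Idx 2 3) ℂ} {N : ℕ}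
    (hf : f ∈ RingHom.ker (aeval (R := ℂ) equalVariancesParam))
    (h : X (ix 0 0) ^ N * f = clearHom g) : twistedHom g = 0 := by
  refine funext_set (fun _ => {0}ᶜ) (fun _ => (Set.finite_singleton _).infinite_compl)
    fun t ht => ?_
  have h0 : t 0 ≠ 0 := ht 0 trivial
  -- Clearing multiplies the third cumulants by $t_0^3$, and the parametrization carries a factor 2;
  -- dividing $t_6,t_7$ by a cube root of $2t_0^3$ compensates for both.
  obtain ⟨r, hr⟩ := IsAlgClosed.exists_pow_nat_eq (2 * t 0 ^ 3) (n := 3) (by norm_num)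
  have hr0 : r ≠ 0 := by
    rintro rfl
    have : (2 * t 0 ^ 3 : ℂ) ≠ 0 := mul_ne_zero two_ne_zero (pow_ne_zero _ h0)
    exact this (by rw [← hr]; norm_num)
  let s : Fin 8 → ℂ := ![t 0, t 1 / t 0, t 2 / t 0, t 3 / t 0 - (t 1 / t 0) ^ 2,
    t 4 / t 0 - t 1 / t 0 * (t 2 / t 0), t 5 / t 0 - (t 2 / t 0) ^ 2, t 6 / r, t 7 / r]
  have hs : vec (clearedCumulant fun i => eval s (equalVariancesParam i)) = vec (twistedCubic t) := by
    rw [eval_equalVariancesParam]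
    funext i
    revert i
    rw [forall_idx]
    simp only [vec_ix, clearedCumulant_param, twistedCubic]
    simp only [clearedCumulant, Pi.smul_apply, vec_ix, cumulantMoment, smul_eq_mul, s,
      Matrix.cons_val]
    refine ⟨?_, ?_, ?_, ?_, ?_, ?_, ?_, ?_, ?_, ?_⟩
    · ring
    · field_simp
    · field_simp
    · field_simp; ring
    · field_simp; ring
    · field_simp; ring
    all_goals field_simp; rw [hr]; ring
  have h1 := congrArg (fun p => eval s (aeval equalVariancesParam p)) h
  simp only [map_mul, RingHom.mem_ker.1 hf, mul_zero, map_zero] at h1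
  rw [map_zero, twistedHom, eval_aeval, eval_twistedCubic, ← hs, ← eval_clearedCumulant,
    ← eval_aeval, ← eval_aeval]
  exact h1.symm

/-- The ideal of the cone over the twisted cubic. -/
noncomputable def twistedIdeal : Ideal (MvPolynomial (Idx 2 3) ℂ) :=
  Ideal.span {X (ix 3 0) * X (ix 1 2) - X (ix 2 1) ^ 2,
    X (ix 3 0) * X (ix 0 3) - X (ix 2 1) * X (ix 1 2),
    X (ix 2 1) * X (ix 0 3) - X (ix 1 2) ^ 2}

theorem clearHom_mem {g : MvPolynomial (Idx 2 3) ℂ} (hg : g ∈ twistedIdeal) :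
    clearHom g ∈ maximalMinors hilbertBurchMatrix := by
  suffices twistedIdeal ≤ (maximalMinors hilbertBurchMatrix).comap clearHom.toRingHom from this hg
  have hX : ∀ a b h, clearHom (X (ix a b h)) = clearedCumulant X a b := by simp [clearHom]
  have hhalf : ∀ {p : MvPolynomial (Idx 2 3) ℂ}, 2 * p ∈ maximalMinors hilbertBurchMatrix →
      p ∈ maximalMinors hilbertBurchMatrix := fun {p} hp => by
    have h2 : C (1 / 2) * (2 * p) = p := by
      rw [← mul_assoc, ← map_ofNat C 2, ← C_mul]
      norm_num
    rw [← h2]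
    exact Ideal.mul_mem_left _ _ hp
  obtain ⟨h1, h2, h3⟩ := clearedCumulant_relations (X : Idx 2 3 → MvPolynomial (Idx 2 3) ℂ)
  rw [twistedIdeal, Ideal.span_le]
  rintro _ (rfl | rfl | rfl)
  · refine hhalf ?_
    have : 2 * clearHom.toRingHom (X (ix 3 0) * X (ix 1 2) - X (ix 2 1) ^ 2) =
        -(X (ix 0 0) * momentMinor X 2) := by
      rw [← h1]
      simp [hX]
    rw [this]
    exact neg_mem (Ideal.mul_mem_left _ _ (momentMinor_mem _))
  · have : clearHom.toRingHom (X (ix 3 0) * X (ix 0 3) - X (ix 2 1) * X (ix 1 2)) =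
        -(X (ix 0 0) * momentMinor X 5) := by
      rw [← h2]
      simp [hX]
    rw [SetLike.mem_coe, Ideal.mem_comap, this]
    exact neg_mem (Ideal.mul_mem_left _ _ (momentMinor_mem _))
  · refine hhalf ?_
    have : 2 * clearHom.toRingHom (X (ix 2 1) * X (ix 0 3) - X (ix 1 2) ^ 2) =
        X (ix 0 0) * momentMinor X 1 := by
      rw [← h3]
      simp [hX]
    rw [this]
    exact Ideal.mul_mem_left _ _ (momentMinor_mem _)

/-- The factor of a normal form that is linear in `m_{21}`, `m_{12}`. -/
noncomputable def normalFactor : ℕ → MvPolynomial (Idx 2 3) ℂ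
  | 0 => 1
  | 1 => X (ix 1 2)
  | _ => X (ix 2 1)

/-- A monomial that `twistedHom` maps to the monomial with exponent `e`. -/
noncomputable def normalForm (e : Fin 8 →₀ ℕ) : MvPolynomial (Idx 2 3) ℂ :=
  X (ix 0 0) ^ e 0 * X (ix 1 0) ^ e 1 * X (ix 0 1) ^ e 2 * X (ix 2 0) ^ e 3 * X (ix 1 1) ^ e 4 *
    X (ix 0 2) ^ e 5 * (X (ix 3 0) ^ (e 6 / 3) * X (ix 0 3) ^ (e 7 / 3) * normalFactor (e 6 % 3))

/-- The exponent of the image of a variable under `twistedHom`. -/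
noncomputable def twistedExponent : ℕ → ℕ → (Fin 8 →₀ ℕ)
  | 0, 0 => Finsupp.single 0 1
  | 1, 0 => Finsupp.single 1 1
  | 0, 1 => Finsupp.single 2 1
  | 2, 0 => Finsupp.single 3 1
  | 1, 1 => Finsupp.single 4 1
  | 0, 2 => Finsupp.single 5 1
  | 3, 0 => Finsupp.single 6 3
  | 2, 1 => Finsupp.single 6 2 + Finsupp.single 7 1
  | 1, 2 => Finsupp.single 6 1 + Finsupp.single 7 2
  | 0, 3 => Finsupp.single 7 3
  | _, _ => 0

theorem twistedHom_X (i : Idx 2 3) : twistedHom (X i) = monomial (vec twistedExponent i) 1 := by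
  rw [twistedHom, aeval_X]
  revert i
  rw [forall_idx]
  simp only [vec_ix, twistedCubic, twistedExponent, X, monomial_pow, monomial_mul, one_pow, mul_one,
    Finsupp.smul_single, smul_eq_mul, and_self]

theorem three_dvd_twistedExponent (i : Idx 2 3) :
    3 ∣ vec twistedExponent i 6 + vec twistedExponent i 7 := by
  revert i
  rw [forall_idx]
  simp [twistedExponent]

/-- Only $m_{21}$ and $m_{12}$ change the residues modulo 3 of the last two exponents. Since their
sum is divisible by 3, there are three residue pairs, and each product is either normal already or
corrected by one of the quadrics. -/
theorem X_mul_normalForm_sub_mem (i : Idx 2 3) {e : Fin 8 →₀ ℕ} (he : 3 ∣ e 6 + e 7) :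
    X i * normalForm e - normalForm (e + vec twistedExponent i) ∈ twistedIdeal := by
  have h1 : X (ix 3 0) * X (ix 1 2) - X (ix 2 1) ^ 2 ∈ twistedIdeal :=
    Ideal.subset_span (by simp)
  have h2 : X (ix 3 0) * X (ix 0 3) - X (ix 2 1) * X (ix 1 2) ∈ twistedIdeal :=
    Ideal.subset_span (by simp)
  have h3 : X (ix 2 1) * X (ix 0 3) - X (ix 1 2) ^ 2 ∈ twistedIdeal :=
    Ideal.subset_span (by simp)
  have hz : ∀ {p : MvPolynomial (Idx 2 3) ℂ}, p = 0 → p ∈ twistedIdeal := by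
    rintro p rfl
    exact zero_mem _
  have hm : ∀ {p q : MvPolynomial (Idx 2 3) ℂ} (s), q ∈ twistedIdeal → p = s * q →
      p ∈ twistedIdeal := by
    rintro _ q s hq rfl
    exact Ideal.mul_mem_left _ s hq
  have n0 : normalFactor 0 = 1 := rfl
  have n1 : normalFactor 1 = X (ix 1 2) := rfl
  have n2 : normalFactor 2 = X (ix 2 1) := rfl
  obtain ⟨a, r, ha, hr⟩ : ∃ a r, e 6 = 3 * a + r ∧ r < 3 :=
    ⟨e 6 / 3, e 6 % 3, by omega, by omega⟩
  obtain ⟨b, r', hb, hr'⟩ : ∃ b r', e 7 = 3 * b + r' ∧ r' < 3 :=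
    ⟨e 7 / 3, e 7 % 3, by omega, by omega⟩
  have hrr : (r = 0 ∧ r' = 0) ∨ (r = 1 ∧ r' = 2) ∨ (r = 2 ∧ r' = 1) := by omega
  revert i
  rw [forall_idx]
  simp only [vec_ix, twistedExponent, normalForm, Finsupp.add_apply, Finsupp.single_apply, ha, hb]
  simp only [Fin.reduceEq, if_true, if_false, add_zero, zero_add]
  rw [show (3 * a + r) / 3 = a by omega, show (3 * b + r') / 3 = b by omega,
    show (3 * a + r) % 3 = r by omega, show (3 * a + r + 3) / 3 = a + 1 by omega,
    show (3 * a + r + 3) % 3 = r by omega, show (3 * b + r' + 3) / 3 = b + 1 by omega]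
  refine ⟨hz (by ring), hz (by ring), hz (by ring), hz (by ring), hz (by ring), hz (by ring),
    hz (by ring), ?_, ?_, hz (by ring)⟩
  · clear ha hb
    generalize (X (ix 0 0) ^ e 0 : MvPolynomial (Idx 2 3) ℂ) * X (ix 1 0) ^ e 1 * X (ix 0 1) ^ e 2 * X (ix 2 0) ^ e 3 *
      X (ix 1 1) ^ e 4 * X (ix 0 2) ^ e 5 = P
    rcases hrr with ⟨rfl, rfl⟩ | ⟨rfl, rfl⟩ | ⟨rfl, rfl⟩
    · rw [show (3 * a + 0 + 2) / 3 = a by omega, show (3 * a + 0 + 2) % 3 = 2 by omega,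
        show (3 * b + 0 + 1) / 3 = b by omega, n0, n2]
      exact hz (by ring)
    · rw [show (3 * a + 1 + 2) / 3 = a + 1 by omega, show (3 * a + 1 + 2) % 3 = 0 by omega,
        show (3 * b + 2 + 1) / 3 = b + 1 by omega, n0, n1]
      exact hm (-(P * (X (ix 3 0) ^ a * X (ix 0 3) ^ b))) h2 (by ring)
    · rw [show (3 * a + 2 + 2) / 3 = a + 1 by omega, show (3 * a + 2 + 2) % 3 = 1 by omega,
        show (3 * b + 1 + 1) / 3 = b by omega, n1, n2]
      exact hm (-(P * (X (ix 3 0) ^ a * X (ix 0 3) ^ b))) h1 (by ring)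
  · clear ha hb
    generalize (X (ix 0 0) ^ e 0 : MvPolynomial (Idx 2 3) ℂ) * X (ix 1 0) ^ e 1 * X (ix 0 1) ^ e 2 * X (ix 2 0) ^ e 3 *
      X (ix 1 1) ^ e 4 * X (ix 0 2) ^ e 5 = P
    rcases hrr with ⟨rfl, rfl⟩ | ⟨rfl, rfl⟩ | ⟨rfl, rfl⟩
    · rw [show (3 * a + 0 + 1) / 3 = a by omega, show (3 * a + 0 + 1) % 3 = 1 by omega,
        show (3 * b + 0 + 2) / 3 = b by omega, n0, n1]
      exact hz (by ring)
    · rw [show (3 * a + 1 + 1) / 3 = a by omega, show (3 * a + 1 + 1) % 3 = 2 by omega,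
        show (3 * b + 2 + 2) / 3 = b + 1 by omega, n1, n2]
      exact hm (-(P * (X (ix 3 0) ^ a * X (ix 0 3) ^ b))) h3 (by ring)
    · rw [show (3 * a + 2 + 1) / 3 = a + 1 by omega, show (3 * a + 2 + 1) % 3 = 0 by omega,
        show (3 * b + 1 + 2) / 3 = b + 1 by omega, n0, n2]
      exact hm (-(P * (X (ix 3 0) ^ a * X (ix 0 3) ^ b))) h2 (by ring)

/-- Modulo the quadrics, a monomial depends only on its image under `twistedHom`. The linear map
sending each exponent to its normal form therefore recovers `g` from `twistedHom g` modulo the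
ideal. -/
theorem mem_twistedIdeal {g : MvPolynomial (Idx 2 3) ℂ} (hg : twistedHom g = 0) :
    g ∈ twistedIdeal := by
  let L : MvPolynomial (Fin 8) ℂ →ₗ[ℂ] MvPolynomial (Idx 2 3) ℂ :=
    (basisMonomials (Fin 8) ℂ).constr ℂ normalForm
  have hL : ∀ e, L (monomial e 1) = normalForm e := fun e => by
    have := (basisMonomials (Fin 8) ℂ).constr_basis ℂ normalForm e
    rwa [coe_basisMonomials] at this
  have hmon : ∀ d : Idx 2 3 →₀ ℕ, ∃ e, twistedHom (monomial d 1) = monomial e 1 ∧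
      3 ∣ e 6 + e 7 ∧ monomial d 1 - normalForm e ∈ twistedIdeal := by
    intro d
    have hadd : ∀ (i : Idx 2 3) (d : Idx 2 3 →₀ ℕ), (∃ e, twistedHom (monomial d 1) = monomial e 1 ∧
        3 ∣ e 6 + e 7 ∧ monomial d 1 - normalForm e ∈ twistedIdeal) →
        ∃ e, twistedHom (monomial (Finsupp.single i 1 + d) 1) = monomial e 1 ∧
          3 ∣ e 6 + e 7 ∧
          monomial (Finsupp.single i 1 + d) 1 - normalForm e ∈ twistedIdeal := by
      rintro i d ⟨e, he, h3, hd⟩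
      have hX : (monomial (Finsupp.single i 1 + d) 1 : MvPolynomial (Idx 2 3) ℂ) =
          X i * monomial d 1 := by
        rw [X, monomial_mul, one_mul]
      refine ⟨e + vec twistedExponent i, ?_, ?_, ?_⟩
      · rw [hX, map_mul, he, twistedHom_X, monomial_mul, one_mul, add_comm]
      · rw [Finsupp.add_apply, Finsupp.add_apply, add_add_add_comm]
        exact dvd_add h3 (three_dvd_twistedExponent i)
      · have := add_mem (Ideal.mul_mem_left _ (X i) hd) (X_mul_normalForm_sub_mem i h3)
        rwa [mul_sub, sub_add_sub_cancel, ← hX] at this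
    induction d using Finsupp.induction with
    | zero => exact ⟨0, by simp [← C_apply], by simp, by simp [normalForm, normalFactor, ← C_apply]⟩
    | single_add i k d _ _ ih =>
      clear * - ih hadd
      induction k with
      | zero => simpa using ih
      | succ k hk =>
        have := hadd i _ hk
        rwa [← add_assoc, ← Finsupp.single_add, add_comm 1 k] at this
  have hsub : g - L (twistedHom g) ∈ twistedIdeal := by
    rw [g.as_sum, map_sum, map_sum, ← Finset.sum_sub_distrib]
    refine sum_mem fun d _ => ?_
    obtain ⟨e, he, -, hd⟩ := hmon d
    have : (monomial d (coeff d g) : MvPolynomial (Idx 2 3) ℂ) = coeff d g • monomial d 1 := by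
      rw [smul_monomial, smul_eq_mul, mul_one]
    rw [this, map_smul, map_smul, he, hL, ← smul_sub]
    exact Submodule.smul_of_tower_mem _ _ hd
  rwa [hg, map_zero, sub_zero] at hsub

/-- For `f` in the kernel, some $m_{00}^Nf$ is a polynomial in the cleared cumulants that lies in
the image of the twisted cubic ideal, hence in the ideal of minors. The powers of $m_{00}$ are then
cancelled one at a time. -/
theorem homogeneousIdeal_equalVariances_eq :
    homogeneousIdeal (equalVariances 2 3) = maximalMinors hilbertBurchMatrix := by
  rw [homogeneousIdeal_equalVariances]
  refine le_antisymm (fun f hf => ?_) maximalMinors_le_ker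
  obtain ⟨N, g, hg⟩ := exists_pow_mul_eq_clearHom f
  have hmem : X (ix 0 0) ^ N * f ∈ maximalMinors hilbertBurchMatrix := by
    rw [hg]
    exact clearHom_mem (mem_twistedIdeal (twistedHom_eq_zero hf hg))
  clear hg
  induction N with
  | zero => simpa using hmem
  | succ N ih =>
    refine ih (mem_of_X_mul_mem ?_)
    rwa [← mul_assoc, ← pow_succ']

theorem hasDegree_equalVariances : HasDegree (equalVariances 2 3) 15 := by
  refine ⟨hilbertBurchPolynomial, Filter.eventually_atTop.2 ⟨6, fun n hn => ?_⟩, ?_⟩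
  · obtain ⟨l, rfl⟩ := Nat.exists_eq_add_of_le' hn
    rw [hilbertFunction_eq, homogeneousIdeal_equalVariances_eq, quotientHilbert_hilbertBurch_eq_eval]
  · rw [hilbertBurchPolynomial_degree.1, hilbertBurchPolynomial_degree.2]
    norm_num [Nat.factorial]

theorem isCohenMacaulay_coordinateRing_equalVariances :
    IsCohenMacaulay (CoordinateRing (equalVariances 2 3)) := by
  unfold CoordinateRing
  rw [homogeneousIdeal_equalVariances_eq]
  exact isCohenMacaulay_hilbertBurch

end EqualVariances

end GaussianMoments

theorem mainTheorem11 :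
    (GaussianMoments.equalMeans 2 3 = GaussianMoments.gaussianVariety 2 3 ∧
      topologicalKrullDim (GaussianMoments.equalMeans 2 3) = 5 ∧
      GaussianMoments.HasDegree (GaussianMoments.equalMeans 2 3) 16) ∧
    (topologicalKrullDim (GaussianMoments.equalVariances 2 3) = 7 ∧
      GaussianMoments.HasDegree (GaussianMoments.equalVariances 2 3) 15 ∧
      GaussianMoments.IsCohenMacaulay
        (GaussianMoments.CoordinateRing (GaussianMoments.equalVariances 2 3)) ∧
      GaussianMoments.homogeneousIdeal (GaussianMoments.equalVariances 2 3) =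
        GaussianMoments.maximalMinors GaussianMoments.hilbertBurchMatrix) := by
  refine ⟨⟨GaussianMoments.equalMeans_eq_gaussianVariety, ?_, ?_⟩,
    GaussianMoments.topologicalKrullDim_equalVariances, GaussianMoments.hasDegree_equalVariances,
    GaussianMoments.isCohenMacaulay_coordinateRing_equalVariances,
    GaussianMoments.homogeneousIdeal_equalVariances_eq⟩
  · rw [GaussianMoments.equalMeans_eq_gaussianVariety]
    exact GaussianMoments.topologicalKrullDim_gaussianVariety
  · rw [GaussianMoments.equalMeans_eq_gaussianVariety]
    exact GaussianMoments.hasDegree_gaussianVariety
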